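/- Let $k$ be a field of characteristic zero, $d\ge 0$ an integer, and $A$ a unital associative $k$-algebra, with $A^e=A\otimes_k A^{\mathrm{op}}$. For a commutative ring $R$ and an $R$-algebra $B$ let $\bar C_n(B)=B\otimes_R(B/R)^{\otimes n}$ be the normalized Hochschild chains relative to $R$, with Hochschild differential $\mathsf b$ and Connes operator $\mathsf B$, and let $\overline{CC}{}^-_\bullet(B)=(\bar C_\bullet(B)[[u]],\mathsf b+u\mathsf B)$, where $u$ has homological degree $-2$, be the normalized negative cyclic complex; its homology is $HC^-_\bullet(B)$. A class $\eta\in HC^-_d(A)$ is non-degenerate if the morphism $\mathrm{RHom}_{A^e}(A,A^e)\to\Sigma^{-d}A$ in $D(A^e)$ defined by its image in $HH_d(A)$ is an isomorphism. Assume that $(A,\eta_0)$ is $d$-Calabi–Yau over $k$: $A$ has a finite resolution by finitely generated projective $A^e$-modules, and $\eta_0\in HC^-_d(A)$ is non-degenerate. Let $\hat\eta_0\in\overline{CC}{}^-_d(A)$ be a cycle with class $\eta_0$. Let $(R,m)$ be a commutative, finite dimensional, local $k$-algebra with $R/m=k$. Let $\mathrm{Def}_{A,\eta_0}(R)$ be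 the category whose objects are triples $(B,s,\eta)$ where $B$ is a flat $R$-algebra, $s:B\to A$ is an $R$-algebra map inducing an isomorphism $B\otimes_R k\cong A$, and $\eta\in HC^-_d(B)$ satisfies $s(\eta)=\eta_0$; a morphism $(B_1,s_1,\eta_1)\to(B_2,s_2,\eta_2)$ is an $R$-algebra map $\phi:B_1\to B_2$ with $s_2\phi=s_1$ and $\phi(\eta_1)=\eta_2$. Let $\mathrm{Def}^\flat_{A,\hat\eta_0}(R)$ be the category whose objects are pairs $(\mu,\eta)$ where $\mu$ is an $R$-bilinear map on $A\otimes_k R$ such that $-\mu$ is an associative multiplication with unit $1\otimes 1$ that reduces modulo $m$ to the multiplication of $A$, and $\eta\in\overline{CC}{}^-_d(A)\otimes_k R$ satisfies $(L_\mu+u\mathsf B)(\eta)=0$ and $\eta\equiv\hat\eta_0$ modulo $m$; here $L_\mu+u\mathsf B$ is the cyclic differential of the $R$-algebra $(A\otimes_kR,-\mu)$. A morphism $(\mu_1,\eta_1)\to(\mu_2,\eta_2)$ is a pair $(\phi,\xi)$ where $\phi:(A\otimes_kR,-\mu_1)\to(A\otimes_kR,-\mu_2)$ is a unital $R$-algebra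 map that is the identity modulo $m$, and $\xi\in\overline{CC}{}^-_{d+1}(A)\otimes_k m$ satisfies $(L_{\mu_2}+u\mathsf B)(\xi)=\phi(\eta_1)-\eta_2$; composition is $(\phi,\xi)\circ(\phi',\xi')=(\phi\phi',\phi(\xi')+\xi)$. Then both categories are groupoids, and the functor $$\mathrm{Def}^\flat_{A,\hat\eta_0}(R)\to\mathrm{Def}_{A,\eta_0}(R),\qquad (\mu,\eta)\mapsto\big((A\otimes_kR,-\mu),\ \mathrm{mod}\ m,\ \bar\eta\big),\qquad(\phi,\xi)\mapsto\phi,$$ where $\bar\eta$ is the class of $\eta$, is essentially surjective on objects and surjective on morphisms: for all objects $X,Y$ of $\mathrm{Def}^\flat_{A,\hat\eta_0}(R)$ it maps $\mathrm{Hom}(X,Y)$ onto the set of morphisms between the images of $X$ and $Y$. -/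

import Mathlib

open scoped TensorProduct
open CategoryTheory

universe u v w

noncomputable section

namespace CYDef

section Chains

variable (R : Type u) [CommRing R] (B : Type v) [Ring B] [Algebra R B]

/-- The Hochschild chains `B^{⊗(n+1)}` of degree `n`, relative to `R`. -/
abbrev Chain (n : ℕ) : Type _ := ⨂[R] (_ : Fin (n + 1)), B

/-- The span of the `b₀ ⊗ ⋯ ⊗ bₙ` with `bᵢ = 1` for some `i ≥ 1`. -/
def degenerate (n : ℕ) : Submodule R (Chain R B n) :=
  Submodule.span R {t | ∃ x : Fin (n + 1) → B, (∃ i, i ≠ 0 ∧ x i = 1) ∧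
    t = PiTensorProduct.tprod R x}

/-- The normalized Hochschild chains `C̄ₙ(B) = B ⊗ (B/R)^{⊗n}`, as a quotient of `B^{⊗(n+1)}`. -/
def NChain (n : ℕ) : Type (max u v) := Chain R B n ⧸ degenerate R B n

instance (n : ℕ) : AddCommGroup (NChain R B n) :=
  inferInstanceAs (AddCommGroup (Chain R B n ⧸ degenerate R B n))

instance (n : ℕ) : Module R (NChain R B n) :=
  inferInstanceAs (Module R (Chain R B n ⧸ degenerate R B n))

/-- The class of a chain in the normalized chains. -/
def NChain.mk (n : ℕ) : Chain R B n →ₗ[R] NChain R B n := (degenerate R B n).mkQ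

variable {B}

theorem contractNth_update {n : ℕ} (j : Fin (n + 1)) (x : Fin (n + 2) → B) (i : Fin (n + 2)) :
    ∃ (l : Fin (n + 1)) (g : B →ₗ[R] B), ∀ a,
      Fin.contractNth j.castSucc (· * ·) (Function.update x i a) =
        Function.update (Fin.contractNth j.castSucc (· * ·) x) l (g a) := by
  rcases lt_trichotomy (i : ℕ) j with h | h | h
  · refine ⟨⟨i, by omega⟩, LinearMap.id, fun a => ?_⟩
    funext l
    simp only [Fin.contractNth, Function.update_apply, Fin.ext_iff, Fin.val_castSucc, Fin.val_succ,
      LinearMap.id_apply]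
    split_ifs <;> first | rfl | omega
  · refine ⟨j, LinearMap.mulRight R (x j.succ), fun a => ?_⟩
    funext l
    by_cases hl : l = j
    · subst hl
      simp [Fin.contractNth, Function.update_apply, Fin.ext_iff, h]
    · have : (l : ℕ) ≠ j := fun e => hl (Fin.ext e)
      simp only [Fin.contractNth, Function.update_apply, Fin.ext_iff, Fin.val_castSucc,
        Fin.val_succ]
      split_ifs <;> first | rfl | omega
  · by_cases h' : (i : ℕ) = j + 1
    · refine ⟨j, LinearMap.mulLeft R (x j.castSucc), fun a => ?_⟩
      funext l
      by_cases hl : l = j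
      · subst hl
        simp [Fin.contractNth, Function.update_apply, Fin.ext_iff, h']
      · have : (l : ℕ) ≠ j := fun e => hl (Fin.ext e)
        simp only [Fin.contractNth, Function.update_apply, Fin.ext_iff, Fin.val_castSucc,
          Fin.val_succ]
        split_ifs <;> first | rfl | omega
    · refine ⟨⟨i - 1, by omega⟩, LinearMap.id, fun a => ?_⟩
      funext l
      simp only [Fin.contractNth, Function.update_apply, Fin.ext_iff, Fin.val_castSucc,
        Fin.val_succ, LinearMap.id_apply]
      split_ifs <;> first | rfl | omega

/-- The multilinear map `(b₀, …, bₙ₊₁) ↦ b₀ ⊗ ⋯ ⊗ bⱼbⱼ₊₁ ⊗ ⋯ ⊗ bₙ₊₁`. -/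
def innerFace {n : ℕ} (j : Fin (n + 1)) :
    MultilinearMap R (fun _ : Fin (n + 2) => B) (Chain R B n) :=
  MultilinearMap.mk'
    (fun x => PiTensorProduct.tprod R (Fin.contractNth j.castSucc (· * ·) x))
    (fun x i a b => by
      obtain ⟨l, g, hg⟩ := contractNth_update R j x i
      simp only [hg, map_add, MultilinearMap.map_update_add])
    (fun x i c a => by
      obtain ⟨l, g, hg⟩ := contractNth_update R j x i
      simp only [hg, map_smul, MultilinearMap.map_update_smul])

@[simp]
theorem innerFace_apply {n : ℕ} (j : Fin (n + 1)) (x : Fin (n + 2) → B) :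
    innerFace R j x = PiTensorProduct.tprod R (Fin.contractNth j.castSucc (· * ·) x) := rfl

/-- The multilinear map `(b₀, …, bₙ₊₁) ↦ bₙ₊₁b₀ ⊗ b₁ ⊗ ⋯ ⊗ bₙ`. -/
def lastFace (n : ℕ) : MultilinearMap R (fun _ : Fin (n + 2) => B) (Chain R B n) :=
  (innerFace R (0 : Fin (n + 1))).domDomCongr (Equiv.subRight (1 : Fin (n + 2)))

theorem lastFace_apply {n : ℕ} (x : Fin (n + 2) → B) :
    lastFace R n x = PiTensorProduct.tprod R
      (Fin.cons (x (Fin.last _) * x 0) (fun i : Fin n => x i.succ.castSucc)) := by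
  simp only [lastFace, MultilinearMap.domDomCongr_apply, innerFace_apply]
  congr 1
  funext l
  have h0 : (0 : Fin (n + 2)) - 1 = Fin.last _ := by
    rw [sub_eq_iff_eq_add, Fin.last_add_one]
  refine Fin.cases ?_ (fun l => ?_) l
  · simp [Fin.contractNth, h0]
  · have h1 : (l.succ.succ : Fin (n + 2)) - 1 = l.succ.castSucc := by
      rw [sub_eq_iff_eq_add, Fin.coeSucc_eq_succ]
    simp [Fin.contractNth, h1]

variable (B)

/-- The Hochschild differential
`b(b₀⊗⋯⊗bₙ₊₁) = ∑ⱼ (-1)^j b₀⊗⋯⊗bⱼbⱼ₊₁⊗⋯⊗bₙ₊₁ + (-1)^(n+1) bₙ₊₁b₀⊗b₁⊗⋯⊗bₙ`. -/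
def hochschildB (n : ℕ) : Chain R B (n + 1) →ₗ[R] Chain R B n :=
  PiTensorProduct.lift (∑ j : Fin (n + 1), (-1 : R) ^ (j : ℕ) • innerFace R j +
    (-1 : R) ^ (n + 1) • lastFace R n)

/-- The Connes operator for normalized chains,
`B(b₀⊗⋯⊗bₙ) = ∑ᵢ (-1)^(n i) 1⊗bᵢ⊗⋯⊗bₙ⊗b₀⊗⋯⊗bᵢ₋₁`. -/
def connesB (n : ℕ) : Chain R B n →ₗ[R] Chain R B (n + 1) :=
  PiTensorProduct.lift (∑ i : Fin (n + 1), (-1 : R) ^ (n * (i : ℕ)) •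
    MultilinearMap.domDomCongr (Equiv.addRight i)
      ((PiTensorProduct.tprod R : MultilinearMap R (fun _ : Fin (n + 2) => B) _).curryLeft 1))

variable {B}

theorem hochschildB_tprod {n : ℕ} (x : Fin (n + 2) → B) :
    hochschildB R B n (PiTensorProduct.tprod R x) =
      ∑ j : Fin (n + 1), (-1 : R) ^ (j : ℕ) •
        PiTensorProduct.tprod R (Fin.contractNth j.castSucc (· * ·) x) +
      (-1 : R) ^ (n + 1) • PiTensorProduct.tprod R
        (Fin.cons (x (Fin.last _) * x 0) (fun i : Fin n => x i.succ.castSucc)) := by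
  simp [hochschildB, lastFace_apply]

theorem connesB_tprod {n : ℕ} (x : Fin (n + 1) → B) :
    connesB R B n (PiTensorProduct.tprod R x) =
      ∑ i : Fin (n + 1), (-1 : R) ^ (n * (i : ℕ)) •
        PiTensorProduct.tprod R (Fin.cons (1 : B) (fun l => x (l + i))) := by
  simp [connesB]

variable {R}

theorem tprod_mem_degenerate {n : ℕ} (x : Fin (n + 1) → B) (i : Fin (n + 1)) (hi : i ≠ 0)
    (hx : x i = 1) : PiTensorProduct.tprod R x ∈ degenerate R B n :=
  Submodule.subset_span ⟨x, ⟨i, hi, hx⟩, rfl⟩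

variable (R B)

theorem connesB_degenerate (n : ℕ) :
    degenerate R B n ≤ (degenerate R B (n + 1)).comap (connesB R B n) := by
  refine Submodule.span_le.2 ?_
  rintro _ ⟨x, ⟨i, hi, hx⟩, rfl⟩
  simp only [Submodule.comap_coe, Set.mem_preimage, connesB_tprod, SetLike.mem_coe]
  refine Submodule.sum_mem _ fun l _ => Submodule.smul_mem _ _ ?_
  refine tprod_mem_degenerate _ (i - l).succ (Fin.succ_ne_zero _) ?_
  simp [hx]

theorem hochschildB_degenerate (n : ℕ) :
    degenerate R B (n + 1) ≤ (degenerate R B n).comap (hochschildB R B n) := by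
  refine Submodule.span_le.2 ?_
  rintro _ ⟨x, ⟨i, hi, hx⟩, rfl⟩
  simp only [Submodule.comap_coe, Set.mem_preimage, hochschildB_tprod, SetLike.mem_coe]
  obtain ⟨i, rfl⟩ := Fin.exists_succ_eq.2 hi
  have inner : ∀ j : Fin (n + 1), (j : ℕ) ≠ i → (j : ℕ) ≠ i + 1 →
      PiTensorProduct.tprod R (Fin.contractNth j.castSucc (· * ·) x) ∈ degenerate R B n := by
    intro j h1 h2
    rcases lt_or_ge (j : ℕ) i with h | h
    · refine tprod_mem_degenerate _ i (by intro e; subst e; simp at h) ?_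
      rw [Fin.contractNth_apply_of_gt _ _ _ _ (by simpa using h), hx]
    · have hi1 : (i : ℕ) + 1 < n + 1 := by omega
      refine tprod_mem_degenerate _ ⟨i + 1, hi1⟩
        (fun e => absurd (congrArg Fin.val e) (Nat.succ_ne_zero _)) ?_
      rw [Fin.contractNth_apply_of_lt _ _ _ _ (by simp; omega), ← hx]
      congr 1
  have key : ∀ l : Fin (n + 1), Fin.contractNth i.castSucc (· * ·) x l =
      if (l : ℕ) ≤ i then x l.castSucc else x l.succ := by
    intro l
    rcases lt_trichotomy (l : ℕ) i with h | h | h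
    · rw [Fin.contractNth_apply_of_lt _ _ _ _ (by simpa using h), if_pos h.le]
    · have : l = i := Fin.ext h
      subst this
      rw [Fin.contractNth_apply_of_eq _ _ _ _ (by simp), hx, if_pos le_rfl, mul_one]
    · rw [Fin.contractNth_apply_of_gt _ _ _ _ (by simpa using h), if_neg (by omega)]
  by_cases hn : (i : ℕ) = n
  · -- the `1` is in last position
    have hil : i = Fin.last n := Fin.ext hn
    subst hil
    rw [Fin.sum_univ_castSucc, add_assoc]
    refine Submodule.add_mem _ (Submodule.sum_mem _ fun j _ => Submodule.smul_mem _ _ ?_) ?_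
    · exact inner _ (by simp; omega) (by simp; omega)
    · have : Fin.contractNth (Fin.last n).castSucc (· * ·) x =
          Fin.cons (x (Fin.last _) * x 0) (fun i : Fin n => x i.succ.castSucc) := by
        funext l
        rw [key]
        rw [Fin.succ_last] at hx
        refine Fin.cases ?_ (fun l => ?_) l
        · simp [hx]
        · have : (l.succ : ℕ) ≤ Fin.last n := by simp
          rw [if_pos this]; simp
      rw [this, pow_succ]
      simp
  · have hlt : (i : ℕ) + 1 < n + 1 := by omega
    refine Submodule.add_mem _ ?_ (Submodule.smul_mem _ _ ?_)
    · set i' : Fin (n + 1) := ⟨i + 1, hlt⟩ with hi'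
      have hne : i ≠ i' := by simp [hi', Fin.ext_iff]
      rw [← Finset.add_sum_erase _ _ (Finset.mem_univ i),
        ← Finset.add_sum_erase _ _ (Finset.mem_erase.2 ⟨hne.symm, Finset.mem_univ i'⟩), ← add_assoc]
      refine Submodule.add_mem _ ?_ (Submodule.sum_mem _ fun j hj => Submodule.smul_mem _ _ ?_)
      · have : Fin.contractNth i'.castSucc (· * ·) x =
            Fin.contractNth i.castSucc (· * ·) x := by
          funext l
          rw [key]
          rcases lt_trichotomy (l : ℕ) i' with h | h | h
          · rw [Fin.contractNth_apply_of_lt _ _ _ _ (by simpa using h), if_pos (by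
              simp [hi'] at h; omega)]
          · rw [Fin.contractNth_apply_of_eq _ _ _ _ (by simpa using h), if_neg (by
              simp [hi'] at h; omega)]
            have : l.castSucc = i.succ := Fin.ext (by simpa [hi'] using h)
            rw [this, hx, one_mul]
          · rw [Fin.contractNth_apply_of_gt _ _ _ _ (by simpa using h), if_neg (by
              simp [hi'] at h; omega)]
        rw [this]
        simp [hi', pow_succ]
      · simp only [Finset.mem_erase, Finset.mem_univ, and_true] at hj
        exact inner j (fun e => hj.2 (Fin.ext e)) (fun e => hj.1 (Fin.ext (by simpa [hi'] using e)))
    · refine tprod_mem_degenerate _ ⟨i + 1, hlt⟩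
        (fun e => absurd (congrArg Fin.val e) (Nat.succ_ne_zero _)) ?_
      have : (⟨i + 1, hlt⟩ : Fin (n + 1)) = Fin.succ ⟨i, by omega⟩ := rfl
      rw [this, Fin.cons_succ, ← hx]
      congr 1

/-- The Hochschild differential on normalized chains. -/
def b (n : ℕ) : NChain R B (n + 1) →ₗ[R] NChain R B n :=
  Submodule.mapQ _ _ (hochschildB R B n) (hochschildB_degenerate R B n)

/-- The Connes differential on normalized chains. -/
def connes (n : ℕ) : NChain R B n →ₗ[R] NChain R B (n + 1) :=
  Submodule.mapQ _ _ (connesB R B n) (connesB_degenerate R B n)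

theorem b_mk (n : ℕ) (x : Chain R B (n + 1)) :
    b R B n (NChain.mk R B (n + 1) x) = NChain.mk R B n (hochschildB R B n x) := rfl

theorem connes_mk (n : ℕ) (x : Chain R B n) :
    connes R B n (NChain.mk R B n x) = NChain.mk R B (n + 1) (connesB R B n x) := rfl

/-- The graded module underlying the normalized negative cyclic complex is
`C̄_•(B)[[u]]` with `u` of homological degree `-2`, so a homogeneous element of degree `n` is a
series `∑ᵢ xᵢ uⁱ` with `xᵢ` in `C̄_{n+2i}(B)`.  Since `n` and the chain degree determine the exponent
of `u`, such an element is stored as the family of its components in all chain degrees. -/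
abbrev Tot : Type (max u v) := ∀ m : ℕ, NChain R B m

/-- The elements of degree `n` of the normalized negative cyclic complex: the components in chain
degrees not of the form `n + 2i`, `i ≥ 0`, vanish. -/
def CC (n : ℤ) : Submodule R (Tot R B) where
  carrier := {x | ∀ m : ℕ, (¬ ∃ i : ℕ, (m : ℤ) = n + 2 * i) → x m = 0}
  add_mem' hx hy m hm := by simp [hx m hm, hy m hm]
  zero_mem' _ _ := rfl
  smul_mem' r x hx m hm := by simp [hx m hm]

/-- The component of `u B(x)` in chain degree `m`. -/
def uConnes : (m : ℕ) → Tot R B →ₗ[R] NChain R B m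
  | 0 => 0
  | m + 1 => connes R B m ∘ₗ LinearMap.proj m

/-- The cyclic differential `b + uB`. -/
def cyclicD : Tot R B →ₗ[R] Tot R B :=
  LinearMap.pi fun m => b R B m ∘ₗ LinearMap.proj (m + 1) + uConnes R B m

/-- The cycles of degree `n` of the normalized negative cyclic complex. -/
def cycles (n : ℤ) : Submodule R (Tot R B) := CC R B n ⊓ LinearMap.ker (cyclicD R B)

/-- The boundaries of degree `n` of the normalized negative cyclic complex. -/
def boundaries (n : ℤ) : Submodule R (Tot R B) := (CC R B (n + 1)).map (cyclicD R B)

/-- Negative cyclic homology `HC⁻ₙ(B)`, relative to `R`. -/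
def HC (n : ℤ) : Type (max u v) :=
  cycles R B n ⧸ (boundaries R B n).submoduleOf (cycles R B n)

instance (n : ℤ) : AddCommGroup (HC R B n) :=
  Submodule.Quotient.addCommGroup ((boundaries R B n).submoduleOf (cycles R B n))

instance (n : ℤ) : Module R (HC R B n) :=
  Submodule.Quotient.module ((boundaries R B n).submoduleOf (cycles R B n))

/-- The homology class of a cycle. -/
def HC.mk (n : ℤ) : cycles R B n →ₗ[R] HC R B n :=
  ((boundaries R B n).submoduleOf (cycles R B n)).mkQ

end Chains

section Functoriality

variable {R : Type u} [CommRing R] {B : Type v} [Ring B] [Algebra R B]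
variable {S : Type*} [CommRing S] {C : Type*} [Ring C] [Algebra S C]

/-- The ring homomorphism `f` is a morphism of algebras over the ring homomorphism `σ`. -/
def IsAlgOver (σ : R →+* S) (f : B →+* C) : Prop :=
  ∀ r, f (algebraMap R B r) = algebraMap S C (σ r)

theorem IsAlgOver.map_smul {σ : R →+* S} {f : B →+* C} (h : IsAlgOver σ f) (r : R) (x : B) :
    f (r • x) = σ r • f x := by
  rw [Algebra.smul_def, map_mul, h, Algebra.smul_def]

theorem IsAlgOver.comp {T D : Type*} [CommRing T] [Ring D] [Algebra T D] {σ : R →+* S}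
    {f : B →+* C} {τ : S →+* T} {g : C →+* D} (hg : IsAlgOver τ g) (hf : IsAlgOver σ f) :
    IsAlgOver (τ.comp σ) (g.comp f) := fun r => by
  simp [hf r, hg (σ r)]

/-- `b₀ ⊗ ⋯ ⊗ bₙ ↦ f(b₀) ⊗ ⋯ ⊗ f(bₙ)`. -/
def chainMap {σ : R →+* S} {f : B →+* C} (h : IsAlgOver σ f) (n : ℕ) :
    Chain R B n →ₛₗ[σ] Chain S C n :=
  letI : Module R (Chain S C n) := Module.compHom _ σ
  let L : Chain R B n →ₗ[R] Chain S C n := PiTensorProduct.lift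
    (MultilinearMap.mk' (fun x => PiTensorProduct.tprod S (f ∘ x))
      (fun x i a b => by
        simp only [Function.comp_update, map_add, MultilinearMap.map_update_add])
      (fun x i c a => by
        simp only [Function.comp_update, h.map_smul, MultilinearMap.map_update_smul]
        rfl))
  { toFun := L
    map_add' := L.map_add
    map_smul' := L.map_smul }

@[simp]
theorem chainMap_tprod {σ : R →+* S} {f : B →+* C} (h : IsAlgOver σ f) (n : ℕ)
    (x : Fin (n + 1) → B) :
    chainMap h n (PiTensorProduct.tprod R x) = PiTensorProduct.tprod S (f ∘ x) := by
  let : Module R (Chain S C n) := Module.compHom _ σ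
  exact PiTensorProduct.lift.tprod (R := R) (E := Chain S C n) x

theorem chain_ext {σ : R →+* S} {n : ℕ} {N : Type*} [AddCommGroup N] [Module S N]
    {f g : Chain R B n →ₛₗ[σ] N}
    (h : ∀ x, f (PiTensorProduct.tprod R x) = g (PiTensorProduct.tprod R x)) : f = g := by
  ext t
  induction t using PiTensorProduct.induction_on with
  | smul_tprod r x => simp [h]
  | add a b ha hb => simp [ha, hb]

theorem chainMap_degenerate {σ : R →+* S} {f : B →+* C} (h : IsAlgOver σ f) (n : ℕ) :
    degenerate R B n ≤ (degenerate S C n).comap (chainMap h n) := by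
  refine Submodule.span_le.2 ?_
  rintro _ ⟨x, ⟨i, hi, hx⟩, rfl⟩
  simp only [Submodule.comap_coe, Set.mem_preimage, chainMap_tprod, SetLike.mem_coe]
  exact tprod_mem_degenerate _ i hi (by simp [hx])

/-- The map induced on normalized chains by a morphism of algebras. -/
def nchainMap {σ : R →+* S} {f : B →+* C} (h : IsAlgOver σ f) (n : ℕ) :
    NChain R B n →ₛₗ[σ] NChain S C n :=
  Submodule.mapQ _ _ (chainMap h n) (chainMap_degenerate h n)

theorem nchainMap_mk {σ : R →+* S} {f : B →+* C} (h : IsAlgOver σ f) (n : ℕ) (x : Chain R B n) :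
    nchainMap h n (NChain.mk R B n x) = NChain.mk S C n (chainMap h n x) := rfl

theorem nchain_ext {σ : R →+* S} {n : ℕ} {N : Type*} [AddCommGroup N] [Module S N]
    {f g : NChain R B n →ₛₗ[σ] N}
    (h : ∀ x, f (NChain.mk R B n (PiTensorProduct.tprod R x)) =
      g (NChain.mk R B n (PiTensorProduct.tprod R x))) : f = g := by
  refine Submodule.linearMap_qext _ (chain_ext fun x => ?_)
  exact h x

theorem b_nchainMap {σ : R →+* S} {f : B →+* C} (h : IsAlgOver σ f) (n : ℕ)
    (x : NChain R B (n + 1)) :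
    b S C n (nchainMap h (n + 1) x) = nchainMap h n (b R B n x) := by
  suffices H : (b S C n).comp (nchainMap h (n + 1)) = (nchainMap h n).comp (b R B n) from
    LinearMap.congr_fun H x
  refine nchain_ext fun x => ?_
  simp only [LinearMap.comp_apply, nchainMap_mk, b_mk, chainMap_tprod, hochschildB_tprod]
  congr 1
  simp only [map_add, map_sum, map_smulₛₗ, chainMap_tprod, map_pow, map_neg, map_one]
  congr 1
  · refine Finset.sum_congr rfl fun j _ => ?_
    rw [Fin.comp_contractNth (· * ·) (· * ·) (map_mul f)]
  · congr 2
    funext l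
    refine Fin.cases ?_ (fun l => ?_) l <;> simp

theorem connes_nchainMap {σ : R →+* S} {f : B →+* C} (h : IsAlgOver σ f) (n : ℕ)
    (x : NChain R B n) :
    connes S C n (nchainMap h n x) = nchainMap h (n + 1) (connes R B n x) := by
  suffices H : (connes S C n).comp (nchainMap h n) = (nchainMap h (n + 1)).comp (connes R B n) from
    LinearMap.congr_fun H x
  refine nchain_ext fun x => ?_
  simp only [LinearMap.comp_apply, nchainMap_mk, connes_mk, chainMap_tprod, connesB_tprod]
  congr 1
  simp only [map_sum, map_smulₛₗ, chainMap_tprod, map_pow, map_neg, map_one]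
  refine Finset.sum_congr rfl fun j _ => ?_
  congr 2
  funext l
  refine Fin.cases ?_ (fun l => ?_) l <;> simp

/-- The map induced on `C̄_•[[u]]` by a morphism of algebras. -/
def totMap {σ : R →+* S} {f : B →+* C} (h : IsAlgOver σ f) : Tot R B →ₛₗ[σ] Tot S C where
  toFun x m := nchainMap h m (x m)
  map_add' x y := by funext m; simp
  map_smul' r x := by funext m; simp

theorem cyclicD_totMap {σ : R →+* S} {f : B →+* C} (h : IsAlgOver σ f) (x : Tot R B) :
    cyclicD S C (totMap h x) = totMap h (cyclicD R B x) := by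
  funext m
  cases m with
  | zero => simp [cyclicD, uConnes, totMap, b_nchainMap]
  | succ m => simp [cyclicD, uConnes, totMap, b_nchainMap, connes_nchainMap]

theorem totMap_mem_CC {σ : R →+* S} {f : B →+* C} (h : IsAlgOver σ f) {n : ℤ} {x : Tot R B}
    (hx : x ∈ CC R B n) : totMap h x ∈ CC S C n := fun m hm => by
  simp [totMap, hx m hm]

theorem totMap_mem_cycles {σ : R →+* S} {f : B →+* C} (h : IsAlgOver σ f) {n : ℤ} {x : Tot R B}
    (hx : x ∈ cycles R B n) : totMap h x ∈ cycles S C n :=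
  ⟨totMap_mem_CC h hx.1, by
    have h0 : cyclicD R B x = 0 := hx.2
    change cyclicD S C (totMap h x) = 0
    rw [cyclicD_totMap, h0, map_zero]⟩

theorem totMap_mem_boundaries {σ : R →+* S} {f : B →+* C} (h : IsAlgOver σ f) {n : ℤ}
    {x : Tot R B} (hx : x ∈ boundaries R B n) : totMap h x ∈ boundaries S C n := by
  obtain ⟨y, hy, rfl⟩ := hx
  exact ⟨totMap h y, totMap_mem_CC h hy, cyclicD_totMap h y⟩

/-- The map induced on elements of degree `n` of the normalized negative cyclic complex. -/
def ccMap {σ : R →+* S} {f : B →+* C} (h : IsAlgOver σ f) (n : ℤ) :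
    CC R B n →ₛₗ[σ] CC S C n :=
  ((totMap h).domRestrict _).codRestrict _ fun x => totMap_mem_CC h x.2

/-- The map induced on cycles. -/
def cyclesMap {σ : R →+* S} {f : B →+* C} (h : IsAlgOver σ f) (n : ℤ) :
    cycles R B n →ₛₗ[σ] cycles S C n :=
  ((totMap h).domRestrict _).codRestrict _ fun x => totMap_mem_cycles h x.2

/-- The map induced on negative cyclic homology. -/
def HC.map {σ : R →+* S} {f : B →+* C} (h : IsAlgOver σ f) (n : ℤ) :
    HC R B n →ₛₗ[σ] HC S C n :=
  Submodule.mapQ _ _ (cyclesMap h n) fun _ hx => totMap_mem_boundaries h hx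

theorem nchainMap_comp {T D : Type*} [CommRing T] [Ring D] [Algebra T D] {σ : R →+* S}
    {f : B →+* C} {τ : S →+* T} {g : C →+* D} (hg : IsAlgOver τ g) (hf : IsAlgOver σ f) (n : ℕ)
    (x : NChain R B n) :
    nchainMap (hg.comp hf) n x = nchainMap hg n (nchainMap hf n x) := by
  have : RingHomCompTriple σ τ (τ.comp σ) := ⟨rfl⟩
  suffices H : nchainMap (hg.comp hf) n = (nchainMap hg n).comp (nchainMap hf n) from
    LinearMap.congr_fun H x
  refine nchain_ext fun x => ?_
  simp [nchainMap_mk, Function.comp_assoc]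

theorem nchainMap_id {h : IsAlgOver (RingHom.id R) (RingHom.id B)} (n : ℕ) (x : NChain R B n) :
    nchainMap h n x = x := by
  suffices H : nchainMap h n = LinearMap.id from LinearMap.congr_fun H x
  refine nchain_ext fun x => ?_
  simp [nchainMap_mk]

theorem totMap_comp {T D : Type*} [CommRing T] [Ring D] [Algebra T D] {σ : R →+* S}
    {f : B →+* C} {τ : S →+* T} {g : C →+* D} (hg : IsAlgOver τ g) (hf : IsAlgOver σ f)
    (x : Tot R B) : totMap (hg.comp hf) x = totMap hg (totMap hf x) :=
  funext fun m => nchainMap_comp hg hf m (x m)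

theorem totMap_id {h : IsAlgOver (RingHom.id R) (RingHom.id B)} (x : Tot R B) :
    totMap h x = x :=
  funext fun m => nchainMap_id m (x m)

theorem HC.map_mk {σ : R →+* S} {f : B →+* C} (h : IsAlgOver σ f) (n : ℤ) (x : cycles R B n) :
    HC.map h n (HC.mk R B n x) = HC.mk S C n (cyclesMap h n x) := rfl

theorem HC.mk_eq_mk {n : ℤ} {x y : cycles R B n}
    (h : (x : Tot R B) - y ∈ boundaries R B n) : HC.mk R B n x = HC.mk R B n y :=
  (Submodule.Quotient.eq _).2 h

theorem coe_ccMap {σ : R →+* S} {f : B →+* C} (h : IsAlgOver σ f) (n : ℤ) (x : CC R B n) :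
    (ccMap h n x : Tot S C) = totMap h x := rfl

theorem HC.map_comp {T D : Type*} [CommRing T] [Ring D] [Algebra T D] {σ : R →+* S}
    {f : B →+* C} {τ : S →+* T} {g : C →+* D} (hg : IsAlgOver τ g) (hf : IsAlgOver σ f) (n : ℤ)
    (x : HC R B n) : HC.map (hg.comp hf) n x = HC.map hg n (HC.map hf n x) := by
  obtain ⟨x, rfl⟩ := Submodule.mkQ_surjective _ x
  exact congrArg (HC.mk T D n) (Subtype.ext (totMap_comp hg hf x.1))

theorem HC.map_id {h : IsAlgOver (RingHom.id R) (RingHom.id B)} (n : ℤ) (x : HC R B n) :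
    HC.map h n x = x := by
  obtain ⟨x, rfl⟩ := Submodule.mkQ_surjective _ x
  exact congrArg (HC.mk R B n) (Subtype.ext (totMap_id x.1))

theorem isAlgOver_algHom {C : Type*} [Ring C] [Algebra R C] (φ : B →ₐ[R] C) :
    IsAlgOver (RingHom.id R) (φ : B →+* C) := φ.commutes

theorem ccMap_mem_smul_top {C : Type*} [Ring C] [Algebra R C]
    (φ : B →ₐ[R] C) (I : Ideal R) (n : ℤ) {ξ : CC R B n}
    (h : ξ ∈ I • (⊤ : Submodule R (CC R B n))) :
    ccMap (isAlgOver_algHom φ) n ξ ∈ I • (⊤ : Submodule R (CC R C n)) := by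
  refine Submodule.smul_induction_on h (fun r hr x _ => ?_) (fun x y hx hy => ?_)
  · rw [map_smul]
    exact Submodule.smul_mem_smul hr trivial
  · rw [map_add]
    exact Submodule.add_mem _ hx hy

theorem totMap_algHom_comp {C D : Type*} [Ring C] [Algebra R C] [Ring D] [Algebra R D]
    (ψ : C →ₐ[R] D) (φ : B →ₐ[R] C) (x : Tot R B) :
    totMap (isAlgOver_algHom (ψ.comp φ)) x =
      totMap (isAlgOver_algHom ψ) (totMap (isAlgOver_algHom φ) x) :=
  totMap_comp (isAlgOver_algHom ψ) (isAlgOver_algHom φ) x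

theorem totMap_algHom_id (x : Tot R B) : totMap (isAlgOver_algHom (AlgHom.id R B)) x = x :=
  totMap_id x

end Functoriality

section CalabiYau

/-- A module is perfect if it has a finite resolution by finitely generated projectives. -/
def IsPerfect (S : Type w) [Ring S] (M : Type w) [AddCommGroup M] [Module S M] : Prop :=
  ∃ P : ProjectiveResolution (ModuleCat.of S M),
    (∀ i, Module.Finite S (P.complex.X i)) ∧
      ∃ N : ℕ, ∀ i, N < i → Subsingleton (P.complex.X i)

variable (k : Type u) [Field k] (A : Type w) [Ring A] [Algebra k A]

/-- `A` is homologically smooth over `k`: it is perfect as a module over `Aᵉ = A ⊗ Aᵒᵖ`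
(flatness over the field `k` is automatic). -/
def HomologicallySmooth : Prop :=
  letI : Module (A ⊗[k] Aᵐᵒᵖ) A := instModuleTensorProductMop k A
  IsPerfect (A ⊗[k] Aᵐᵒᵖ) A

/-- The normalized Hochschild cochains of degree `n` with values in `Aᵉ`.  Since `k` is a field,
these are the terms `Hom_{Aᵉ}(A ⊗ (A/k)^{⊗ n} ⊗ A, Aᵉ)` of the complex that computes
`RHom_{Aᵉ}(A, Aᵉ)` through the normalized bar resolution of `A`. -/
def Cochain (n : ℕ) : Submodule k (MultilinearMap k (fun _ : Fin n => A) (A ⊗[k] Aᵐᵒᵖ)) where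
  carrier := {f | ∀ x : Fin n → A, (∃ i, x i = 1) → f x = 0}
  add_mem' hf hg x hx := by simp [hf x hx, hg x hx]
  zero_mem' _ _ := rfl
  smul_mem' r f hf x hx := by simp [hf x hx]

variable {k A}

/-- The Hochschild coboundary
`(δf)(a₁, …, aₙ₊₁) = a₁ f(a₂, …) + ∑ⱼ (-1)^j f(…, aⱼaⱼ₊₁, …) + (-1)^(n+1) f(a₁, …, aₙ) aₙ₊₁`
for the outer bimodule structure `a (x ⊗ y) c = ax ⊗ yc` on `Aᵉ`, that is, left multiplication in
the ring `A ⊗ Aᵒᵖ`. -/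
def coboundary {n : ℕ} (f : Cochain k A n) (x : Fin (n + 1) → A) : A ⊗[k] Aᵐᵒᵖ :=
  (x 0 ⊗ₜ 1) * f.1 (Fin.tail x)
    + ∑ j : Fin n, (-1 : k) ^ ((j : ℕ) + 1) • f.1 (Fin.contractNth j.castSucc (· * ·) x)
    + (-1 : k) ^ (n + 1) • ((1 ⊗ₜ MulOpposite.op (x (Fin.last n))) * f.1 (Fin.init x))

/-- `f` is a cocycle. -/
def IsCocycle {n : ℕ} (f : Cochain k A n) : Prop := ∀ x, coboundary f x = 0

/-- `f` is a coboundary. -/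
def IsCoboundary : {n : ℕ} → Cochain k A n → Prop
  | 0, f => f = 0
  | _ + 1, f => ∃ g, ∀ x, f.1 x = coboundary g x

variable (k A)

/-- The right action of `Aᵉ` on `A`: `x ⊗ y` acts as `c ↦ y c x`. -/
def envAct : A ⊗[k] Aᵐᵒᵖ →ₗ[k] Module.End k A :=
  TensorProduct.lift (LinearMap.mk₂ k
    (fun x y => LinearMap.mulLeft k y.unop ∘ₗ LinearMap.mulRight k x)
    (fun x x' y => by ext; simp [mul_add])
    (fun r x y => by ext; simp)
    (fun x y y' => by ext; simp [add_mul])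
    (fun r x y => by ext; simp))

variable {k A}

/-- The multilinear map `(a₀, …, aₙ) ↦ a₀ · f(a₁, …, aₙ)`, the dot being the right action of `Aᵉ`
on `A`. -/
def evalMultilinear {n : ℕ} (f : Cochain k A n) :
    MultilinearMap k (fun _ : Fin (n + 1) => A) A :=
  LinearMap.uncurryLeft (M := fun _ : Fin (n + 1) => A)
    { toFun := fun c => ((envAct k A).flip c).compMultilinearMap f.1
      map_add' := fun c c' => by ext; simp
      map_smul' := fun r c => by ext; simp }

theorem evalMultilinear_apply {n : ℕ} (f : Cochain k A n) (x : Fin (n + 1) → A) :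
    evalMultilinear f x = envAct k A (f.1 (Fin.tail x)) (x 0) := rfl

/-- Evaluation of a cochain on the chains `C̄ₙ(A) = A ⊗_{Aᵉ} (A ⊗ (A/k)^{⊗ n} ⊗ A)`, with values in
`A = A ⊗_{Aᵉ} Aᵉ`. -/
def evalCochain {n : ℕ} (f : Cochain k A n) : NChain k A n →ₗ[k] A :=
  (degenerate k A n).liftQ (PiTensorProduct.lift (evalMultilinear f)) <| by
    refine Submodule.span_le.2 ?_
    rintro _ ⟨x, ⟨i, hi, hx⟩, rfl⟩
    obtain ⟨i, rfl⟩ := Fin.exists_succ_eq.2 hi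
    have : f.1 (Fin.tail x) = 0 := f.2 _ ⟨i, hx⟩
    simp [evalMultilinear_apply, this]

theorem evalCochain_mk {n : ℕ} (f : Cochain k A n) (x : Chain k A n) :
    evalCochain f (NChain.mk k A n x) = PiTensorProduct.lift (evalMultilinear f) x := rfl

/-- A Hochschild cycle `z` of degree `d` is nondegenerate if the morphism
`RHom_{Aᵉ}(A, Aᵉ) ⟶ Σ^{-d} A`, `f ↦ f(z)`, that it defines is an isomorphism in the derived category,
i.e. if it induces isomorphisms on the cohomology of the cochain complex `C̄^•(A, Aᵉ)`. -/
def IsNondegenerateCycle (d : ℕ) (z : NChain k A d) : Prop :=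
  (∀ n, n ≠ d → ∀ f : Cochain k A n, IsCocycle f → IsCoboundary f) ∧
  (∀ f : Cochain k A d, IsCocycle f → evalCochain f z = 0 → IsCoboundary f) ∧
  (∀ a : A, ∃ f : Cochain k A d, IsCocycle f ∧ evalCochain f z = a)

/-- A class in `HC⁻_d(A)` is nondegenerate if its image in `HH_d(A)`, the class of the coefficient
of `u⁰` of a representing cycle, is nondegenerate. -/
def IsNondegenerate (d : ℕ) (η : HC k A d) : Prop :=
  ∃ z : cycles k A d, HC.mk k A d z = η ∧ IsNondegenerateCycle d (z.1 d)

/-- `(A, η)` is a Calabi-Yau algebra of dimension `d` over the field `k`. -/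
def IsCalabiYau (d : ℕ) (η : HC k A d) : Prop :=
  HomologicallySmooth k A ∧ IsNondegenerate d η

end CalabiYau

section Deformations

/-- The local `k`-algebra `R` is finite dimensional with residue field `k`. -/
class Nilp (k : Type u) [Field k] (R : Type v) [CommRing R] [Algebra k R] [IsLocalRing R] :
    Prop where
  finite : Module.Finite k R
  bijective : Function.Bijective (algebraMap k (IsLocalRing.ResidueField R))

section Reduction

theorem isBaseChange_comp_equiv {R : Type*} [CommRing R] {S M N P : Type*} [CommRing S]
    [Algebra R S] [AddCommGroup M] [Module R M] [AddCommGroup N] [Module R N] [AddCommGroup P]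
    [Module R P] [Module S P] [IsScalarTower R S P] (e : M ≃ₗ[R] N) (h : N →ₗ[R] P)
    (H : IsBaseChange S h) : IsBaseChange S (h ∘ₗ e.toLinearMap) :=
  (IsBaseChange.ofEquiv e).comp H

variable (k : Type u) [Field k] (A : Type w) [Ring A] [Algebra k A]
variable (R : Type v) [CommRing R] [Algebra k R] [IsLocalRing R] [Nilp k R]

/-- The reduction `R → R/m = k`. -/
def aug : R →ₐ[k] k :=
  (AlgEquiv.ofBijective (Algebra.ofId k (IsLocalRing.ResidueField R))
    Nilp.bijective).symm.toAlgHom.comp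
      (IsScalarTower.toAlgHom k R (IsLocalRing.ResidueField R))

/-- The reduction modulo `m` as a map `A ⊗ R → A`.  We write the tensor product as `R ⊗ A`, since
it is considered as an `R`-module. -/
def modM : R ⊗[k] A →ₗ[k] A :=
  (TensorProduct.lid k A).toLinearMap ∘ₗ LinearMap.rTensor A (aug k R).toLinearMap

variable {k A R}

@[simp]
theorem modM_tmul (r : R) (a : A) : modM k A R (r ⊗ₜ a) = aug k R r • a := by
  simp [modM]

theorem modM_smul (r : R) (x : R ⊗[k] A) : modM k A R (r • x) = aug k R r • modM k A R x := by
  induction x using TensorProduct.induction_on with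
  | zero => simp
  | tmul s a => simp [TensorProduct.smul_tmul', mul_smul]
  | add x y hx hy => rw [smul_add, map_add, hx, hy, map_add, smul_add]

/-- Given an `R`-algebra map `s : B → A`, where `A` is an `R`-algebra through `R → R/m = k`, the
statement that `s` induces an isomorphism `k ⊗_R B → A`. -/
def IsReduction {B : Type*} [Ring B] [Algebra R B] {s : B →+* A}
    (hs : IsAlgOver (aug k R : R →+* k) s) : Prop :=
  letI : Algebra R k := (aug k R : R →+* k).toAlgebra
  letI : Module R A := Module.compHom A (aug k R : R →+* k)
  haveI : IsScalarTower R k A := ⟨fun r c a => mul_smul (aug k R r) c a⟩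
  IsBaseChange k ({ toFun := s, map_add' := map_add s, map_smul' := hs.map_smul } : B →ₗ[R] A)

end Reduction

variable (k : Type u) [Field k] (A : Type w) [Ring A] [Algebra k A]
variable (R : Type v) [CommRing R] [Algebra k R] [IsLocalRing R] [Nilp k R]

/-! ### The groupoid `Def_{A,η₀}(R)` -/

/-- The objects of `Def_{A,η₀}(R)`: triples `(B, s, η)`. -/
structure DefObj (d : ℕ) (η₀ : HC k A d) where
  B : Type (max v w)
  [ring : Ring B]
  [algebra : Algebra R B]
  flat : Module.Flat R B
  s : B →+* A
  isAlgOver : IsAlgOver (aug k R : R →+* k) s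
  isReduction : IsReduction isAlgOver
  η : HC R B d
  map_η : HC.map isAlgOver d η = η₀

attribute [instance] DefObj.ring DefObj.algebra

variable {k A R}

/-- The morphisms of `Def_{A,η₀}(R)`. -/
@[ext]
structure DefHom {d : ℕ} {η₀ : HC k A d} (X Y : DefObj k A R d η₀) where
  φ : X.B →ₐ[R] Y.B
  comm : ∀ x, Y.s (φ x) = X.s x
  map_η : HC.map (isAlgOver_algHom φ) d X.η = Y.η

instance {d : ℕ} {η₀ : HC k A d} : Category (DefObj k A R d η₀) where
  Hom := DefHom
  id X := ⟨AlgHom.id R X.B, fun _ => rfl, HC.map_id _ _⟩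
  comp f g := ⟨g.φ.comp f.φ, fun x => by simp [g.comm, f.comm], by
    rw [← g.map_η, ← f.map_η]
    exact HC.map_comp (isAlgOver_algHom g.φ) (isAlgOver_algHom f.φ) d _⟩

/-! ### The groupoid `Def♭_{A,η̂₀}(R)` -/

variable (k A R)

/-- The "inverse multiplications" `μ` on `A ⊗ R`: the product `-μ` is associative with unit `1 ⊗ 1`,
and reduces modulo `m` to the product of `A`. -/
structure InvMul where
  μ : R ⊗[k] A →ₗ[R] R ⊗[k] A →ₗ[R] R ⊗[k] A
  assoc : ∀ x y z, -μ (-μ x y) z = -μ x (-μ y z)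
  one_mul : ∀ x, -μ (1 ⊗ₜ 1) x = x
  mul_one : ∀ x, -μ x (1 ⊗ₜ 1) = x
  mod_m : ∀ x y, modM k A R (μ x y) = -(modM k A R x * modM k A R y)

variable {k A R}

namespace InvMul

variable (M : InvMul k A R)

theorem mu_add (x y z : R ⊗[k] A) : -M.μ x (y + z) = -M.μ x y + -M.μ x z := by
  rw [map_add, neg_add]

theorem add_mu (x y z : R ⊗[k] A) : -M.μ (x + y) z = -M.μ x z + -M.μ y z := by
  rw [map_add, LinearMap.add_apply, neg_add]

theorem zero_mu (x : R ⊗[k] A) : -M.μ 0 x = 0 := by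
  rw [map_zero, LinearMap.zero_apply, neg_zero]

theorem mu_zero (x : R ⊗[k] A) : -M.μ x 0 = 0 := by
  rw [map_zero, neg_zero]

theorem smul_mu (r : R) (x y : R ⊗[k] A) : -M.μ (r • x) y = r • -M.μ x y := by
  rw [map_smul, LinearMap.smul_apply, smul_neg]

theorem mu_smul (r : R) (x y : R ⊗[k] A) : -M.μ x (r • y) = r • -M.μ x y := by
  rw [map_smul, smul_neg]

theorem modM_mu (x y : R ⊗[k] A) :
    modM k A R (-M.μ x y) = modM k A R x * modM k A R y := by
  rw [map_neg, M.mod_m, neg_neg]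

/-- The `R`-algebra `(A ⊗ R, -μ)`: a copy of `A ⊗ R` with product `-μ`. -/
structure Alg (M : InvMul k A R) : Type (max v w) where
  /-- An element of `A ⊗ R`, seen in `(A ⊗ R, -μ)`. -/
  of ::
  /-- The underlying element of `A ⊗ R`. -/
  val : R ⊗[k] A

/-- The underlying bijection between `(A ⊗ R, -μ)` and `A ⊗ R`. -/
def valEquiv : M.Alg ≃ R ⊗[k] A := ⟨Alg.val, Alg.of, fun _ => rfl, fun _ => rfl⟩

instance : AddCommGroup M.Alg := M.valEquiv.addCommGroup

instance : Module R M.Alg := M.valEquiv.module R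

instance : Ring M.Alg where
  __ := (inferInstance : AddCommGroup M.Alg)
  mul x y := ⟨-M.μ x.val y.val⟩
  one := ⟨1 ⊗ₜ 1⟩
  mul_assoc x y z := congrArg Alg.of (M.assoc x.val y.val z.val)
  one_mul x := congrArg Alg.of (M.one_mul x.val)
  mul_one x := congrArg Alg.of (M.mul_one x.val)
  left_distrib x y z := congrArg Alg.of (M.mu_add x.val y.val z.val)
  right_distrib x y z := congrArg Alg.of (M.add_mu x.val y.val z.val)
  zero_mul x := congrArg Alg.of (M.zero_mu x.val)
  mul_zero x := congrArg Alg.of (M.mu_zero x.val)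

instance : Algebra R M.Alg :=
  Algebra.ofModule (fun r x y => congrArg Alg.of (M.smul_mu r x.val y.val))
    (fun r x y => congrArg Alg.of (M.mu_smul r x.val y.val))

/-- The underlying `R`-linear isomorphism between `(A ⊗ R, -μ)` and `A ⊗ R`. -/
def valLinearEquiv : M.Alg ≃ₗ[R] R ⊗[k] A where
  __ := M.valEquiv
  map_add' _ _ := rfl
  map_smul' _ _ := rfl

/-- The reduction modulo `m` as a ring homomorphism `(A ⊗ R, -μ) → A`. -/
def red : M.Alg →+* A where
  toFun x := modM k A R x.val
  map_one' := by
    change modM k A R ((1 : R) ⊗ₜ[k] (1 : A)) = 1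
    simp
  map_mul' x y := M.modM_mu x.val y.val
  map_zero' := map_zero (modM k A R)
  map_add' x y := map_add (modM k A R) x.val y.val

theorem red_isAlgOver : IsAlgOver (aug k R : R →+* k) M.red := fun r => by
  change modM k A R (r • ((1 : R) ⊗ₜ[k] (1 : A))) = _
  rw [modM_smul]
  simp [Algebra.algebraMap_eq_smul_one]

theorem flat : Module.Flat R M.Alg := Module.Flat.of_linearEquiv M.valLinearEquiv

theorem red_isReduction : IsReduction M.red_isAlgOver := by
  let : Algebra R k := (aug k R : R →+* k).toAlgebra
  let : Module R A := Module.compHom A (aug k R : R →+* k)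
  have : IsScalarTower R k A := ⟨fun r c a => mul_smul (aug k R r) c a⟩
  have : IsScalarTower k R k := IsScalarTower.of_algebraMap_eq fun c =>
    ((aug k R).commutes c).symm
  have : IsScalarTower k R A := ⟨fun c r a => by
    change aug k R (c • r) • a = c • (aug k R r • a)
    rw [map_smul, smul_assoc]⟩
  let h : R ⊗[k] A →ₗ[R] A :=
    { toFun := modM k A R
      map_add' := map_add _
      map_smul' := modM_smul }
  have H : IsBaseChange k h := by
    refine IsBaseChange.of_comp (R := k) (S := R) (T := k) (TensorProduct.isBaseChange k A R)
      (h := h) ?_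
    have : (h : R ⊗[k] A →ₗ[k] A) ∘ₗ TensorProduct.mk k R A 1 = LinearMap.id := by
      ext a
      change modM k A R (1 ⊗ₜ a) = a
      simp
    rw [this]
    exact IsBaseChange.ofEquiv (LinearEquiv.refl k A)
  exact isBaseChange_comp_equiv M.valLinearEquiv h H

end InvMul

variable (k A R)

/-- The objects `(μ, η)` of `Def♭_{A,η̂₀}(R)`.  As `R` is finite dimensional,
`C̄C⁻_d(A) ⊗ R` is the degree `d` part of the normalized negative cyclic complex of `A ⊗ R` relative
to `R`; its underlying module only depends on the `R`-module `A ⊗ R` and the element `1 ⊗ 1`.  The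
operator `L_μ + uB` is the cyclic differential of the algebra `(A ⊗ R, -μ)`. -/
structure FlatObj (d : ℕ) (η₀ : cycles k A d) extends InvMul k A R where
  η : CC R toInvMul.Alg d
  closed : cyclicD R toInvMul.Alg η = 0
  η_mod_m : totMap toInvMul.red_isAlgOver (η : Tot R toInvMul.Alg) = (η₀ : Tot k A)

variable {k A R}

/-- The `R`-algebra `(A ⊗ R, -μ)`. -/
abbrev FlatObj.Alg {d : ℕ} {η₀ : cycles k A d} (X : FlatObj k A R d η₀) : Type (max v w) :=
  X.toInvMul.Alg

/-- The morphisms `(φ, ξ)` of `Def♭_{A,η̂₀}(R)`.  The submodule `C̄C⁻_{d+1}(A) ⊗ m` of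
`C̄C⁻_{d+1}(A) ⊗ R` is `m (C̄C⁻_{d+1}(A) ⊗ R)`. -/
@[ext]
structure FlatHom {d : ℕ} {η₀ : cycles k A d} (X Y : FlatObj k A R d η₀) where
  φ : X.Alg →ₐ[R] Y.Alg
  φ_mod_m : ∀ x, Y.red (φ x) = X.red x
  ξ : CC R Y.Alg (d + 1)
  ξ_mem : ξ ∈ IsLocalRing.maximalIdeal R • (⊤ : Submodule R (CC R Y.Alg (d + 1)))
  d_ξ : cyclicD R Y.Alg ξ = totMap (isAlgOver_algHom φ) (X.η : Tot R X.Alg) - Y.η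

/-- The identity `(id, 0)`. -/
def FlatHom.id {d : ℕ} {η₀ : cycles k A d} (X : FlatObj k A R d η₀) : FlatHom X X where
  φ := AlgHom.id R X.Alg
  φ_mod_m := fun _ => rfl
  ξ := 0
  ξ_mem := Submodule.zero_mem _
  d_ξ := by rw [totMap_algHom_id, ZeroMemClass.coe_zero, map_zero, sub_self]

/-- The composition `(φ, ξ) ∘ (φ', ξ') = (φ ∘ φ', φ(ξ') + ξ)`. -/
def FlatHom.comp {d : ℕ} {η₀ : cycles k A d} {X Y Z : FlatObj k A R d η₀}
    (g : FlatHom Y Z) (f : FlatHom X Y) : FlatHom X Z where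
  φ := g.φ.comp f.φ
  φ_mod_m := fun x => by rw [AlgHom.comp_apply, g.φ_mod_m, f.φ_mod_m]
  ξ := ccMap (isAlgOver_algHom g.φ) (d + 1) f.ξ + g.ξ
  ξ_mem := Submodule.add_mem _ (ccMap_mem_smul_top g.φ _ _ f.ξ_mem) g.ξ_mem
  d_ξ := by
    rw [Submodule.coe_add, map_add, g.d_ξ, coe_ccMap, cyclicD_totMap, f.d_ξ, map_sub,
      totMap_algHom_comp, sub_add_sub_cancel]

theorem FlatHom.comp_idHom {d : ℕ} {η₀ : cycles k A d} {X Y : FlatObj k A R d η₀}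
    (f : FlatHom X Y) : f.comp (FlatHom.id X) = f := by
  have h : (f.comp (FlatHom.id X)).ξ = f.ξ := by
    change ccMap (isAlgOver_algHom f.φ) (d + 1) 0 + f.ξ = f.ξ
    rw [map_zero, zero_add]
  exact FlatHom.ext rfl h

theorem FlatHom.idHom_comp {d : ℕ} {η₀ : cycles k A d} {X Y : FlatObj k A R d η₀}
    (f : FlatHom X Y) : (FlatHom.id Y).comp f = f := by
  have h : ((FlatHom.id Y).comp f).ξ = f.ξ := by
    change ccMap (isAlgOver_algHom (AlgHom.id R Y.Alg)) (d + 1) f.ξ + 0 = f.ξ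
    rw [add_zero]
    exact Subtype.ext (totMap_algHom_id _)
  exact FlatHom.ext rfl h

theorem FlatHom.comp_assocHom {d : ℕ} {η₀ : cycles k A d} {X Y Z W : FlatObj k A R d η₀}
    (h : FlatHom Z W) (g : FlatHom Y Z) (f : FlatHom X Y) :
    h.comp (g.comp f) = (h.comp g).comp f := by
  have e : (h.comp (g.comp f)).ξ = ((h.comp g).comp f).ξ := by
    change ccMap (isAlgOver_algHom h.φ) (d + 1)
        (ccMap (isAlgOver_algHom g.φ) (d + 1) f.ξ + g.ξ) + h.ξ =
      ccMap (isAlgOver_algHom (h.φ.comp g.φ)) (d + 1) f.ξ +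
        (ccMap (isAlgOver_algHom h.φ) (d + 1) g.ξ + h.ξ)
    rw [map_add, add_assoc]
    congr 1
    exact Subtype.ext (totMap_algHom_comp _ _ _).symm
  exact FlatHom.ext rfl e

instance {d : ℕ} {η₀ : cycles k A d} : Category (FlatObj k A R d η₀) where
  Hom := FlatHom
  id := FlatHom.id
  comp f g := FlatHom.comp g f
  id_comp := FlatHom.comp_idHom
  comp_id := FlatHom.idHom_comp
  assoc f g h := FlatHom.comp_assocHom h g f

/-- The cycle `η` of an object `(μ, η)`. -/
def FlatObj.cycle {d : ℕ} {η₀ : cycles k A d} (X : FlatObj k A R d η₀) : cycles R X.Alg d :=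
  ⟨X.η, X.η.2, X.closed⟩

/-- The object `((A ⊗ R, -μ), mod m, class of η)` of `Def_{A,η₀}(R)`. -/
def FlatObj.toDefObj {d : ℕ} {η₀ : HC k A d} {ηhat : cycles k A d} (h : HC.mk k A d ηhat = η₀)
    (X : FlatObj k A R d ηhat) : DefObj k A R d η₀ where
  B := X.Alg
  flat := X.flat
  s := X.red
  isAlgOver := X.red_isAlgOver
  isReduction := X.red_isReduction
  η := HC.mk R X.Alg d X.cycle
  map_η := by
    rw [HC.map_mk, ← h]
    exact congrArg _ (Subtype.ext X.η_mod_m)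

theorem FlatHom.map_class {d : ℕ} {ηhat : cycles k A d} {X Y : FlatObj k A R d ηhat}
    (f : FlatHom X Y) :
    HC.map (isAlgOver_algHom f.φ) d (HC.mk R X.Alg d X.cycle) = HC.mk R Y.Alg d Y.cycle := by
  rw [HC.map_mk]
  exact HC.mk_eq_mk ⟨f.ξ, f.ξ.2, f.d_ξ⟩

/-- The morphism `φ` of `Def_{A,η₀}(R)` underlying a morphism `(φ, ξ)`. -/
def FlatHom.toDefHom {d : ℕ} {η₀ : HC k A d} {ηhat : cycles k A d} (h : HC.mk k A d ηhat = η₀)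
    {X Y : FlatObj k A R d ηhat} (f : FlatHom X Y) : DefHom (X.toDefObj h) (Y.toDefObj h) :=
  DefHom.mk (X := X.toDefObj h) (Y := Y.toDefObj h) f.φ f.φ_mod_m f.map_class

/-- The functor `Def♭_{A,η̂₀}(R) ⟶ Def_{A,η₀}(R)`,
`(μ, η) ↦ ((A ⊗ R, -μ), mod m, class of η)`, `(φ, ξ) ↦ φ`, where `η̂₀` is a lift of `η₀`. -/
def flatToDef {d : ℕ} {η₀ : HC k A d} {ηhat : cycles k A d} (h : HC.mk k A d ηhat = η₀) :
    FlatObj k A R d ηhat ⥤ DefObj k A R d η₀ where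
  obj X := X.toDefObj h
  map f := FlatHom.toDefHom h f

end Deformations

end CYDef

end

/-! Essential surjectivity. The maximal ideal `m` is nilpotent, so a Nakayama argument that needs no
finite generation applies to arbitrary modules. A flat deformation `B` has a unital `k`-linear
section of `B → A`; its `R`-linear extension `R ⊗ A → B` is an isomorphism modulo `m` onto a flat
module, hence an isomorphism, and the product of `B` can be transported to `R ⊗ A`
(`IsReduction.exists_algEquiv`). Choose a cycle that represents the given class. Its reduction is
homologous to the fixed cycle `ηhat`. Lifting a primitive of the difference from `A` to the
deformation and subtracting its boundary makes the reduction equal to `ηhat` without changing the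
class. The same Nakayama argument makes every morphism bijective (`algHom_bijective`), so both
categories are groupoids.

Fullness. If `φ` matches the classes, then `φ(η₁) - η₂` is the boundary of some `ξ` of degree `d +
1`, but `ξ` need not vanish modulo `m`. Its reduction is a cycle, because both cycles reduce to
`ηhat`. So everything rests on `HC⁻_{d+1}(A) = 0`: the reduction is then a boundary, and subtracting
the boundary of a lift of its primitive moves `ξ` into `m`.

The vanishing comes from the Calabi-Yau condition in three stages. Non-degeneracy gives `H^n(A, Aᵉ)
= 0` for `n > d`. With a finite resolution by finitely generated projectives this extends to all
coefficient bimodules, since it forces the resolution to split in high degrees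
(`exactSucc_homD_of_bounded`, `exactSucc_cochainD_of_homologicallySmooth`). For coefficients in the
dual of `A`, Hochschild cohomology is dual to Hochschild homology, so `HH_n(A) = 0` for `n > d`
(`exists_b_eq_of_isCalabiYau`). Finally a cycle of `b + uB` of degree `d + 1` is integrated one
power of `u` at a time (`exists_cyclicD_eq`).

The stage about coefficients compares the normalized bar cochains with `Hom` out of a projective
resolution by dimension shifting along coinduced modules, so no comparison map of resolutions is
needed (`exactSucc_cochainD_iff`). -/

noncomputable section

namespace CYDef

/-! ### Cosimplicial identities for Hochschild cochains, on sequences -/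

section Cofaces

variable {A : Type*} [Monoid A] {M : Type*} [AddCommGroup M]

/-- The sequence `X₀, …, XⱼXⱼ₊₁, …`. -/
def merge (j : ℕ) (X : ℕ → A) (l : ℕ) : A :=
  if l < j then X l else if l = j then X l * X (l + 1) else X (l + 1)

/-- The cofaces of the Hochschild cochains of degree `n`, where a cochain is given as a function on
sequences and the bimodule structure of the coefficients by the actions `L` and `T`. -/
def coface (L T : A → M →+ M) (n j : ℕ) (F : (ℕ → A) → M) (X : ℕ → A) : M :=
  if j = 0 then L (X 0) (F fun l => X (l + 1))
  else if j ≤ n then F (merge (j - 1) X)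
  else T (X n) (F X)

/-- The alternating sum of the cofaces. -/
def cobd (L T : A → M →+ M) (n : ℕ) (F : (ℕ → A) → M) (X : ℕ → A) : M :=
  ∑ j ∈ Finset.range (n + 2), (-1 : ℤ) ^ j • coface L T n j F X

/-- Disjoint merges commute up to the index shift; associativity enters only when `i = j`. -/
theorem merge_merge {i j : ℕ} (h : i ≤ j) (X : ℕ → A) :
    merge i (merge (j + 1) X) = merge j (merge i X) := by
  funext l
  simp only [merge]
  split_ifs <;> first | rfl | omega | skip
  rw [mul_assoc]

theorem merge_shift (j : ℕ) (X : ℕ → A) :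
    merge j (fun l => X (l + 1)) = fun l => merge (j + 1) X (l + 1) := by
  funext l
  simp only [merge]
  split_ifs <;> first | rfl | omega

/-- The cosimplicial identity. Each module axiom settles one boundary case: `hL` two initial
cofaces, `hT` two final ones, `hLT` one of each; the interior is `merge_merge`. -/
theorem coface_coface {L T : A → M →+ M} (hL : ∀ a b m, L (a * b) m = L a (L b m))
    (hT : ∀ a b m, T (a * b) m = T b (T a m)) (hLT : ∀ a b m, L a (T b m) = T b (L a m))
    {n i j : ℕ} (hij : i ≤ j) (hj : j ≤ n + 1) {F : (ℕ → A) → M}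
    (hloc : ∀ X Y, (∀ l < n, X l = Y l) → F X = F Y) (X : ℕ → A) :
    coface L T (n + 1) (j + 1) (coface L T n i F) X =
      coface L T (n + 1) i (coface L T n j F) X := by
  rcases Nat.eq_zero_or_pos i with rfl | hi
  · rcases Nat.eq_zero_or_pos j with rfl | hj0
    · simp [coface, hL, merge]
    · obtain ⟨j, rfl⟩ := Nat.exists_eq_succ_of_ne_zero hj0.ne'
      by_cases h : j + 1 ≤ n
      · have h' : j + 1 + 1 ≤ n + 1 := by omega
        simp only [coface, Nat.succ_eq_add_one, h, h', merge_shift]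
        simp [merge]
      · have h' : ¬ (j + 1 + 1 ≤ n + 1) := by omega
        simp [coface, h, hLT]
  · obtain ⟨i, rfl⟩ := Nat.exists_eq_succ_of_ne_zero hi.ne'
    obtain ⟨j, rfl⟩ := Nat.exists_eq_succ_of_ne_zero (Nat.ne_of_gt (lt_of_lt_of_le hi hij))
    simp only [Nat.succ_eq_add_one, Nat.add_le_add_iff_right] at hij hj ⊢
    by_cases h : j + 1 ≤ n
    · have h' : i + 1 ≤ n := by omega
      have h'' : i ≤ n := by omega
      simp only [coface, h, h', h'', add_le_add_iff_right, if_true, Nat.add_sub_cancel,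
        Nat.succ_ne_zero, if_false]
      rw [merge_merge hij]
    · have hjn : j = n := by omega
      subst hjn
      by_cases h' : i + 1 ≤ j
      · have h1 : ¬ (j < i) := by omega
        have h2 : j ≠ i := by omega
        have h3 : i ≤ j := by omega
        simp [coface, h', merge, h1, h2, h3]
      · have : i = j := by omega
        subst this
        -- Merging at position `n` only alters entries from `n` on, which a cochain of degree `n`
        -- does not see.
        have : F (merge i X) = F X := hloc _ _ fun l hl => by simp [merge, hl]
        simp [coface, merge, hT, this]

theorem alternating_sum_eq_zero {G : Type*} [AddCommGroup G] (n : ℕ) (F : ℕ → ℕ → G)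
    (h : ∀ i j, i ≤ j → j ≤ n → F (j + 1) i = F i j) :
    ∑ j ∈ Finset.range (n + 2), ∑ i ∈ Finset.range (n + 1), (-1 : ℤ) ^ (j + i) • F j i = 0 := by
  rw [← Finset.sum_product']
  -- The cosimplicial identity pairs the terms `(j + 1, i)` and `(i, j)` with `i ≤ j`; the index
  -- sums differ by one, so the signs cancel.
  refine Finset.sum_involution
    (fun p _ => if p.2 < p.1 then (p.2, p.1 - 1) else (p.2 + 1, p.1)) ?_ ?_ ?_ ?_
  · rintro ⟨j, i⟩ hp
    simp only [Finset.mem_product, Finset.mem_range] at hp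
    by_cases hij : i < j
    · obtain ⟨j, rfl⟩ : ∃ j', j = j' + 1 := ⟨j - 1, by omega⟩
      simp only [hij, if_true, Nat.add_sub_cancel]
      rw [h i j (by omega) (by omega), show j + 1 + i = (i + j) + 1 by ring, pow_succ]
      simp
    · simp only [hij, if_false]
      rw [h j i (by omega) (by omega), show i + 1 + j = (j + i) + 1 by ring, pow_succ]
      simp
  · rintro ⟨j, i⟩ hp _
    simp only [Finset.mem_product, Finset.mem_range] at hp
    dsimp only
    split_ifs <;> simp only [ne_eq, Prod.mk.injEq, not_and] <;> omega
  · rintro ⟨j, i⟩ hp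
    simp only [Finset.mem_product, Finset.mem_range] at hp ⊢
    split_ifs <;> dsimp only <;> omega
  · rintro ⟨j, i⟩ hp
    simp only [Finset.mem_product, Finset.mem_range] at hp
    by_cases hij : i < j
    · simp only [hij, if_true, show ¬ (j - 1 < i) by omega, if_false, Nat.sub_add_cancel (show 1 ≤ j by omega)]
    · simp only [hij, if_false, show j < i + 1 by omega, if_true, Nat.add_sub_cancel]

theorem coface_sum (L T : A → M →+ M) (n j : ℕ) {ι : Type*} (s : Finset ι) (c : ι → ℤ)
    (F : ι → (ℕ → A) → M) (X : ℕ → A) :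
    coface L T n j (fun Y => ∑ i ∈ s, c i • F i Y) X = ∑ i ∈ s, c i • coface L T n j (F i) X := by
  simp only [coface]
  split_ifs <;> simp

theorem cobd_cobd {L T : A → M →+ M} (hL : ∀ a b m, L (a * b) m = L a (L b m))
    (hT : ∀ a b m, T (a * b) m = T b (T a m)) (hLT : ∀ a b m, L a (T b m) = T b (L a m))
    {n : ℕ} {F : (ℕ → A) → M} (hloc : ∀ X Y, (∀ l < n, X l = Y l) → F X = F Y) (X : ℕ → A) :
    cobd L T (n + 1) (cobd L T n F) X = 0 := by
  have : cobd L T (n + 1) (cobd L T n F) X = ∑ j ∈ Finset.range (n + 1 + 2),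
      ∑ i ∈ Finset.range (n + 1 + 1), (-1 : ℤ) ^ (j + i) •
        coface L T (n + 1) j (coface L T n i F) X := by
    refine Finset.sum_congr rfl fun j _ => ?_
    rw [show cobd L T n F = fun Y => ∑ i ∈ Finset.range (n + 2), (-1 : ℤ) ^ i • coface L T n i F Y
      from rfl, coface_sum, Finset.smul_sum]
    simp only [smul_smul, pow_add]
  rw [this]
  exact alternating_sum_eq_zero _ _ fun i j hij hj => coface_coface hL hT hLT hij hj hloc X

/-- The unit in position `i` can be absorbed to the left or to the right, so cofaces `i` and `i + 1`
agree and cancel. Every other coface still has the unit among its arguments. -/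
theorem cobd_eq_zero_of_one {L T : A → M →+ M} (hL : ∀ m, L 1 m = m) (hT : ∀ m, T 1 m = m)
    {n : ℕ} {F : (ℕ → A) → M} (hF : ∀ X i, i < n → X i = 1 → F X = 0)
    (hloc : ∀ X Y, (∀ i < n, X i = Y i) → F X = F Y)
    {X : ℕ → A} {i : ℕ} (hi : i < n + 1) (hX : X i = 1) : cobd L T n F X = 0 := by
  have key : coface L T n i F X = coface L T n (i + 1) F X := by
    rcases Nat.eq_zero_or_pos i with rfl | hi0
    · by_cases h : 1 ≤ n
      · simp only [coface, if_true, hX, hL, zero_add, one_ne_zero, if_false, h]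
        refine hloc _ _ fun l _ => ?_
        rcases Nat.eq_zero_or_pos l with rfl | hl <;> simp [merge, hX]
        intro h; omega
      · have h0 : n = 0 := by omega
        subst h0
        simp only [coface, if_true, hX, hL, zero_add, one_ne_zero, if_false, h, hT]
        exact hloc _ _ fun l hl => absurd hl (Nat.not_lt_zero l)
    · obtain ⟨i, rfl⟩ := Nat.exists_eq_succ_of_ne_zero hi0.ne'
      by_cases h : i + 1 + 1 ≤ n
      · simp only [coface, Nat.succ_eq_add_one, h, Nat.succ_ne_zero, if_false, if_true,
          show i + 1 ≤ n by omega, Nat.add_sub_cancel]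
        refine hloc _ _ fun l _ => ?_
        simp only [merge]
        split_ifs with h1 h2 h3 h4 h5 h6 <;> first | rfl | omega | skip
        · subst h4; rw [hX, mul_one]
        · next h5 => subst h5; rw [hX, one_mul]
      · have h0 : n = i + 1 := by omega
        subst h0
        simp only [coface, Nat.succ_eq_add_one, h, Nat.succ_ne_zero, if_false, if_true, le_refl,
          Nat.add_sub_cancel, hX, hT]
        refine hloc _ _ fun l hl => ?_
        simp only [merge]
        split_ifs with h1 h2 <;> first | rfl | omega | skip
        subst h2; rw [hX, mul_one]
  have other : ∀ j ∈ Finset.range (n + 2), j ≠ i ∧ j ≠ i + 1 → (-1 : ℤ) ^ j • coface L T n j F X = 0 := by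
    rintro j hj ⟨h1, h2⟩
    rw [Finset.mem_range] at hj
    suffices H : coface L T n j F X = 0 by rw [H, smul_zero]
    simp only [coface]
    split_ifs with h3 h4
    · rw [hF _ (i - 1) (by omega), map_zero]
      rw [Nat.sub_add_cancel (by omega), hX]
    · rcases lt_or_ge i j with h | h
      · exact hF _ i (by omega) (by simp only [merge]; rw [if_pos (by omega), hX])
      · refine hF _ (i - 1) (by omega) ?_
        simp only [merge]
        rw [if_neg (by omega), if_neg (by omega), Nat.sub_add_cancel (by omega), hX]
    · rw [hF _ i (by omega) hX, map_zero]
  unfold cobd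
  rw [Finset.sum_eq_add_of_mem i (i + 1) (by simp; omega) (by simp; omega) (by omega) other, key,
    pow_succ]
  simp

end Cofaces

/-- A tuple, continued by `1` to a sequence. -/
def extendOne {A : Type*} [One A] {n : ℕ} (x : Fin n → A) (l : ℕ) : A :=
  if h : l < n then x ⟨l, h⟩ else 1

theorem extendOne_val {A : Type*} [One A] {n : ℕ} (x : Fin n → A) (l : Fin n) :
    extendOne x l = x l := by
  simp [extendOne]

/-! ### The cyclic differential squares to zero -/

section CyclicDifferential

variable (R : Type u) [CommRing R] {B : Type v} [Ring B] [Algebra R B]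

/-- The chain `X₀ ⊗ ⋯ ⊗ Xₙ`. -/
def seqTensor (n : ℕ) (X : ℕ → B) : Chain R B n :=
  PiTensorProduct.tprod R fun l : Fin (n + 1) => X l

variable {R}

theorem seqTensor_congr {n : ℕ} {X Y : ℕ → B} (h : ∀ l ≤ n, X l = Y l) :
    seqTensor R n X = seqTensor R n Y := by
  unfold seqTensor
  congr 1
  funext l
  exact h l (by omega)

theorem chain_ext_seqTensor {n : ℕ} {N : Type*} [AddCommGroup N] [Module R N]
    {f g : Chain R B n →ₗ[R] N} (h : ∀ X, f (seqTensor R n X) = g (seqTensor R n X)) : f = g :=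
  chain_ext fun x => by
    have : PiTensorProduct.tprod R x = seqTensor R n (extendOne x) := by
      simp only [seqTensor, extendOne_val]
    rw [this, h]

/-- The sequence `a, X₀, X₁, …`. -/
def consSeq {A : Type*} (a : A) (X : ℕ → A) : ℕ → A
  | 0 => a
  | l + 1 => X l

/-- The tuple `X₀, …, Xₙ` rotated by `j` places. -/
def rot {A : Type*} (n j : ℕ) (X : ℕ → A) (l : ℕ) : A :=
  if l + j ≤ n then X (l + j) else X (l + j - (n + 1))

/-- The faces of `X₀ ⊗ ⋯ ⊗ Xₙ₊₁`. -/
def face (n j : ℕ) (X : ℕ → B) (l : ℕ) : B :=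
  if j ≤ n then merge j X l else if l = 0 then X (n + 1) * X 0 else X l

theorem neg_one_pow_smul {N : Type*} [AddCommGroup N] [Module R N] (j : ℕ) (x : N) :
    (-1 : R) ^ j • x = (-1 : ℤ) ^ j • x := by
  rcases Nat.even_or_odd j with h | h <;> simp [h.neg_one_pow]

theorem hochschildB_seqTensor (n : ℕ) (X : ℕ → B) :
    hochschildB R B n (seqTensor R (n + 1) X) =
      ∑ j ∈ Finset.range (n + 2), (-1 : R) ^ j • seqTensor R n (face n j X) := by
  rw [seqTensor, hochschildB_tprod, Finset.sum_range_succ, Finset.sum_range]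
  congr 1
  · refine Finset.sum_congr rfl fun j _ => ?_
    congr 2
    funext l
    simp [face, merge, Fin.contractNth, show (j : ℕ) ≤ n by omega]
  · congr 2
    funext l
    refine Fin.cases ?_ (fun l => ?_) l <;> simp [face]

theorem connesB_seqTensor (n : ℕ) (X : ℕ → B) :
    connesB R B n (seqTensor R n X) = ∑ j ∈ Finset.range (n + 1),
      (-1 : R) ^ (n * j) • seqTensor R (n + 1) (consSeq 1 (rot n j X)) := by
  rw [seqTensor, connesB_tprod, Finset.sum_range]
  refine Finset.sum_congr rfl fun j _ => ?_
  congr 2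
  funext l
  refine Fin.cases ?_ (fun l => ?_) l
  · simp [consSeq]
  · simp only [Fin.cons_succ, Fin.val_succ, consSeq, rot, Fin.val_add]
    split_ifs with h
    · rw [Nat.mod_eq_of_lt (by omega)]
    · rw [Nat.mod_eq_sub_mod (by omega), Nat.mod_eq_of_lt (by omega)]

/-- Keeping the zeroth tensor factor as a free variable turns the boundary of chains into a
coboundary with coefficients in functions of that variable, on which `B` acts by multiplying the
argument on either side. The face that wraps around is the final coface, so `b² = 0` is a case of
`cobd_cobd`. -/
theorem hochschildB_seqTensor_consSeq (n : ℕ) (a : B) (X : ℕ → B) :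
    hochschildB R B n (seqTensor R (n + 1) (consSeq a X)) =
      cobd (M := B → Chain R B n)
        (fun c => { toFun := fun φ t => φ (t * c), map_zero' := rfl, map_add' := fun _ _ => rfl })
        (fun c => { toFun := fun φ t => φ (c * t), map_zero' := rfl, map_add' := fun _ _ => rfl })
        n (fun Y t => seqTensor R n (consSeq t Y)) X a := by
  rw [hochschildB_seqTensor, cobd, Finset.sum_apply]
  refine Finset.sum_congr rfl fun j hj => ?_
  rw [Finset.mem_range] at hj
  rw [Pi.smul_apply, neg_one_pow_smul]
  congr 1
  rcases j with _ | j
  · simp only [coface, if_true, AddMonoidHom.coe_mk, ZeroHom.coe_mk]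
    refine seqTensor_congr fun l _ => ?_
    rcases l with _ | l <;> simp [face, merge, consSeq]
  · by_cases h : j + 1 ≤ n
    · simp only [coface, Nat.succ_ne_zero, if_false, h, if_true, Nat.add_sub_cancel]
      refine seqTensor_congr fun l _ => ?_
      rcases l with _ | l <;> simp [face, merge, consSeq, h]
    · simp only [coface, Nat.succ_ne_zero, if_false, h, AddMonoidHom.coe_mk, ZeroHom.coe_mk]
      refine seqTensor_congr fun l _ => ?_
      rcases l with _ | l <;> simp [face, consSeq, h]

theorem hochschildB_hochschildB (n : ℕ) (x : Chain R B (n + 2)) :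
    hochschildB R B n (hochschildB R B (n + 1) x) = 0 := by
  suffices H : hochschildB R B n ∘ₗ hochschildB R B (n + 1) = 0 from LinearMap.congr_fun H x
  refine chain_ext_seqTensor fun X => ?_
  have hX : X = consSeq (X 0) (fun l => X (l + 1)) := by
    funext l; rcases l with _ | l <;> rfl
  rw [hX, LinearMap.comp_apply, hochschildB_seqTensor_consSeq, LinearMap.zero_apply, cobd,
    Finset.sum_apply, map_sum]
  rw [← Pi.zero_apply (M := fun _ => Chain R B n) (X 0), ← cobd_cobd (M := B → Chain R B n)
    (L := fun c => { toFun := fun φ t => φ (t * c), map_zero' := rfl, map_add' := fun _ _ => rfl })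
    (T := fun c => { toFun := fun φ t => φ (c * t), map_zero' := rfl, map_add' := fun _ _ => rfl })
    (fun a b φ => funext fun t => congrArg φ (mul_assoc t a b).symm)
    (fun a b φ => funext fun t => congrArg φ (mul_assoc a b t))
    (fun a b φ => funext fun t => congrArg φ (mul_assoc b t a).symm)
    (n := n) (F := fun Y t => seqTensor R n (consSeq t Y))
    (fun Y Z h => funext fun t => seqTensor_congr fun l hl => by
      rcases l with _ | l
      · rfl
      · exact h l (by omega)) (fun l => X (l + 1)), cobd, Finset.sum_apply]
  refine Finset.sum_congr rfl fun j _ => ?_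
  rw [Pi.smul_apply, Pi.smul_apply, map_zsmul]
  congr 1
  simp only [coface]
  split_ifs
  · exact hochschildB_seqTensor_consSeq _ _ _
  · exact hochschildB_seqTensor_consSeq _ _ _
  · exact hochschildB_seqTensor_consSeq _ _ _

/-- Entries `i, i + 1` of the rotated tuple are the entries `i + j, i + j + 1` of the original,
counted modulo `n + 2`. If the merged pair lies entirely before the starting point of the rotation,
merging it moves that point back by one, whence `j - 1`. -/
theorem face_rot (n : ℕ) {i j : ℕ} (hi : i ≤ n) (hj : j ≤ n + 1) (X : ℕ → B) {l : ℕ} (hl : l ≤ n) :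
    merge i (rot (n + 1) j X) l =
      if i + j ≤ n + 1 then rot n j (face n (i + j) X) l
      else rot n (j - 1) (face n (i + j - (n + 2)) X) l := by
  rcases lt_trichotomy (i + j) (n + 1) with h | h | h
  · rw [if_pos h.le]
    simp only [rot, face, show i + j ≤ n by omega, if_true]
    rcases lt_trichotomy l i with h1 | h1 | h1
    · simp only [merge, rot, h1, if_true, show l + j ≤ n + 1 by omega, show l + j ≤ n by omega,
        show l + j < i + j by omega]
    · subst h1
      simp only [merge, rot, lt_irrefl, if_true, if_false, show l + j ≤ n + 1 by omega,
        show l + 1 + j ≤ n + 1 by omega, show l + j ≤ n by omega]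
      rw [show l + 1 + j = l + j + 1 by omega]
    · simp only [merge, rot, show ¬ l < i by omega, show ¬ l = i by omega, if_false]
      split_ifs <;> first | omega | rfl | (congr 1; omega)
  · rw [if_pos h.le]
    simp only [rot, face, show ¬ (i + j ≤ n) by omega, if_false]
    rcases lt_trichotomy l i with h1 | h1 | h1
    · simp only [merge, rot, h1, if_true, show l + j ≤ n + 1 by omega]
      split_ifs <;> first | omega | rfl
    · subst h1
      simp only [merge, rot, lt_irrefl, if_true, if_false, show l + j ≤ n + 1 by omega,
        show ¬ (l + 1 + j ≤ n + 1) by omega, show ¬ (l + j ≤ n) by omega,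
        show l + 1 + j - (n + 1 + 1) = 0 by omega, show l + j - (n + 1) = 0 by omega]
      rw [h]
    · simp only [merge, rot, show ¬ l < i by omega, show ¬ l = i by omega, if_false]
      split_ifs <;> first | omega | rfl | (congr 1; omega)
  · rw [if_neg (by omega)]
    simp only [rot, face, show i + j - (n + 2) ≤ n by omega, if_true]
    rcases lt_trichotomy l i with h1 | h1 | h1
    · simp only [merge, rot, h1, if_true]
      split_ifs <;> first | omega | rfl | (congr 1; omega)
    · subst h1
      simp only [merge, rot, lt_irrefl, if_true, if_false, show ¬ (l + j ≤ n + 1) by omega,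
        show ¬ (l + 1 + j ≤ n + 1) by omega, show ¬ (l + (j - 1) ≤ n) by omega,
        show l + (j - 1) - (n + 1) = l + j - (n + 2) by omega]
      rw [show l + 1 + j - (n + 1 + 1) = l + j - (n + 2) + 1 by omega]
    · simp only [merge, rot, show ¬ l < i by omega, show ¬ l = i by omega, if_false]
      split_ifs <;> first | omega | rfl | (congr 1; omega)

/-- In the boundary of `1 ⊗ Y`, the two faces that involve the leading unit give `Y` and, up to
sign, its cyclic shift. Summed over all rotations `Y` these telescope around the circle, and only
the inner merges remain. -/
theorem hochschildB_connesB_seqTensor (n : ℕ) (X : ℕ → B) :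
    hochschildB R B n (connesB R B n (seqTensor R n X)) =
      -∑ j ∈ Finset.range (n + 1), ∑ i ∈ Finset.range n,
        (-1 : R) ^ (n * j + i) • seqTensor R n (consSeq 1 (merge i (rot n j X))) := by
  have key : ∀ Y : ℕ → B, hochschildB R B n (seqTensor R (n + 1) (consSeq 1 Y)) =
      seqTensor R n Y + (-1 : R) ^ (n + 1) • seqTensor R n (rot n n Y) -
        ∑ i ∈ Finset.range n, (-1 : R) ^ i • seqTensor R n (consSeq 1 (merge i Y)) := by
    intro Y
    rw [hochschildB_seqTensor, Finset.sum_range_succ, Finset.sum_range_succ']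
    have h0 : seqTensor R n (face n 0 (consSeq 1 Y)) = seqTensor R n Y :=
      seqTensor_congr fun l _ => by rcases l with _ | l <;> simp [face, merge, consSeq]
    have h1 : seqTensor R n (face n (n + 1) (consSeq 1 Y)) = seqTensor R n (rot n n Y) :=
      seqTensor_congr fun l hl => by
        rcases l with _ | l
        · simp [face, consSeq, rot]
        · have : ¬ (l + 1 + n ≤ n) := by omega
          simp [face, consSeq, rot, this, show l + 1 + n - (n + 1) = l by omega]
    have h2 : ∀ i ∈ Finset.range n, (-1 : R) ^ (i + 1) • seqTensor R n
        (face n (i + 1) (consSeq 1 Y)) = -((-1 : R) ^ i • seqTensor R n (consSeq 1 (merge i Y))) := by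
      intro i hi
      rw [Finset.mem_range] at hi
      rw [pow_succ, mul_neg, mul_one, neg_smul]
      congr 2
      refine seqTensor_congr fun l hl => ?_
      rcases l with _ | l <;> simp [face, consSeq, merge, show i + 1 ≤ n by omega]
    rw [h0, h1, Finset.sum_congr rfl h2, Finset.sum_neg_distrib]
    simp only [pow_zero, one_smul]
    abel
  have rotrot : ∀ j, j < n → seqTensor R n (rot n n (rot n (j + 1) X)) = seqTensor R n (rot n j X) :=
    fun j hj => seqTensor_congr fun l hl => by
      simp only [rot]
      split_ifs <;> first | omega | (congr 1; omega)
  rw [connesB_seqTensor, map_sum]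
  simp only [map_smul, key, smul_sub, smul_add, Finset.sum_sub_distrib, Finset.sum_add_distrib]
  have tele : ∑ j ∈ Finset.range (n + 1), (-1 : R) ^ (n * j) • seqTensor R n (rot n j X) +
      ∑ j ∈ Finset.range (n + 1), (-1 : R) ^ (n * j) •
        (-1 : R) ^ (n + 1) • seqTensor R n (rot n n (rot n j X)) = 0 := by
    rw [Finset.sum_range_succ, Finset.sum_range_succ' (fun j => (-1 : R) ^ (n * j) •
        (-1 : R) ^ (n + 1) • seqTensor R n (rot n n (rot n j X)))]
    have h1 : ∀ j ∈ Finset.range n, (-1 : R) ^ (n * (j + 1)) •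
        (-1 : R) ^ (n + 1) • seqTensor R n (rot n n (rot n (j + 1) X)) =
        -((-1 : R) ^ (n * j) • seqTensor R n (rot n j X)) := by
      intro j hj
      rw [rotrot j (Finset.mem_range.1 hj), smul_smul, ← neg_smul]
      congr 1
      rw [← pow_add, show n * (j + 1) + (n + 1) = n * j + 2 * n + 1 by ring, pow_succ, pow_add,
        pow_mul (-1 : R) 2 n]
      simp
    have h2 : seqTensor R n (rot n n (rot n 0 X)) = seqTensor R n (rot n n X) :=
      seqTensor_congr fun l hl => by
        simp only [rot]
        split_ifs <;> first | omega | rfl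
    have h3 : (-1 : R) ^ (n * n) = (-1) ^ n := by
      rcases Nat.even_or_odd n with h | h
      · rw [(h.mul_left n).neg_one_pow, h.neg_one_pow]
      · rw [(h.mul h).neg_one_pow, h.neg_one_pow]
    rw [Finset.sum_congr rfl h1, h2, h3, Finset.sum_neg_distrib, mul_zero, pow_zero, one_smul,
      pow_succ, mul_neg, mul_one, neg_smul]
    abel
  rw [tele, zero_sub]
  simp only [Finset.smul_sum, smul_smul, pow_add]

/-- Both sides are signed sums of `1 ⊗ Y`, where `Y` arises by one cyclically adjacent
multiplication and one rotation; `face_rot` matches the orders of the two operations. The identity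
already holds before normalization. -/
theorem connesB_hochschildB (n : ℕ) (x : Chain R B (n + 1)) :
    connesB R B n (hochschildB R B n x) = -hochschildB R B (n + 1) (connesB R B (n + 1) x) := by
  suffices H : connesB R B n ∘ₗ hochschildB R B n =
      -(hochschildB R B (n + 1) ∘ₗ connesB R B (n + 1)) from LinearMap.congr_fun H x
  refine chain_ext_seqTensor fun X => ?_
  rw [LinearMap.neg_apply, LinearMap.comp_apply, LinearMap.comp_apply,
    hochschildB_connesB_seqTensor, neg_neg, hochschildB_seqTensor, map_sum]
  simp only [map_smul, connesB_seqTensor, Finset.smul_sum, smul_smul, ← pow_add]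
  rw [← Finset.sum_product', ← Finset.sum_product']
  -- The reindexing of `face_rot`, except for the pair rotation `n + 1`, merge `0`. There `face_rot`
  -- yields face `n + 1` rotated by `n + 1`, a full turn of `n + 1` entries and out of range as an
  -- index, so it is recorded as rotation `0`.
  refine Finset.sum_nbij'
    (fun p => if p.2 = 0 ∧ p.1 = n + 1 then (n + 1, 0)
      else if p.2 ≤ p.1 then (p.2, p.1 - p.2) else (p.2 + 1, p.1 + (n + 1) - p.2))
    (fun q => if q.2 = 0 ∧ q.1 = n + 1 then (n + 1, 0)
      else if q.2 + q.1 ≤ n + 1 then (q.2 + q.1, q.1) else (q.2 + q.1 - (n + 2), q.1 - 1))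
    ?_ ?_ ?_ ?_ ?_
  · rintro ⟨m, p⟩ h
    simp only [Finset.mem_product, Finset.mem_range] at h ⊢
    split_ifs <;> dsimp only <;> omega
  · rintro ⟨j, i⟩ h
    simp only [Finset.mem_product, Finset.mem_range] at h ⊢
    split_ifs <;> dsimp only <;> omega
  · rintro ⟨m, p⟩ h
    simp only [Finset.mem_product, Finset.mem_range] at h ⊢
    by_cases h1 : p = 0 ∧ m = n + 1
    · simp [h1]
    · by_cases h2 : p ≤ m
      · have h3 : ¬ (m - p = 0 ∧ p = n + 1) := by omega
        have h4 : m - p + p ≤ n + 1 := by omega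
        simp only [h1, h2, h3, h4, if_true, if_false]
        rw [Nat.sub_add_cancel h2]
      · have h3 : ¬ (m + (n + 1) - p = 0 ∧ p + 1 = n + 1) := by omega
        have h4 : ¬ (m + (n + 1) - p + (p + 1) ≤ n + 1) := by omega
        simp only [h1, h2, h3, h4, if_false, Prod.mk.injEq]
        omega
  · rintro ⟨j, i⟩ h
    simp only [Finset.mem_product, Finset.mem_range] at h ⊢
    by_cases h1 : i = 0 ∧ j = n + 1
    · simp [h1]
    · by_cases h2 : i + j ≤ n + 1
      · have h3 : ¬ (j = 0 ∧ i + j = n + 1) := by omega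
        have h4 : j ≤ i + j := by omega
        simp only [h1, h2, h3, h4, if_true, if_false, Nat.add_sub_cancel]
      · have h3 : ¬ (j - 1 = 0 ∧ i + j - (n + 2) = n + 1) := by omega
        have h4 : ¬ (j - 1 ≤ i + j - (n + 2)) := by omega
        simp only [h1, h2, h3, h4, if_false, Prod.mk.injEq]
        omega
  · rintro ⟨m, p⟩ h
    simp only [Finset.mem_product, Finset.mem_range] at h
    have sign : ∀ a b : ℕ, (∃ c, a + 2 * c = b ∨ b + 2 * c = a) → (-1 : R) ^ a = (-1) ^ b := by
      rintro _ _ ⟨c, rfl | rfl⟩ <;> simp [pow_add, pow_mul]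
    by_cases h1 : p = 0 ∧ m = n + 1
    · obtain ⟨rfl, rfl⟩ := h1
      simp only [and_self, if_true]
      congr 1
      · obtain ⟨c, hc⟩ := Nat.even_mul_succ_self n
        refine sign _ _ ⟨c, Or.inl ?_⟩
        nlinarith [hc]
      · refine seqTensor_congr fun l hl => ?_
        rcases l with _ | l
        · rfl
        · simp only [consSeq]
          rw [face_rot n (Nat.zero_le _) le_rfl X (by omega), if_pos (by omega), zero_add]
          simp only [rot]
          split_ifs <;> first | omega | rfl | (congr 1; omega)
    · by_cases h2 : p ≤ m
      · simp only [h1, h2, if_true, if_false]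
        congr 1
        · refine sign _ _ ⟨0, Or.inl ?_⟩
          obtain ⟨c, rfl⟩ := Nat.exists_eq_add_of_le h2
          rw [Nat.add_sub_cancel_left]; ring
        · refine seqTensor_congr fun l hl => ?_
          rcases l with _ | l
          · rfl
          · simp only [consSeq]
            rw [face_rot n (by omega) (by omega) X (by omega), if_pos (by omega),
              Nat.sub_add_cancel h2]
      · simp only [h1, h2, if_false]
        congr 1
        · refine sign _ _ ⟨n + 1, Or.inl ?_⟩
          obtain ⟨c, hc⟩ := Nat.exists_eq_add_of_le (show p ≤ m + (n + 1) by omega)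
          rw [hc, Nat.add_sub_cancel_left]
          nlinarith [hc]
        · refine seqTensor_congr fun l hl => ?_
          rcases l with _ | l
          · rfl
          · simp only [consSeq]
            rw [face_rot n (by omega) (by omega) X (by omega), if_neg (by omega),
              Nat.add_sub_cancel, show m + (n + 1) - p + (p + 1) - (n + 2) = m by omega]

variable (R B)

theorem b_b (n : ℕ) (x : NChain R B (n + 2)) : b R B n (b R B (n + 1) x) = 0 := by
  obtain ⟨x, rfl⟩ := Submodule.mkQ_surjective _ x
  change NChain.mk R B n (hochschildB R B n (hochschildB R B (n + 1) x)) = 0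
  rw [hochschildB_hochschildB, map_zero]

theorem b_connes_zero (x : NChain R B 0) : b R B 0 (connes R B 0 x) = 0 := by
  obtain ⟨x, rfl⟩ := Submodule.mkQ_surjective _ x
  change NChain.mk R B 0 (hochschildB R B 0 (connesB R B 0 x)) = 0
  have : hochschildB R B 0 ∘ₗ connesB R B 0 = 0 := chain_ext_seqTensor fun X => by
    rw [LinearMap.comp_apply, hochschildB_connesB_seqTensor]
    simp
  rw [show hochschildB R B 0 (connesB R B 0 x) = 0 from LinearMap.congr_fun this x, map_zero]

theorem connes_b (n : ℕ) (x : NChain R B (n + 1)) :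
    connes R B n (b R B n x) = -b R B (n + 1) (connes R B (n + 1) x) := by
  obtain ⟨x, rfl⟩ := Submodule.mkQ_surjective _ x
  change NChain.mk R B (n + 1) (connesB R B n (hochschildB R B n x)) =
    -NChain.mk R B (n + 1) (hochschildB R B (n + 1) (connesB R B (n + 1) x))
  rw [connesB_hochschildB, map_neg]

/-- The second application puts a new unit in front and pushes the first one into a later slot, so
every term is degenerate; this needs normalized chains. -/
theorem connes_connes (n : ℕ) (x : NChain R B n) :
    connes R B (n + 1) (connes R B n x) = 0 := by
  suffices H : connes R B (n + 1) ∘ₗ connes R B n = 0 from LinearMap.congr_fun H x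
  refine nchain_ext fun x => ?_
  change NChain.mk R B (n + 2) (connesB R B (n + 1) (connesB R B n (PiTensorProduct.tprod R x))) = 0
  refine (Submodule.Quotient.mk_eq_zero _).2 ?_
  rw [connesB_tprod, map_sum]
  refine Submodule.sum_mem _ fun i _ => ?_
  rw [map_smul, connesB_tprod]
  refine Submodule.smul_mem _ _ (Submodule.sum_mem _ fun j _ => Submodule.smul_mem _ _ ?_)
  refine tprod_mem_degenerate _ (-j).succ (Fin.succ_ne_zero _) ?_
  simp

theorem cyclicD_cyclicD (x : Tot R B) : cyclicD R B (cyclicD R B x) = 0 := by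
  funext m
  rcases m with _ | _ | m
  · simp [cyclicD, uConnes, b_b, b_connes_zero]
  · simp [cyclicD, uConnes, b_b, connes_b]
  · simp [cyclicD, uConnes, b_b, connes_b, connes_connes]

end CyclicDifferential

/-! ### Normalized Hochschild cochains with coefficients in a bimodule -/

section Coefficients

set_option linter.unusedSectionVars false

variable (k : Type u) [Field k] (A : Type w) [Ring A] [Algebra k A]
variable (M : Type v) [AddCommGroup M] [Module k M] [Module (A ⊗[k] Aᵐᵒᵖ) M]
  [IsScalarTower k (A ⊗[k] Aᵐᵒᵖ) M]

/-- The left action of `A` on an `Aᵉ`-module. -/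
def leftAct : A →ₗ[k] M →ₗ[k] M :=
  LinearMap.mk₂ k (fun a m => (a ⊗ₜ[k] (1 : Aᵐᵒᵖ)) • m)
    (fun a a' m => by rw [TensorProduct.add_tmul, add_smul])
    (fun c a m => by rw [← TensorProduct.smul_tmul', smul_assoc])
    (fun a m m' => smul_add _ _ _)
    (fun c a m => (smul_comm c _ m).symm)

/-- The right action of `A` on an `Aᵉ`-module. -/
def rightAct : A →ₗ[k] M →ₗ[k] M :=
  LinearMap.mk₂ k (fun a m => ((1 : A) ⊗ₜ[k] MulOpposite.op a) • m)
    (fun a a' m => by rw [MulOpposite.op_add, TensorProduct.tmul_add, add_smul])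
    (fun c a m => by rw [MulOpposite.op_smul, TensorProduct.tmul_smul, smul_assoc])
    (fun a m m' => smul_add _ _ _)
    (fun c a m => (smul_comm c _ m).symm)

variable {k A M}

theorem contractNth_update_of_fin {n : ℕ} (j : Fin n) (x : Fin (n + 1) → A) (i : Fin (n + 1)) :
    ∃ (l : Fin n) (g : A →ₗ[k] A), ∀ a,
      Fin.contractNth j.castSucc (· * ·) (Function.update x i a) =
        Function.update (Fin.contractNth j.castSucc (· * ·) x) l (g a) := by
  cases n with
  | zero => exact j.elim0
  | succ n => exact contractNth_update k j x i

/-- The multilinear map `(a₀, …, aₙ) ↦ f(a₀, …, aⱼaⱼ₊₁, …, aₙ)`. -/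
def mergeMultilinear {n : ℕ} (f : MultilinearMap k (fun _ : Fin n => A) M) (j : Fin n) :
    MultilinearMap k (fun _ : Fin (n + 1) => A) M :=
  MultilinearMap.mk' (fun x => f (Fin.contractNth j.castSucc (· * ·) x))
    (fun x i a b => by
      obtain ⟨l, g, hg⟩ := contractNth_update_of_fin (k := k) j x i
      simp only [hg, map_add, MultilinearMap.map_update_add])
    (fun x i c a => by
      obtain ⟨l, g, hg⟩ := contractNth_update_of_fin (k := k) j x i
      simp only [hg, map_smul, MultilinearMap.map_update_smul])

/-- The Hochschild coboundary of a multilinear map with values in an `Aᵉ`-module. -/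
def multilinearCobd {n : ℕ} (f : MultilinearMap k (fun _ : Fin n => A) M) :
    MultilinearMap k (fun _ : Fin (n + 1) => A) M :=
  LinearMap.uncurryLeft (M := fun _ : Fin (n + 1) => A)
      { toFun := fun a => (leftAct k A M a).compMultilinearMap f
        map_add' := fun a a' => by ext; simp
        map_smul' := fun c a => by ext; simp }
    + ∑ j : Fin n, (-1 : k) ^ ((j : ℕ) + 1) • mergeMultilinear f j
    + (-1 : k) ^ (n + 1) • ((rightAct k A M).flip.compMultilinearMap f).uncurryRight

theorem multilinearCobd_apply {n : ℕ} (f : MultilinearMap k (fun _ : Fin n => A) M)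
    (x : Fin (n + 1) → A) :
    multilinearCobd f x = (x 0 ⊗ₜ[k] (1 : Aᵐᵒᵖ)) • f (Fin.tail x)
      + ∑ j : Fin n, (-1 : k) ^ ((j : ℕ) + 1) • f (Fin.contractNth j.castSucc (· * ·) x)
      + (-1 : k) ^ (n + 1) • ((1 : A) ⊗ₜ[k] MulOpposite.op (x (Fin.last n))) • f (Fin.init x) := by
  simp only [multilinearCobd, add_apply, sum_apply,
    smul_apply]
  rfl

/-- A multilinear map as a function on sequences. -/
def onSeq {n : ℕ} (f : MultilinearMap k (fun _ : Fin n => A) M) (X : ℕ → A) : M :=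
  f fun l : Fin n => X l

theorem onSeq_multilinearCobd {n : ℕ} (f : MultilinearMap k (fun _ : Fin n => A) M) :
    onSeq (multilinearCobd f) = cobd (fun a => (leftAct k A M a).toAddMonoidHom)
      (fun a => (rightAct k A M a).toAddMonoidHom) n (onSeq f) := by
  funext X
  rw [onSeq, multilinearCobd_apply, cobd, Finset.sum_range_succ, Finset.sum_range_succ', add_comm
    (Finset.sum _ _), Finset.sum_range]
  congr 1
  · congr 1
    · simp only [pow_zero, one_smul]
      rfl
    · refine Finset.sum_congr rfl fun j _ => ?_
      rw [neg_one_pow_smul]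
      congr 1
      simp only [coface, Nat.succ_ne_zero, if_false, show (j : ℕ) + 1 ≤ n by omega, if_true,
        Nat.add_sub_cancel, onSeq]
      congr 1
  · rw [neg_one_pow_smul]
    congr 1
    simp only [coface, Nat.succ_ne_zero, if_false, show ¬ (n + 1 ≤ n) by omega]
    rfl

theorem onSeq_congr {n : ℕ} (f : MultilinearMap k (fun _ : Fin n => A) M) (X Y : ℕ → A)
    (h : ∀ l < n, X l = Y l) : onSeq f X = onSeq f Y :=
  congrArg f (funext fun l => h l l.2)

theorem onSeq_extendOne {n : ℕ} (f : MultilinearMap k (fun _ : Fin n => A) M) (x : Fin n → A) :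
    onSeq f (extendOne x) = f x :=
  congrArg f (funext fun l => extendOne_val x l)

variable (k A M)

/-- The normalized Hochschild cochains with values in an `Aᵉ`-module. -/
def NCochain (n : ℕ) : Submodule k (MultilinearMap k (fun _ : Fin n => A) M) where
  carrier := {f | ∀ x : Fin n → A, (∃ i, x i = 1) → f x = 0}
  add_mem' hf hg x hx := by simp [hf x hx, hg x hx]
  zero_mem' _ _ := rfl
  smul_mem' r f hf x hx := by simp [hf x hx]

variable {k A M}

theorem multilinearCobd_mem {n : ℕ} {f : MultilinearMap k (fun _ : Fin n => A) M}
    (hf : f ∈ NCochain k A M n) : multilinearCobd f ∈ NCochain k A M (n + 1) := by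
  rintro x ⟨i, hi⟩
  rw [← onSeq_extendOne, onSeq_multilinearCobd]
  refine cobd_eq_zero_of_one (fun m => ?_) (fun m => ?_) (fun X i hi hX => hf _ ⟨⟨i, hi⟩, hX⟩)
    (onSeq_congr f) i.2 ((extendOne_val x i).trans hi)
  · exact one_smul (A ⊗[k] Aᵐᵒᵖ) m
  · exact one_smul (A ⊗[k] Aᵐᵒᵖ) m

theorem multilinearCobd_multilinearCobd {n : ℕ} (f : MultilinearMap k (fun _ : Fin n => A) M) :
    multilinearCobd (multilinearCobd f) = 0 := by
  ext x
  rw [← onSeq_extendOne, onSeq_multilinearCobd, onSeq_multilinearCobd]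
  refine cobd_cobd (fun a b m => ?_) (fun a b m => ?_) (fun a b m => ?_) (onSeq_congr f) _
  · change ((a * b) ⊗ₜ[k] (1 : Aᵐᵒᵖ)) • m = (a ⊗ₜ[k] (1 : Aᵐᵒᵖ)) • (b ⊗ₜ[k] (1 : Aᵐᵒᵖ)) • m
    rw [smul_smul, Algebra.TensorProduct.tmul_mul_tmul, mul_one]
  · change ((1 : A) ⊗ₜ[k] MulOpposite.op (a * b)) • m =
      ((1 : A) ⊗ₜ[k] MulOpposite.op b) • ((1 : A) ⊗ₜ[k] MulOpposite.op a) • m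
    rw [smul_smul, Algebra.TensorProduct.tmul_mul_tmul, mul_one, MulOpposite.op_mul]
  · change (a ⊗ₜ[k] (1 : Aᵐᵒᵖ)) • ((1 : A) ⊗ₜ[k] MulOpposite.op b) • m =
      ((1 : A) ⊗ₜ[k] MulOpposite.op b) • (a ⊗ₜ[k] (1 : Aᵐᵒᵖ)) • m
    rw [smul_smul, smul_smul, Algebra.TensorProduct.tmul_mul_tmul,
      Algebra.TensorProduct.tmul_mul_tmul, mul_one, one_mul, mul_one, one_mul]

variable (k A M)

/-- The Hochschild coboundary on normalized cochains. -/
def cochainD (n : ℕ) : NCochain k A M n →+ NCochain k A M (n + 1) where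
  toFun f := ⟨multilinearCobd f.1, multilinearCobd_mem f.2⟩
  map_zero' := by
    ext x
    simp [multilinearCobd_apply]
  map_add' f g := by
    ext x
    simp only [multilinearCobd_apply, Submodule.coe_add, add_apply, smul_add,
      Finset.sum_add_distrib]
    abel

variable {k A M}

theorem cochainD_cochainD {n : ℕ} (f : NCochain k A M n) :
    cochainD k A M (n + 1) (cochainD k A M n f) = 0 :=
  Subtype.ext (multilinearCobd_multilinearCobd f.1)

variable {N : Type*} [AddCommGroup N] [Module k N] [Module (A ⊗[k] Aᵐᵒᵖ) N]
  [IsScalarTower k (A ⊗[k] Aᵐᵒᵖ) N]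

/-- The map on normalized cochains induced by a linear map of coefficients. -/
def cochainMap (g : M →ₗ[k] N) (n : ℕ) : NCochain k A M n →+ NCochain k A N n where
  toFun f := ⟨g.compMultilinearMap f.1, fun x hx => by simp [f.2 x hx]⟩
  map_zero' := by ext; simp
  map_add' f f' := by ext; simp

theorem cochainMap_apply (g : M →ₗ[k] N) {n : ℕ} (f : NCochain k A M n) (x : Fin n → A) :
    (cochainMap g n f).1 x = g (f.1 x) := rfl

theorem cochainD_cochainMap (g : M →ₗ[A ⊗[k] Aᵐᵒᵖ] N) {n : ℕ} (f : NCochain k A M n) :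
    cochainD k A N n (cochainMap (g.restrictScalars k) n f) =
      cochainMap (g.restrictScalars k) (n + 1) (cochainD k A M n f) := by
  ext x
  change multilinearCobd _ x = g (multilinearCobd f.1 x)
  simp only [multilinearCobd_apply, map_add, map_sum, map_smul, cochainMap_apply,
    LinearMap.map_smul_of_tower, LinearMap.restrictScalars_apply]

end Coefficients

/-! ### Dimension shifting in short exact sequences of complexes -/

section DimensionShifting

variable {X Y Z : ℕ → Type*} [∀ n, AddCommGroup (X n)] [∀ n, AddCommGroup (Y n)]
  [∀ n, AddCommGroup (Z n)]

/-- A sequence of maps is exact in degree `n + 1`. -/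
def ExactSucc (dX : ∀ n, X n →+ X (n + 1)) (n : ℕ) : Prop :=
  ∀ x, dX (n + 1) x = 0 → ∃ y, dX n y = x

/-- A short exact sequence of cochain complexes. -/
structure IsShortExact (dX : ∀ n, X n →+ X (n + 1)) (dY : ∀ n, Y n →+ Y (n + 1))
    (dZ : ∀ n, Z n →+ Z (n + 1)) (i : ∀ n, X n →+ Y n) (p : ∀ n, Y n →+ Z n) : Prop where
  d_d : ∀ n y, dY (n + 1) (dY n y) = 0
  d_i : ∀ n x, dY n (i n x) = i (n + 1) (dX n x)
  d_p : ∀ n y, dZ n (p n y) = p (n + 1) (dY n y)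
  injective : ∀ n, Function.Injective (i n)
  exact : ∀ n, Function.Exact (i n) (p n)
  surjective : ∀ n, Function.Surjective (p n)

variable {dX : ∀ n, X n →+ X (n + 1)} {dY : ∀ n, Y n →+ Y (n + 1)}
  {dZ : ∀ n, Z n →+ Z (n + 1)} {i : ∀ n, X n →+ Y n} {p : ∀ n, Y n →+ Z n}

/-- The piece of the long exact sequence where the connecting map from degree `n + 1` of the
quotient to degree `n + 2` of the subcomplex is an isomorphism. -/
theorem IsShortExact.exactSucc_succ_iff (h : IsShortExact dX dY dZ i p) {n : ℕ}
    (h1 : ExactSucc dY n) (h2 : ExactSucc dY (n + 1)) :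
    ExactSucc dX (n + 1) ↔ ExactSucc dZ n := by
  constructor
  · intro H z hz
    obtain ⟨y, rfl⟩ := h.surjective _ z
    rw [h.d_p] at hz
    obtain ⟨x, hx⟩ := (h.exact _ _).1 hz
    have : dX (n + 2) x = 0 := h.injective _ (by rw [← h.d_i, hx, h.d_d, map_zero])
    obtain ⟨x', hx'⟩ := H x this
    have hc : dY (n + 1) (y - i _ x') = 0 := by rw [map_sub, h.d_i, hx', hx, sub_self]
    obtain ⟨w, hw⟩ := h1 _ hc
    refine ⟨p n w, ?_⟩
    rw [h.d_p, hw, map_sub, (h.exact _ _).2 ⟨x', rfl⟩, sub_zero]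
  · intro H x hx
    obtain ⟨y, hy⟩ := h2 (i _ x) (by rw [h.d_i, hx, map_zero])
    obtain ⟨z, hz⟩ := H (p _ y) (by rw [h.d_p, hy]; exact (h.exact _ _).2 ⟨x, rfl⟩)
    obtain ⟨w, rfl⟩ := h.surjective _ z
    obtain ⟨x', hx'⟩ := (h.exact _ (y - dY n w)).1 (by rw [map_sub, ← h.d_p, hz, sub_self])
    refine ⟨x', h.injective _ ?_⟩
    rw [← h.d_i, hx', map_sub, h.d_d, sub_zero, hy]

/-- At the bottom the connecting map is only surjective: `H¹` of the subcomplex is the cokernel of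
the map on `H⁰`. -/
theorem IsShortExact.exactSucc_zero_iff (h : IsShortExact dX dY dZ i p) (h1 : ExactSucc dY 0) :
    ExactSucc dX 0 ↔ ∀ z, dZ 0 z = 0 → ∃ y, dY 0 y = 0 ∧ p 0 y = z := by
  constructor
  · intro H z hz
    obtain ⟨y, rfl⟩ := h.surjective _ z
    rw [h.d_p] at hz
    obtain ⟨x, hx⟩ := (h.exact _ _).1 hz
    have : dX 1 x = 0 := h.injective _ (by rw [← h.d_i, hx, h.d_d, map_zero])
    obtain ⟨x', hx'⟩ := H x this
    refine ⟨y - i _ x', by rw [map_sub, h.d_i, hx', hx, sub_self], ?_⟩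
    rw [map_sub, (h.exact _ _).2 ⟨x', rfl⟩, sub_zero]
  · intro H x hx
    obtain ⟨y, hy⟩ := h1 (i _ x) (by rw [h.d_i, hx, map_zero])
    obtain ⟨w, hw, hwp⟩ := H (p _ y) (by rw [h.d_p, hy]; exact (h.exact _ _).2 ⟨x, rfl⟩)
    obtain ⟨x', hx'⟩ := (h.exact _ (y - w)).1 (by rw [map_sub, hwp, sub_self])
    refine ⟨x', h.injective _ ?_⟩
    rw [← h.d_i, hx', map_sub, hw, sub_zero, hy]

end DimensionShifting

/-! ### Coinduced modules -/

section Coinduced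

variable (k : Type u) [Field k] (S : Type w) [Ring S] [Algebra k S]
variable (M : Type v) [AddCommGroup M] [Module k M]

/-- The coinduced `S`-module `Hom_k(S, M)`. -/
def Coind : Type (max w v) := S →ₗ[k] M

instance : AddCommGroup (Coind k S M) := inferInstanceAs (AddCommGroup (S →ₗ[k] M))

instance : Module k (Coind k S M) := inferInstanceAs (Module k (S →ₗ[k] M))

instance : FunLike (Coind k S M) S M := inferInstanceAs (FunLike (S →ₗ[k] M) S M)

instance : LinearMapClass (Coind k S M) k S M := inferInstanceAs (LinearMapClass (S →ₗ[k] M) k S M)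

variable {k S M}

@[ext]
theorem Coind.ext {φ ψ : Coind k S M} (h : ∀ s, φ s = ψ s) : φ = ψ := LinearMap.ext h

/-- The action goes through the argument. When `M` is itself an `S`-module, plain linear maps also
carry the pointwise action, which is why `Coind` is a type of its own. -/
instance : Module S (Coind k S M) where
  smul s φ := LinearMap.comp φ (LinearMap.mulRight k s)
  one_smul φ := Coind.ext fun t => congrArg φ (mul_one t)
  mul_smul s s' φ := Coind.ext fun t => congrArg φ (mul_assoc t s s').symm
  smul_zero _ := rfl
  smul_add _ _ _ := rfl
  add_smul s s' φ := Coind.ext fun t => (congrArg φ (mul_add t s s')).trans (map_add φ _ _)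
  zero_smul φ := Coind.ext fun t => (congrArg φ (mul_zero t)).trans (map_zero φ)

theorem Coind.smul_apply (s : S) (φ : Coind k S M) (t : S) : (s • φ) t = φ (t * s) := rfl

theorem Coind.smul_apply' (c : k) (φ : Coind k S M) (t : S) : (c • φ) t = c • φ t := rfl

theorem Coind.add_apply (φ ψ : Coind k S M) (t : S) : (φ + ψ) t = φ t + ψ t := rfl

theorem Coind.sum_apply {ι : Type*} (s : Finset ι) (φ : ι → Coind k S M) (t : S) :
    (∑ i ∈ s, φ i) t = ∑ i ∈ s, φ i t :=
  LinearMap.sum_apply s φ t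

instance : IsScalarTower k S (Coind k S M) := ⟨fun c s φ => Coind.ext fun t => by
  rw [Coind.smul_apply, mul_smul_comm, map_smul, Coind.smul_apply', Coind.smul_apply]⟩

variable (k S M)

/-- The embedding of an `S`-module into the coinduced module. -/
def toCoind [Module S M] [IsScalarTower k S M] : M →ₗ[S] Coind k S M where
  toFun m := (LinearMap.toSpanSingleton S M m).restrictScalars k
  map_add' m m' := Coind.ext fun t => smul_add t m m'
  map_smul' s m := Coind.ext fun t => smul_smul t s m

theorem toCoind_injective [Module S M] [IsScalarTower k S M] :
    Function.Injective (toCoind k S M) := fun m m' h => by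
  have : (1 : S) • m = (1 : S) • m' := congrArg (fun φ : Coind k S M => φ 1) h
  simpa using this

end Coinduced

theorem contractNth_zero_cons {A : Type*} [Mul A] {n : ℕ} (a : A) (x : Fin (n + 1) → A) :
    Fin.contractNth (0 : Fin (n + 1)).castSucc (· * ·) (Fin.cons a x : Fin (n + 2) → A) =
      Fin.cons (a * x 0) (Fin.tail x) := by
  funext l
  refine Fin.cases ?_ (fun l => ?_) l <;> simp [Fin.contractNth, Fin.tail]

theorem contractNth_succ_cons {A : Type*} [Mul A] {n : ℕ} (a : A) (x : Fin (n + 1) → A)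
    (j : Fin n) :
    Fin.contractNth j.succ.castSucc (· * ·) (Fin.cons a x : Fin (n + 2) → A) =
      Fin.cons a (Fin.contractNth j.castSucc (· * ·) x) := by
  funext l
  refine Fin.cases ?_ (fun l => ?_) l
  · simp [Fin.contractNth]
  · simp only [Fin.contractNth, Fin.cons_succ, Fin.val_succ, Fin.val_castSucc,
      add_lt_add_iff_right, add_left_inj]
    rfl

/-! ### Exactness in the coefficients, and acyclicity of coinduced ones -/

section HochschildCohomology

variable (k : Type u) [Field k] (A : Type w) [Ring A] [Algebra k A]

/-- Cochains are only `k`-multilinear, so `k`-linear splittings of the coefficient sequence, which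
exist over a field, give exactness in each degree. Bimodule linearity is needed just for
compatibility with the differentials. -/
theorem isShortExact_cochainMap {M I N : Type*} [AddCommGroup M] [Module k M]
    [Module (A ⊗[k] Aᵐᵒᵖ) M] [IsScalarTower k (A ⊗[k] Aᵐᵒᵖ) M] [AddCommGroup I] [Module k I]
    [Module (A ⊗[k] Aᵐᵒᵖ) I] [IsScalarTower k (A ⊗[k] Aᵐᵒᵖ) I] [AddCommGroup N] [Module k N]
    [Module (A ⊗[k] Aᵐᵒᵖ) N] [IsScalarTower k (A ⊗[k] Aᵐᵒᵖ) N]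
    {i : M →ₗ[A ⊗[k] Aᵐᵒᵖ] I} {p : I →ₗ[A ⊗[k] Aᵐᵒᵖ] N} (hi : Function.Injective i)
    (hip : Function.Exact i p) (hp : Function.Surjective p) :
    IsShortExact (cochainD k A M) (cochainD k A I) (cochainD k A N)
      (cochainMap (i.restrictScalars k)) (cochainMap (p.restrictScalars k)) where
  d_d _ y := cochainD_cochainD y
  d_i _ x := cochainD_cochainMap i x
  d_p _ y := cochainD_cochainMap p y
  injective n f g h := by
    ext x
    exact hi (congrArg (fun F : NCochain k A I n => F.1 x) h)
  exact n f := by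
    obtain ⟨ρ, hρ⟩ := LinearMap.exists_leftInverse_of_injective (i.restrictScalars k)
      (LinearMap.ker_eq_bot.2 hi)
    constructor
    · intro h
      refine ⟨cochainMap ρ n f, ?_⟩
      ext x
      obtain ⟨m, hm⟩ := (hip (f.1 x)).1 (congrArg (fun F : NCochain k A N n => F.1 x) h)
      have : ρ (i m) = m := LinearMap.congr_fun hρ m
      simp only [cochainMap_apply, LinearMap.restrictScalars_apply, ← hm, this]
    · rintro ⟨g, rfl⟩
      ext x
      exact (hip _).2 ⟨_, rfl⟩
  surjective n g := by
    obtain ⟨σ, hσ⟩ := LinearMap.exists_rightInverse_of_surjective (p.restrictScalars k)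
      (LinearMap.range_eq_top.2 hp)
    refine ⟨cochainMap σ n g, ?_⟩
    ext x
    exact LinearMap.congr_fun hσ (g.1 x)

variable {k A} in
/-- The contraction of the cochains with coinduced coefficients. -/
def coindContraction {M : Type*} [AddCommGroup M] [Module k M] {n : ℕ}
    (f : NCochain k A (Coind k (A ⊗[k] Aᵐᵒᵖ) M) (n + 1)) :
    NCochain k A (Coind k (A ⊗[k] Aᵐᵒᵖ) M) n :=
  ⟨MultilinearMap.mk'
    (fun x => (TensorProduct.lift (LinearMap.mk₂ k
      (fun (a : A) (c : Aᵐᵒᵖ) => (f.1.curryLeft a x) ((1 : A) ⊗ₜ[k] c))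
      (fun a a' c => by rw [map_add, add_apply, Coind.add_apply])
      (fun r a c => by rw [map_smul, smul_apply, Coind.smul_apply'])
      (fun a c c' => by rw [TensorProduct.tmul_add, map_add])
      (fun r a c => by rw [TensorProduct.tmul_smul, map_smul])) :
        A ⊗[k] Aᵐᵒᵖ →ₗ[k] M))
    (fun x i y y' => TensorProduct.ext' fun a c => by
      simp only [TensorProduct.lift.tmul, LinearMap.mk₂_apply, MultilinearMap.map_update_add]
      rfl)
    (fun x i r y => TensorProduct.ext' fun a c => by
      simp only [TensorProduct.lift.tmul, LinearMap.mk₂_apply, MultilinearMap.map_update_smul]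
      rfl), by
    rintro x ⟨i, hi⟩
    refine TensorProduct.ext' fun a c => ?_
    change (f.1 (Fin.cons a x)) ((1 : A) ⊗ₜ[k] c) = 0
    rw [f.2 (Fin.cons a x) ⟨i.succ, by simpa using hi⟩]
    rfl⟩

theorem coindContraction_apply {M : Type*} [AddCommGroup M] [Module k M] {n : ℕ}
    (f : NCochain k A (Coind k (A ⊗[k] Aᵐᵒᵖ) M) (n + 1)) (x : Fin n → A) (a : A) (c : Aᵐᵒᵖ) :
    (coindContraction f).1 x (a ⊗ₜ[k] c) = (f.1 (Fin.cons a x)) ((1 : A) ⊗ₜ[k] c) := rfl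

/-- Evaluate the cocycle equation at `(a, x)` and the resulting map at `1 ⊗ c`. The initial coface
contributes `f(x)(a ⊗ c)`, and the other terms are minus the coboundary of `coindContraction f` at
the same place. -/
theorem exactSucc_cochainD_coind (M : Type*) [AddCommGroup M] [Module k M] (n : ℕ) :
    ExactSucc (cochainD k A (Coind k (A ⊗[k] Aᵐᵒᵖ) M)) n := by
  intro f hf
  refine ⟨coindContraction f, ?_⟩
  ext x : 2
  refine TensorProduct.ext' fun a c => ?_
  have h : (multilinearCobd f.1 (Fin.cons a x : Fin (n + 2) → A)) ((1 : A) ⊗ₜ[k] c) = 0 := by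
    have h0 : multilinearCobd f.1 = 0 := congrArg Subtype.val hf
    rw [h0]
    rfl
  change (multilinearCobd (coindContraction f).1 x) (a ⊗ₜ[k] c) = f.1 x (a ⊗ₜ[k] c)
  rw [multilinearCobd_apply] at h ⊢
  simp only [Coind.add_apply, Coind.sum_apply, Coind.smul_apply, Coind.smul_apply',
    Algebra.TensorProduct.tmul_mul_tmul, mul_one, one_mul, coindContraction_apply] at h ⊢
  rw [Fin.sum_univ_succ] at h
  have e2 : Fin.init (Fin.cons a x : Fin (n + 2) → A) = Fin.cons a (Fin.init x) := by
    funext l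
    refine Fin.cases ?_ (fun l => ?_) l
    · rfl
    · rfl
  have e3 : (Fin.cons a x : Fin (n + 2) → A) (Fin.last (n + 1)) = x (Fin.last n) := rfl
  rw [contractNth_zero_cons, e2, e3, Fin.tail_cons, Fin.cons_zero] at h
  simp only [contractNth_succ_cons] at h
  simp only [Fin.val_zero, Fin.val_succ, zero_add, pow_one, pow_succ (-1 : k) (_ + 1), mul_neg,
    mul_one, neg_smul, one_smul, Finset.sum_neg_distrib] at h
  rw [eq_comm, ← sub_eq_zero, ← h]
  abel

end HochschildCohomology

theorem exists_comp_eq_of_surjective {S : Type*} [Ring S] {V W M : Type*} [AddCommGroup V]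
    [Module S V] [AddCommGroup W] [Module S W] [AddCommGroup M] [Module S M] {f : V →ₗ[S] W}
    (hf : Function.Surjective f) {φ : V →ₗ[S] M} (h : LinearMap.ker f ≤ LinearMap.ker φ) :
    ∃ ψ : W →ₗ[S] M, ψ ∘ₗ f = φ :=
  ⟨(LinearMap.ker f).liftQ φ h ∘ₗ (f.quotKerEquivOfSurjective hf).symm.toLinearMap,
    LinearMap.ext fun x => by simp [LinearMap.quotKerEquivOfSurjective_symm_apply]⟩

theorem exists_comp_eq_of_ker_le {k : Type*} [Field k] {V W M : Type*} [AddCommGroup V]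
    [Module k V] [AddCommGroup W] [Module k W] [AddCommGroup M] [Module k M] {f : V →ₗ[k] W}
    {φ : V →ₗ[k] M} (h : LinearMap.ker f ≤ LinearMap.ker φ) :
    ∃ ψ : W →ₗ[k] M, ψ ∘ₗ f = φ := by
  obtain ⟨ψ, hψ⟩ := exists_comp_eq_of_surjective (f := f.rangeRestrict)
    f.surjective_rangeRestrict (φ := φ) (by rwa [LinearMap.ker_rangeRestrict])
  obtain ⟨ψ', hψ'⟩ := ψ.exists_extend
  exact ⟨ψ', by rw [← hψ, ← hψ']; rfl⟩

/-! ### Maps out of a projective resolution -/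

section Resolution

variable {S : Type w} [Ring S] {P : ℕ → Type*} [∀ n, AddCommGroup (P n)] [∀ n, Module S (P n)]

/-- The differential of the complex `Hom_S(P, M)`. -/
def homD (d : ∀ n, P (n + 1) →ₗ[S] P n) (M : Type*) [AddCommGroup M] [Module S M] (n : ℕ) :
    (P n →ₗ[S] M) →+ (P (n + 1) →ₗ[S] M) where
  toFun φ := φ ∘ₗ d n
  map_zero' := LinearMap.zero_comp _
  map_add' φ ψ := LinearMap.add_comp _ ψ φ

theorem homD_apply (d : ∀ n, P (n + 1) →ₗ[S] P n) {M : Type*} [AddCommGroup M] [Module S M]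
    {n : ℕ} (φ : P n →ₗ[S] M) : homD d M n φ = φ ∘ₗ d n := rfl

variable {d : ∀ n, P (n + 1) →ₗ[S] P n}

/-- Projectivity is what makes the map to the quotient complex surjective; the rest is left
exactness of `Hom`. -/
theorem isShortExact_homD [∀ n, Module.Projective S (P n)] {M I N : Type*} [AddCommGroup M]
    [Module S M] [AddCommGroup I] [Module S I] [AddCommGroup N] [Module S N]
    (hd : ∀ n, Function.Exact (d (n + 1)) (d n)) {i : M →ₗ[S] I} {p : I →ₗ[S] N}
    (hi : Function.Injective i) (hip : Function.Exact i p) (hp : Function.Surjective p) :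
    IsShortExact (homD d M) (homD d I) (homD d N)
      (fun n => { toFun := fun φ : P n →ₗ[S] M => i ∘ₗ φ, map_zero' := LinearMap.comp_zero _,
                  map_add' := fun φ ψ => LinearMap.comp_add φ ψ i })
      (fun n => { toFun := fun φ : P n →ₗ[S] I => p ∘ₗ φ, map_zero' := LinearMap.comp_zero _,
                  map_add' := fun φ ψ => LinearMap.comp_add φ ψ p }) where
  d_d n φ := LinearMap.ext fun x => by
    change φ (d n (d (n + 1) x)) = 0
    rw [(hd n).apply_apply_eq_zero, map_zero]
  d_i _ _ := rfl
  d_p _ _ := rfl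
  injective n φ ψ h := LinearMap.ext fun x => hi (LinearMap.congr_fun h x)
  exact n φ := by
    constructor
    · intro h
      have hr : ∀ x, φ x ∈ LinearMap.range i := fun x => (hip _).1 (LinearMap.congr_fun h x)
      refine ⟨(LinearEquiv.ofInjective i hi).symm.toLinearMap ∘ₗ φ.codRestrict _ hr, ?_⟩
      refine LinearMap.ext fun x => ?_
      exact congrArg Subtype.val
        ((LinearEquiv.ofInjective i hi).apply_symm_apply (φ.codRestrict _ hr x))
    · rintro ⟨ψ, rfl⟩
      exact LinearMap.ext fun x => (hip _).2 ⟨_, rfl⟩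
  surjective n φ := Module.projective_lifting_property p φ hp

/-- Evaluation at `1` identifies `Hom_S(P, Coind M)` with `Hom_k(P, M)`, and `Hom_k(-, M)` is exact
over a field. The primitive is `x ↦ (t ↦ ψ'(t x))`, with `ψ'` a `k`-linear primitive. -/
theorem exactSucc_homD_coind (k : Type*) [Field k] [Algebra k S]
    (hd : ∀ n, Function.Exact (d (n + 1)) (d n)) (M : Type*) [AddCommGroup M] [Module k M]
    (n : ℕ) : ExactSucc (homD d (Coind k S M)) n := by
  intro φ hφ
  let _ (n : ℕ) : Module k (P n) := Module.compHom (P n) (algebraMap k S)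
  have (n : ℕ) : IsScalarTower k S (P n) := ⟨fun c s x => by
    rw [Algebra.smul_def, mul_smul]; rfl⟩
  let φ' : P (n + 1) →ₗ[k] M :=
    { toFun := fun x => φ x 1
      map_add' := fun x y => by rw [map_add]; rfl
      map_smul' := fun c x => by rw [LinearMap.map_smul_of_tower]; rfl }
  let dk : P (n + 1) →ₗ[k] P n := (d n).restrictScalars k
  have hker : LinearMap.ker dk ≤ LinearMap.ker φ' := by
    intro x hx
    obtain ⟨y, rfl⟩ := (hd n x).1 hx
    change φ (d (n + 1) y) 1 = 0
    rw [show φ (d (n + 1) y) = 0 from LinearMap.congr_fun hφ y]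
    rfl
  obtain ⟨ψ', hψ'⟩ := exists_comp_eq_of_ker_le hker
  refine ⟨{ toFun := fun x => ψ' ∘ₗ (LinearMap.toSpanSingleton S (P n) x).restrictScalars k
            map_add' := fun x y => Coind.ext fun t => ?_
            map_smul' := fun s x => Coind.ext fun t => ?_ }, ?_⟩
  · change ψ' (t • (x + y)) = ψ' (t • x) + ψ' (t • y)
    rw [smul_add, map_add]
  · change ψ' (t • s • x) = ψ' ((t * s) • x)
    rw [mul_smul]
  · refine LinearMap.ext fun x => Coind.ext fun t => ?_
    change ψ' (t • d n x) = φ x t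
    rw [← map_smul]
    refine (LinearMap.congr_fun hψ' (t • x)).trans ?_
    change φ (t • x) 1 = φ x t
    rw [map_smul, Coind.smul_apply, one_mul]

/-- If `Ext^n(-, P n) = 0` for `n > m` and `P` is bounded, then `P` splits in degrees `≥ m`. -/
theorem exactSucc_homD_of_bounded {m N : ℕ} (hd : ∀ n, Function.Exact (d (n + 1)) (d n))
    (hN : ∀ n, N < n → Subsingleton (P n))
    (h : ∀ n, m ≤ n → ExactSucc (homD d (P (n + 1))) n) (M : Type*) [AddCommGroup M] [Module S M]
    {n : ℕ} (hn : m ≤ n) : ExactSucc (homD d M) n := by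
  -- Descending induction from degree `N`, where the target of `g` is zero. Given `g` one degree
  -- higher, `id - d g` is a cocycle with values in `P (n + 1)`; a primitive `g'` of it satisfies
  -- `g' d = id - d g`, and applying `d` gives `d g' d = d`.
  have key : ∀ l n, m ≤ n → N ≤ n + l → ∃ g : P n →ₗ[S] P (n + 1), d n ∘ₗ g ∘ₗ d n = d n := by
    intro l
    induction l with
    | zero =>
      intro n _ hn
      have := hN (n + 1) (by omega)
      exact ⟨0, LinearMap.ext fun x => by rw [Subsingleton.elim x 0]; simp⟩
    | succ l ih =>
      intro n hmn hn
      obtain ⟨g, hg⟩ := ih (n + 1) (by omega) (by omega)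
      obtain ⟨g', hg'⟩ := h n hmn (LinearMap.id - d (n + 1) ∘ₗ g) (by
        rw [homD_apply, LinearMap.sub_comp, LinearMap.id_comp, LinearMap.comp_assoc, hg, sub_self])
      refine ⟨g', ?_⟩
      rw [homD_apply] at hg'
      rw [hg']
      refine LinearMap.ext fun x => ?_
      simp [(hd n).apply_apply_eq_zero]
  intro φ hφ
  obtain ⟨g, hg⟩ := key N (n + 1) (by omega) (by omega)
  obtain ⟨g', hg'⟩ := h n hn (LinearMap.id - d (n + 1) ∘ₗ g) (by
    rw [homD_apply, LinearMap.sub_comp, LinearMap.id_comp, LinearMap.comp_assoc, hg, sub_self])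
  -- Applying the cocycle `φ` to `g' d = id - d g` kills the last term.
  refine ⟨φ ∘ₗ g', ?_⟩
  rw [homD_apply] at hg' hφ ⊢
  rw [LinearMap.comp_assoc, hg', LinearMap.comp_sub, ← LinearMap.comp_assoc, hφ,
    LinearMap.zero_comp, sub_zero, LinearMap.comp_id]

end Resolution

/-! ### Bar cochains versus a projective resolution -/

section Comparison

variable {k : Type u} [Field k] {A : Type w} [Ring A] [Algebra k A]

/-- The elements of an `Aᵉ`-module on which the two actions of `A` agree. -/
def IsCentral (k : Type*) [Field k] (A : Type*) [Ring A] [Algebra k A] {M : Type*} [AddCommGroup M] [Module (A ⊗[k] Aᵐᵒᵖ) M] (m : M) : Prop :=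
  ∀ a : A, (a ⊗ₜ[k] (1 : Aᵐᵒᵖ)) • m = ((1 : A) ⊗ₜ[k] MulOpposite.op a) • m

theorem cochainD_zero_eq_zero_iff {M : Type*} [AddCommGroup M] [Module k M]
    [Module (A ⊗[k] Aᵐᵒᵖ) M] [IsScalarTower k (A ⊗[k] Aᵐᵒᵖ) M] (f : NCochain k A M 0) :
    cochainD k A M 0 f = 0 ↔ IsCentral k A (f.1 Fin.elim0) := by
  have h : ∀ x, (cochainD k A M 0 f).1 x = (x 0 ⊗ₜ[k] (1 : Aᵐᵒᵖ)) • f.1 Fin.elim0 -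
      ((1 : A) ⊗ₜ[k] MulOpposite.op (x 0)) • f.1 Fin.elim0 := by
    intro x
    change multilinearCobd f.1 x = _
    rw [multilinearCobd_apply, Subsingleton.elim (Fin.tail x) Fin.elim0,
      Subsingleton.elim (Fin.init x) Fin.elim0]
    simp [sub_eq_add_neg]
  constructor
  · intro h0 a
    have := h fun _ => a
    rw [h0] at this
    exact sub_eq_zero.1 this.symm
  · intro hc
    ext x
    rw [h, hc, sub_self]
    rfl

/-- The cochain of degree `0` given by an element of the coefficients. -/
def zeroCochain {M : Type*} [AddCommGroup M] [Module k M] (m : M) : NCochain k A M 0 :=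
  ⟨MultilinearMap.constOfIsEmpty k _ m, fun _ h => h.choose.elim0⟩

/-- Cocycles of degree `0` are the central elements of the coefficients. This and
`lift_hom_zero_iff` reduce the two complexes to the same condition in degree `0`. -/
theorem lift_cochain_zero_iff {I N : Type*} [AddCommGroup I] [Module k I]
    [Module (A ⊗[k] Aᵐᵒᵖ) I] [IsScalarTower k (A ⊗[k] Aᵐᵒᵖ) I] [AddCommGroup N] [Module k N]
    [Module (A ⊗[k] Aᵐᵒᵖ) N] [IsScalarTower k (A ⊗[k] Aᵐᵒᵖ) N] (p : I →ₗ[A ⊗[k] Aᵐᵒᵖ] N) :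
    (∀ z : NCochain k A N 0, cochainD k A N 0 z = 0 →
      ∃ y, cochainD k A I 0 y = 0 ∧ cochainMap (p.restrictScalars k) 0 y = z) ↔
    ∀ n : N, IsCentral k A n → ∃ m : I, IsCentral k A m ∧ p m = n := by
  constructor
  · intro H n hn
    obtain ⟨y, hy, hyz⟩ := H (zeroCochain n) ((cochainD_zero_eq_zero_iff _).2 hn)
    exact ⟨y.1 Fin.elim0, (cochainD_zero_eq_zero_iff _).1 hy,
      congrArg (fun F : NCochain k A N 0 => F.1 Fin.elim0) hyz⟩
  · intro H z hz
    obtain ⟨m, hm, hmz⟩ := H _ ((cochainD_zero_eq_zero_iff _).1 hz)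
    refine ⟨zeroCochain m, (cochainD_zero_eq_zero_iff _).2 hm, ?_⟩
    ext x
    rw [Subsingleton.elim x Fin.elim0]
    exact hmz

attribute [local instance] instModuleTensorProductMop

theorem tmul_smul_self (a c x : A) :
    (a ⊗ₜ[k] MulOpposite.op c : A ⊗[k] Aᵐᵒᵖ) • x = a * (x * c) := by
  rw [TensorProduct.Algebra.smul_def]
  rfl

/-- The map of `Aᵉ`-modules `A → M` that takes `1` to a central element. -/
def ofCentral {M : Type*} [AddCommGroup M] [Module k M] [Module (A ⊗[k] Aᵐᵒᵖ) M]
    [IsScalarTower k (A ⊗[k] Aᵐᵒᵖ) M] {m : M} (hm : IsCentral k A m) : A →ₗ[A ⊗[k] Aᵐᵒᵖ] M where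
  toFun a := (a ⊗ₜ[k] (1 : Aᵐᵒᵖ)) • m
  map_add' a a' := by rw [TensorProduct.add_tmul, add_smul]
  map_smul' s a := by
    have key (x c : A) : ((x ⊗ₜ[k] MulOpposite.op c : A ⊗[k] Aᵐᵒᵖ) • a) ⊗ₜ[k] (1 : Aᵐᵒᵖ) • m =
        (x ⊗ₜ[k] MulOpposite.op c : A ⊗[k] Aᵐᵒᵖ) • a ⊗ₜ[k] (1 : Aᵐᵒᵖ) • m := by
      rw [tmul_smul_self, smul_smul, Algebra.TensorProduct.tmul_mul_tmul, mul_one,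
        ← mul_assoc, show (x * a * c) ⊗ₜ[k] (1 : Aᵐᵒᵖ) = (x * a) ⊗ₜ[k] (1 : Aᵐᵒᵖ) * c ⊗ₜ[k] (1 : Aᵐᵒᵖ)
          by rw [Algebra.TensorProduct.tmul_mul_tmul, mul_one], mul_smul, hm, smul_smul,
        Algebra.TensorProduct.tmul_mul_tmul, mul_one, one_mul]
    induction s using TensorProduct.induction_on with
    | zero =>
      -- Zero is itself a pure tensor, so `key` covers it.
      rw [← TensorProduct.zero_tmul A (MulOpposite.op (0 : A))]
      exact key 0 0
    | add s t hs ht =>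
      simp only [RingHom.id_apply, add_smul, TensorProduct.add_tmul] at *
      rw [hs, ht]
    | tmul x y => exact key x y.unop

theorem isCentral_map_one {M : Type*} [AddCommGroup M] [Module (A ⊗[k] Aᵐᵒᵖ) M]
    (ψ : A →ₗ[A ⊗[k] Aᵐᵒᵖ] M) : IsCentral k A (ψ 1) := fun a => by
  rw [← map_smul, ← map_smul, ← MulOpposite.op_one, tmul_smul_self, tmul_smul_self]
  simp

variable {P : ℕ → Type*} [∀ n, AddCommGroup (P n)] [∀ n, Module (A ⊗[k] Aᵐᵒᵖ) (P n)]

/-- Cocycles of degree `0` factor through the augmentation, and a bimodule map out of `A` amounts to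
the central element that is the image of `1`. -/
theorem lift_hom_zero_iff {d : ∀ n, P (n + 1) →ₗ[A ⊗[k] Aᵐᵒᵖ] P n} {ε : P 0 →ₗ[A ⊗[k] Aᵐᵒᵖ] A}
    (hε : Function.Exact (d 0) ε) (hs : Function.Surjective ε) {I N : Type*} [AddCommGroup I]
    [Module k I] [Module (A ⊗[k] Aᵐᵒᵖ) I] [IsScalarTower k (A ⊗[k] Aᵐᵒᵖ) I] [AddCommGroup N]
    [Module k N] [Module (A ⊗[k] Aᵐᵒᵖ) N] [IsScalarTower k (A ⊗[k] Aᵐᵒᵖ) N]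
    (p : I →ₗ[A ⊗[k] Aᵐᵒᵖ] N) :
    (∀ z, homD d N 0 z = 0 → ∃ y, homD d I 0 y = 0 ∧ p ∘ₗ y = z) ↔
    ∀ n : N, IsCentral k A n → ∃ m : I, IsCentral k A m ∧ p m = n := by
  have desc (z : P 0 →ₗ[A ⊗[k] Aᵐᵒᵖ] N) (hz : homD d N 0 z = 0) :
      ∃ ψ : A →ₗ[A ⊗[k] Aᵐᵒᵖ] N, ψ ∘ₗ ε = z :=
    exists_comp_eq_of_surjective hs fun x hx => by
      obtain ⟨y, rfl⟩ := (hε x).1 hx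
      exact LinearMap.congr_fun hz y
  have desc' (z : P 0 →ₗ[A ⊗[k] Aᵐᵒᵖ] I) (hz : homD d I 0 z = 0) :
      ∃ ψ : A →ₗ[A ⊗[k] Aᵐᵒᵖ] I, ψ ∘ₗ ε = z :=
    exists_comp_eq_of_surjective hs fun x hx => by
      obtain ⟨y, rfl⟩ := (hε x).1 hx
      exact LinearMap.congr_fun hz y
  have closed (ψ : A →ₗ[A ⊗[k] Aᵐᵒᵖ] I) : homD d I 0 (ψ ∘ₗ ε) = 0 := LinearMap.ext fun x => by
    change ψ (ε (d 0 x)) = 0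
    rw [hε.apply_apply_eq_zero, map_zero]
  have closed' (ψ : A →ₗ[A ⊗[k] Aᵐᵒᵖ] N) : homD d N 0 (ψ ∘ₗ ε) = 0 := LinearMap.ext fun x => by
    change ψ (ε (d 0 x)) = 0
    rw [hε.apply_apply_eq_zero, map_zero]
  have hone {a : A} : (a ⊗ₜ[k] (1 : Aᵐᵒᵖ)) • (1 : A) = a := by
    rw [← MulOpposite.op_one, tmul_smul_self, mul_one, mul_one]
  constructor
  · intro H n hn
    obtain ⟨y, hy, hyz⟩ := H (ofCentral hn ∘ₗ ε) (closed' _)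
    obtain ⟨ψ, rfl⟩ := desc' y hy
    refine ⟨ψ 1, isCentral_map_one ψ, ?_⟩
    obtain ⟨x, hx⟩ := hs 1
    have := LinearMap.congr_fun hyz x
    simp only [LinearMap.comp_apply, hx] at this
    rw [this]
    exact one_smul (A ⊗[k] Aᵐᵒᵖ) n
  · intro H z hz
    obtain ⟨ψ, rfl⟩ := desc z hz
    obtain ⟨m, hm, hmz⟩ := H _ (isCentral_map_one ψ)
    refine ⟨ofCentral hm ∘ₗ ε, closed _, LinearMap.ext fun x => ?_⟩
    change p ((ε x ⊗ₜ[k] (1 : Aᵐᵒᵖ)) • m) = ψ (ε x)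
    rw [map_smul, hmz, ← map_smul, hone]

/-- The Hochschild cochains and a projective resolution of `A` have the same acyclic
coefficients. -/
theorem exactSucc_cochainD_iff [∀ n, Module.Projective (A ⊗[k] Aᵐᵒᵖ) (P n)]
    {d : ∀ n, P (n + 1) →ₗ[A ⊗[k] Aᵐᵒᵖ] P n} {ε : P 0 →ₗ[A ⊗[k] Aᵐᵒᵖ] A}
    (hd : ∀ n, Function.Exact (d (n + 1)) (d n)) (hε : Function.Exact (d 0) ε)
    (hs : Function.Surjective ε) (n : ℕ) : ∀ (M : Type (max v w)) [AddCommGroup M] [Module k M]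
    [Module (A ⊗[k] Aᵐᵒᵖ) M] [IsScalarTower k (A ⊗[k] Aᵐᵒᵖ) M],
    ExactSucc (cochainD k A M) n ↔ ExactSucc (homD d M) n := by
  -- Embed `M` into its coinduced module. Coinduced coefficients are acyclic for both complexes, so
  -- both questions pass to the quotient one degree lower. Hence `M` must vary in the induction, in
  -- a universe large enough to contain these quotients.
  induction n with
  | zero =>
    intro M _ _ _ _
    have hex := LinearMap.exact_map_mkQ_range (toCoind k (A ⊗[k] Aᵐᵒᵖ) M)
    have h1 := isShortExact_cochainMap k A (toCoind_injective k _ M) hex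
      (Submodule.mkQ_surjective _)
    have h2 := isShortExact_homD hd (toCoind_injective k _ M) hex (Submodule.mkQ_surjective _)
    rw [h1.exactSucc_zero_iff (exactSucc_cochainD_coind k A M 0),
      h2.exactSucc_zero_iff (exactSucc_homD_coind k hd M 0), lift_cochain_zero_iff]
    exact (lift_hom_zero_iff hε hs _).symm
  | succ n ih =>
    intro M _ _ _ _
    have hex := LinearMap.exact_map_mkQ_range (toCoind k (A ⊗[k] Aᵐᵒᵖ) M)
    have h1 := isShortExact_cochainMap k A (toCoind_injective k _ M) hex
      (Submodule.mkQ_surjective _)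
    have h2 := isShortExact_homD hd (toCoind_injective k _ M) hex (Submodule.mkQ_surjective _)
    rw [h1.exactSucc_succ_iff (exactSucc_cochainD_coind k A M n)
        (exactSucc_cochainD_coind k A M (n + 1)),
      h2.exactSucc_succ_iff (exactSucc_homD_coind k hd M n) (exactSucc_homD_coind k hd M (n + 1))]
    exact ih _

end Comparison

/-! ### Vanishing of Hochschild cohomology and homology above `d` -/

section Vanishing

variable {k : Type u} [Field k] {A : Type w} [Ring A] [Algebra k A]

theorem exactSucc_cochainD_of_retract {M N : Type*} [AddCommGroup M] [Module k M]
    [Module (A ⊗[k] Aᵐᵒᵖ) M] [IsScalarTower k (A ⊗[k] Aᵐᵒᵖ) M] [AddCommGroup N] [Module k N]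
    [Module (A ⊗[k] Aᵐᵒᵖ) N] [IsScalarTower k (A ⊗[k] Aᵐᵒᵖ) N] {i : M →ₗ[A ⊗[k] Aᵐᵒᵖ] N}
    {r : N →ₗ[A ⊗[k] Aᵐᵒᵖ] M} (hri : r ∘ₗ i = LinearMap.id) {n : ℕ}
    (h : ExactSucc (cochainD k A N) n) : ExactSucc (cochainD k A M) n := by
  intro f hf
  obtain ⟨g, hg⟩ := h (cochainMap (i.restrictScalars k) _ f) (by
    rw [cochainD_cochainMap, hf, map_zero])
  refine ⟨cochainMap (r.restrictScalars k) _ g, ?_⟩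
  rw [cochainD_cochainMap, hg]
  ext x
  exact LinearMap.congr_fun hri (f.1 x)

theorem exactSucc_cochainD_pi {ι : Type*} {M : Type*} [AddCommGroup M] [Module k M]
    [Module (A ⊗[k] Aᵐᵒᵖ) M] [IsScalarTower k (A ⊗[k] Aᵐᵒᵖ) M] {n : ℕ}
    (h : ExactSucc (cochainD k A M) n) : ExactSucc (cochainD k A (ι → M)) n := by
  intro f hf
  have (l : ι) := h (cochainMap ((LinearMap.proj (R := A ⊗[k] Aᵐᵒᵖ) (φ := fun _ : ι => M)
    l).restrictScalars k) _ f) (by rw [cochainD_cochainMap, hf, map_zero])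
  choose g hg using this
  refine ⟨⟨MultilinearMap.pi fun l => (g l).1, fun x hx => funext fun l => (g l).2 x hx⟩, ?_⟩
  ext x l
  have := congrArg (fun F : NCochain k A M (n + 1) => F.1 x) (hg l)
  refine Eq.trans ?_ this
  refine (congrFun (multilinearCobd_apply (M := ι → M) _ x) l).trans ?_
  refine Eq.trans ?_ (multilinearCobd_apply (M := M) _ x).symm
  simp only [Pi.add_apply, Finset.sum_apply, Pi.smul_apply,
    MultilinearMap.pi_apply]

/-- Such a module is a retract of a finite power of `Aᵉ`, and acyclicity passes to powers and
retracts. -/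
theorem exactSucc_cochainD_of_finite_projective {M : Type*} [AddCommGroup M] [Module k M]
    [Module (A ⊗[k] Aᵐᵒᵖ) M] [IsScalarTower k (A ⊗[k] Aᵐᵒᵖ) M] [Module.Finite (A ⊗[k] Aᵐᵒᵖ) M]
    [Module.Projective (A ⊗[k] Aᵐᵒᵖ) M] {n : ℕ}
    (h : ExactSucc (cochainD k A (A ⊗[k] Aᵐᵒᵖ)) n) : ExactSucc (cochainD k A M) n := by
  obtain ⟨m, f, g, -, -, hfg⟩ := Module.Finite.exists_comp_eq_id_of_projective (A ⊗[k] Aᵐᵒᵖ) M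
  exact exactSucc_cochainD_of_retract hfg (exactSucc_cochainD_pi h)

theorem exactSucc_cochainD_env {n : ℕ}
    (h : ∀ f : Cochain k A (n + 1), IsCocycle f → IsCoboundary f) :
    ExactSucc (cochainD k A (A ⊗[k] Aᵐᵒᵖ)) n := by
  intro f hf
  obtain ⟨g, hg⟩ := h ⟨f.1, f.2⟩ fun x => by
    have := congrArg (fun F : NCochain k A (A ⊗[k] Aᵐᵒᵖ) (n + 2) => F.1 x) hf
    exact (multilinearCobd_apply f.1 x).symm.trans this
  refine ⟨⟨g.1, g.2⟩, ?_⟩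
  ext x
  exact (multilinearCobd_apply g.1 x).trans (hg x).symm

attribute [local instance] instModuleTensorProductMop

/-- The Hochschild cohomology of a homologically smooth algebra vanishes in the degrees above `d`
if it does so with values in `Aᵉ`. -/
theorem exactSucc_cochainD_of_homologicallySmooth (hA : HomologicallySmooth k A) {d : ℕ}
    (h : ∀ n, d ≤ n → ∀ f : Cochain k A (n + 1), IsCocycle f → IsCoboundary f) {n : ℕ}
    (hn : d ≤ n) (M : Type (max v w)) [AddCommGroup M] [Module k M] [Module (A ⊗[k] Aᵐᵒᵖ) M]
    [IsScalarTower k (A ⊗[k] Aᵐᵒᵖ) M] : ExactSucc (cochainD k A M) n := by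
  obtain ⟨P, hfin, N, hN⟩ := hA
  have hd (n : ℕ) : Function.Exact (P.complex.d (n + 1 + 1) (n + 1)).hom
      (P.complex.d (n + 1) n).hom :=
    (ShortComplex.ShortExact.moduleCat_exact_iff_function_exact _).1 (P.exact_succ n)
  have hε : Function.Exact (P.complex.d 1 0).hom (P.π.f 0).hom :=
    (ShortComplex.ShortExact.moduleCat_exact_iff_function_exact _).1 P.exact₀
  have hs : Function.Surjective (P.π.f 0).hom :=
    (ModuleCat.epi_iff_surjective _).1 inferInstance
  have hproj (n : ℕ) : Module.Projective (A ⊗[k] Aᵐᵒᵖ) (P.complex.X n) :=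
    (IsProjective.iff_projective _).2 (P.projective n)
  -- The comparison is used twice: here to trade the cochains with values in `M` for the resolution,
  -- and at the end to carry acyclicity of the terms `P (n + 1)`, known for bar cochains, to the
  -- resolution, where it yields the splitting.
  refine (exactSucc_cochainD_iff (P := fun n => P.complex.X n)
    (d := fun n => (P.complex.d (n + 1) n).hom) (ε := (P.π.f 0).hom) hd hε hs n M).2 ?_
  refine exactSucc_homD_of_bounded (m := d) (N := N) hd hN (fun n hn => ?_) M hn
  let _ : Module k (P.complex.X (n + 1)) := Module.compHom _ (algebraMap k (A ⊗[k] Aᵐᵒᵖ))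
  have : IsScalarTower k (A ⊗[k] Aᵐᵒᵖ) (P.complex.X (n + 1)) := ⟨fun c s x =>
    (congrArg (· • x) (Algebra.smul_def c s)).trans (mul_smul (algebraMap k _ c) s x)⟩
  have := hfin (n + 1)
  exact (exactSucc_cochainD_iff (P := fun n => P.complex.X n)
    (d := fun n => (P.complex.d (n + 1) n).hom) (ε := (P.π.f 0).hom) hd hε hs n _).1
    (exactSucc_cochainD_of_finite_projective (exactSucc_cochainD_env (h n hn)))

/-- `Aᵉ` acts on `A` from the right here, so its transpose makes the dual a left module. -/
theorem envAct_mul (s t : A ⊗[k] Aᵐᵒᵖ) : envAct k A (s * t) = envAct k A t * envAct k A s := by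
  induction s using TensorProduct.induction_on with
  | zero => simp
  | add s s' hs hs' => rw [add_mul, map_add, hs, hs', map_add, mul_add]
  | tmul x y =>
    induction t using TensorProduct.induction_on with
    | zero => simp
    | add t t' ht ht' => rw [mul_add, map_add, ht, ht', map_add, add_mul]
    | tmul x' y' =>
      ext c
      simp [envAct, mul_assoc]

theorem envAct_tmul (x c : A) (y : Aᵐᵒᵖ) : envAct k A (x ⊗ₜ[k] y) c = y.unop * (c * x) := by
  simp [envAct]

variable (k A)

/-- The dual of the bimodule `A`. -/
def DualBimodule : Type (max u w) := A →ₗ[k] k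

instance : AddCommGroup (DualBimodule k A) := inferInstanceAs (AddCommGroup (A →ₗ[k] k))

instance : Module k (DualBimodule k A) := inferInstanceAs (Module k (A →ₗ[k] k))

instance : FunLike (DualBimodule k A) A k := inferInstanceAs (FunLike (A →ₗ[k] k) A k)

instance : LinearMapClass (DualBimodule k A) k A k :=
  inferInstanceAs (LinearMapClass (A →ₗ[k] k) k A k)

variable {k A}

@[ext]
theorem DualBimodule.ext {φ ψ : DualBimodule k A} (h : ∀ a, φ a = ψ a) : φ = ψ := LinearMap.ext h

instance : Module (A ⊗[k] Aᵐᵒᵖ) (DualBimodule k A) where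
  smul s φ := LinearMap.comp φ (envAct k A s)
  one_smul φ := DualBimodule.ext fun a => congrArg φ (by
    rw [Algebra.TensorProduct.one_def, envAct_tmul]; simp)
  mul_smul s t φ := DualBimodule.ext fun a => congrArg φ (by rw [envAct_mul]; rfl)
  smul_zero _ := rfl
  smul_add _ _ _ := rfl
  add_smul s t φ := DualBimodule.ext fun a =>
    (congrArg φ (by rw [map_add]; rfl)).trans (map_add φ (envAct k A s a) (envAct k A t a))
  zero_smul φ := DualBimodule.ext fun a =>
    (congrArg φ (by rw [map_zero]; rfl)).trans (map_zero φ)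

theorem DualBimodule.smul_apply (s : A ⊗[k] Aᵐᵒᵖ) (φ : DualBimodule k A) (a : A) :
    (s • φ) a = φ (envAct k A s a) := rfl

theorem DualBimodule.smul_apply' (c : k) (φ : DualBimodule k A) (a : A) :
    (c • φ) a = c • φ a := rfl

theorem DualBimodule.add_apply (φ ψ : DualBimodule k A) (a : A) : (φ + ψ) a = φ a + ψ a := rfl

theorem DualBimodule.sum_apply {ι : Type*} (s : Finset ι) (φ : ι → DualBimodule k A) (a : A) :
    (∑ i ∈ s, φ i) a = ∑ i ∈ s, φ i a :=
  LinearMap.sum_apply s φ a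

/-- Evaluation at an element of `A`. -/
def DualBimodule.eval (a : A) : DualBimodule k A →ₗ[k] k :=
  { toFun := fun φ => φ a
    map_add' := fun _ _ => rfl
    map_smul' := fun _ _ => rfl }

instance : IsScalarTower k (A ⊗[k] Aᵐᵒᵖ) (DualBimodule k A) := ⟨fun c s φ =>
  DualBimodule.ext fun a => by
    rw [DualBimodule.smul_apply, map_smul, LinearMap.smul_apply, map_smul]
    rfl⟩

/-- The cochain with values in the dual of `A` given by a linear form on the chains. -/
def dualCochain {n : ℕ} (ℓ : NChain k A n →ₗ[k] k) : NCochain k A (DualBimodule k A) n :=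
  let F : A →ₗ[k] MultilinearMap k (fun _ : Fin n => A) k :=
    ((ℓ ∘ₗ NChain.mk k A n).compMultilinearMap (PiTensorProduct.tprod k)).curryLeft
  ⟨MultilinearMap.mk' (fun x =>
      ({ toFun := fun a => F a x
         map_add' := fun a a' => by rw [map_add, add_apply]
         map_smul' := fun r a => by rw [map_smul, smul_apply]; rfl } : A →ₗ[k] k))
    (fun x i y y' => DualBimodule.ext fun a => (F a).map_update_add x i y y')
    (fun x i r y => DualBimodule.ext fun a => (F a).map_update_smul x i r y), by
    rintro x ⟨i, hi⟩
    refine DualBimodule.ext fun a => ?_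
    change ℓ (NChain.mk k A n (PiTensorProduct.tprod k (Fin.cons a x))) = 0
    rw [show NChain.mk k A n (PiTensorProduct.tprod k (Fin.cons a x)) = 0 from
      (Submodule.Quotient.mk_eq_zero _).2
        (tprod_mem_degenerate _ i.succ (Fin.succ_ne_zero _) (by simpa using hi)), map_zero]⟩

theorem dualCochain_apply {n : ℕ} (ℓ : NChain k A n →ₗ[k] k) (x : Fin n → A) (a : A) :
    (dualCochain ℓ).1 x a = ℓ (NChain.mk k A n (PiTensorProduct.tprod k (Fin.cons a x))) := rfl

theorem dualCochain_injective {n : ℕ} :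
    Function.Injective (dualCochain (k := k) (A := A) (n := n)) := fun ℓ ℓ' h =>
  nchain_ext fun x => by
    have := congrArg (fun F : NCochain k A (DualBimodule k A) n => F.1 (Fin.tail x) (x 0)) h
    simpa only [dualCochain_apply, Fin.cons_self_tail] using this

theorem dualCochain_surjective {n : ℕ} :
    Function.Surjective (dualCochain (k := k) (A := A) (n := n)) := by
  intro f
  let g : MultilinearMap k (fun _ : Fin (n + 1) => A) k :=
    LinearMap.uncurryLeft (M := fun _ : Fin (n + 1) => A)
      { toFun := fun a => (DualBimodule.eval a).compMultilinearMap f.1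
        map_add' := fun a a' => by ext x; exact map_add (f.1 x) a a'
        map_smul' := fun r a => by ext x; exact map_smul (f.1 x) r a }
  refine ⟨(degenerate k A n).liftQ (PiTensorProduct.lift g) (Submodule.span_le.2 ?_), ?_⟩
  · rintro _ ⟨x, ⟨i, hi, hx⟩, rfl⟩
    obtain ⟨i, rfl⟩ := Fin.exists_succ_eq.2 hi
    change PiTensorProduct.lift g _ = 0
    rw [PiTensorProduct.lift.tprod]
    change f.1 (Fin.tail x) (x 0) = 0
    rw [f.2 _ ⟨i, hx⟩]
    rfl
  · ext x a
    refine (PiTensorProduct.lift.tprod (φ := g) _).trans ?_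
    change f.1 (Fin.tail (Fin.cons a x : Fin (n + 1) → A)) ((Fin.cons a x : Fin (n + 1) → A) 0) = _
    rw [Fin.tail_cons, Fin.cons_zero]

/-- The cochains with values in the dual of `A` are the dual complex of the normalized chains: the
left action corresponds to the face `a₀a₁` and the right action to the face that wraps around. -/
theorem cochainD_dualCochain {n : ℕ} (ℓ : NChain k A n →ₗ[k] k) :
    cochainD k A (DualBimodule k A) n (dualCochain ℓ) = dualCochain (ℓ ∘ₗ b k A n) := by
  ext x a
  refine (congrArg (fun φ : DualBimodule k A => φ a)
    (multilinearCobd_apply (dualCochain ℓ).1 x)).trans ?_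
  rw [dualCochain_apply, LinearMap.comp_apply, b_mk, hochschildB_tprod, Fin.sum_univ_succ,
    contractNth_zero_cons]
  simp only [contractNth_succ_cons, map_add, map_sum, map_smul, DualBimodule.add_apply,
    DualBimodule.sum_apply, DualBimodule.smul_apply, DualBimodule.smul_apply', envAct_tmul,
    dualCochain_apply, Fin.val_zero, Fin.val_succ, pow_zero, one_smul, MulOpposite.unop_one,
    one_mul, mul_one, MulOpposite.unop_op]
  rfl

/-- The Hochschild homology of a Calabi-Yau algebra of dimension `d` vanishes above degree `d`. -/
theorem exists_b_eq_of_isCalabiYau {d : ℕ} {η : HC k A d} (hA : IsCalabiYau d η) {n : ℕ}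
    (hn : d ≤ n) (z : NChain k A (n + 1)) (hz : b k A n z = 0) : ∃ w, b k A (n + 1) w = z := by
  obtain ⟨hsm, ζ, -, hζ, -⟩ := hA
  by_contra hcon
  have hmem : z ∉ LinearMap.range (b k A (n + 1)) := fun ⟨w, hw⟩ => hcon ⟨w, hw⟩
  -- A linear form that kills the boundaries but not `z` is a cocycle with values in the dual of
  -- `A`. It is a coboundary, so it has the form `ℓ' ∘ b` and kills the cycle `z`, a contradiction.
  obtain ⟨ℓ, hℓz, hℓ⟩ := Submodule.exists_dual_map_eq_bot_of_notMem hmem inferInstance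
  have hℓb : ℓ ∘ₗ b k A (n + 1) = 0 := LinearMap.ext fun w => by
    have : ℓ (b k A (n + 1) w) ∈ (LinearMap.range (b k A (n + 1))).map ℓ := ⟨_, ⟨w, rfl⟩, rfl⟩
    rwa [hℓ, Submodule.mem_bot] at this
  have hcoc : cochainD k A (DualBimodule k A) (n + 1) (dualCochain ℓ) = 0 := by
    rw [cochainD_dualCochain, hℓb]
    ext x a
    rfl
  obtain ⟨g, hg⟩ := exactSucc_cochainD_of_homologicallySmooth.{u, u, w} hsm
    (fun n hn => hζ (n + 1) (by omega)) hn (DualBimodule k A) _ hcoc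
  obtain ⟨ℓ', rfl⟩ := dualCochain_surjective g
  rw [cochainD_dualCochain] at hg
  have := LinearMap.congr_fun (dualCochain_injective hg) z
  rw [LinearMap.comp_apply, hz, map_zero] at this
  exact hℓz this.symm

end Vanishing

/-! ### From Hochschild homology to negative cyclic homology -/

section CyclicHomology

variable {k : Type u} [Field k] {A : Type w} [Ring A] [Algebra k A]

open Classical in
/-- A solution `w` of `b w = t`, or `0` if `t = 0` or there is none. -/
def solveB (m : ℕ) (t : NChain k A (m + 1)) : NChain k A (m + 2) :=
  if h : t ≠ 0 ∧ ∃ w, b k A (m + 1) w = t then h.2.choose else 0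

theorem b_solveB {m : ℕ} {t : NChain k A (m + 1)} (h : ∃ w, b k A (m + 1) w = t) :
    b k A (m + 1) (solveB m t) = t := by
  by_cases ht : t = 0
  · rw [solveB, dif_neg (by simp [ht]), map_zero, ht]
  · rw [solveB, dif_pos ⟨ht, h⟩]
    exact h.choose_spec

/-- This choice keeps `primitive` homogeneous: components in the wrong chain degrees stay zero. -/
theorem solveB_zero (m : ℕ) : solveB m (0 : NChain k A (m + 1)) = 0 := by
  rw [solveB, dif_neg (by simp)]

/-- The successive solutions `y` of `b y_{m+2} = x_{m+1} - B y_m`. -/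
def primitive (x : Tot k A) : (m : ℕ) → NChain k A m
  | 0 => 0
  | 1 => 0
  | m + 2 => solveB m (x (m + 1) - connes k A m (primitive x m))

theorem primitive_add_two (x : Tot k A) (m : ℕ) :
    primitive x (m + 2) = solveB m (x (m + 1) - connes k A m (primitive x m)) := by
  rw [primitive]

theorem primitive_mem_CC {n : ℤ} {x : Tot k A} (hx : x ∈ CC k A n) :
    primitive x ∈ CC k A (n + 1) := by
  intro m
  induction m using Nat.twoStepInduction with
  | zero => intro _; rfl
  | one => intro _; rfl
  | more m ih _ =>
    intro h
    have h1 : x (m + 1) = 0 := hx _ fun ⟨i, hi⟩ => h ⟨i, by push_cast at hi ⊢; omega⟩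
    have h2 : primitive x m = 0 := ih fun ⟨i, hi⟩ => h ⟨i + 1, by push_cast at hi ⊢; omega⟩
    rw [primitive_add_two, h1, h2, map_zero, sub_zero, solveB_zero]

/-- If the Hochschild homology vanishes above degree `d`, then so does negative cyclic homology. -/
theorem exists_cyclicD_eq {d : ℕ}
    (hb : ∀ n, d ≤ n → ∀ z : NChain k A (n + 1), b k A n z = 0 → ∃ w, b k A (n + 1) w = z)
    {x : Tot k A} (hx : x ∈ CC k A (d + 1)) (hDx : cyclicD k A x = 0) :
    ∃ y ∈ CC k A (d + 1 + 1), cyclicD k A y = x := by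
  have hmem := primitive_mem_CC hx
  have hD0 : b k A 0 (x 1) = 0 := by
    have := congrFun hDx 0
    simpa [cyclicD, uConnes] using this
  have hD (m : ℕ) : b k A (m + 1) (x (m + 2)) + connes k A m (x m) = 0 := by
    have := congrFun hDx (m + 1)
    simpa [cyclicD, uConnes] using this
  have hx0 : x 0 = 0 := hx _ fun ⟨i, hi⟩ => by push_cast at hi; omega
  -- The right side is a `b`-cycle: `bB = -Bb`, the equation two steps earlier and `B² = 0` turn
  -- `-bB y_m` into `B x_{m-1}`, which cancels `b x_{m+1}` because `x` is closed.
  have key (m : ℕ) : b k A (m + 1) (primitive x (m + 2)) =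
      x (m + 1) - connes k A m (primitive x m) := by
    induction m using Nat.strong_induction_on with
    | _ m ih =>
      rw [primitive_add_two]
      refine b_solveB ?_
      -- In these degrees `m ≥ d`, so the Hochschild homology in chain degree `m + 1` vanishes; in
      -- the others both terms of the right side are zero by homogeneity.
      by_cases hm : ∃ i : ℕ, (m : ℤ) = d + 2 * i
      · refine hb m (by omega) _ ?_
        rcases m with _ | _ | m
        · rw [map_sub, b_connes_zero, hD0, sub_zero]
        · have h1 : connes k A 0 (x 0) = 0 := by rw [hx0, map_zero]
          have h2 := hD 0
          rw [h1, add_zero] at h2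
          rw [map_sub, h2, show primitive x (0 + 1) = 0 from rfl, map_zero, map_zero, sub_zero]
        · have h1 := connes_b k A (m + 1) (primitive x (m + 2))
          rw [ih m (by omega), map_sub, connes_connes, sub_zero] at h1
          rw [map_sub, ← neg_eq_iff_eq_neg.2 h1, sub_neg_eq_add]
          exact hD (m + 1)
      · refine ⟨0, ?_⟩
        have h1 : x (m + 1) = 0 := hx _ fun ⟨i, hi⟩ => hm ⟨i, by push_cast at hi; omega⟩
        have h2 : primitive x m = 0 := hmem _ fun ⟨i, hi⟩ => hm ⟨i + 1, by push_cast at hi ⊢; omega⟩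
        rw [h1, h2, map_zero, map_zero, sub_zero]
  refine ⟨primitive x, hmem, funext fun m => ?_⟩
  rcases m with _ | m
  · simp [cyclicD, uConnes, primitive, hx0]
  · simp [cyclicD, uConnes, key]

end CyclicHomology

/-! ### Nakayama arguments for nilpotent ideals -/

section Nilpotent

variable {R : Type*} [CommRing R]

/-- Substitute the inclusion into itself until the power of `I` is zero; no finite generation is
required. -/
theorem le_of_le_sup_smul_of_nilpotent {I : Ideal R} (hI : IsNilpotent I) {M : Type*}
    [AddCommGroup M] [Module R M] {N N' : Submodule R M} (h : N' ≤ N ⊔ I • N') : N' ≤ N := by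
  obtain ⟨n, hn⟩ := hI
  have key : ∀ i : ℕ, N' ≤ N ⊔ I ^ i • N' := by
    intro i
    induction i with
    | zero => simp
    | succ i ih =>
      refine ih.trans (sup_le le_sup_left ?_)
      refine (smul_mono_right _ h).trans ?_
      rw [Submodule.smul_sup, ← mul_smul, ← pow_succ]
      exact sup_le_sup_right Submodule.smul_le_right _
  have := key n
  rwa [hn, Submodule.zero_eq_bot, Submodule.bot_smul, sup_bot_eq] at this

/-- For a surjection `f` onto a flat module, `ker f ∩ I M = I ker f`. -/
theorem ker_inf_smul_top_le {M N : Type*} [AddCommGroup M] [Module R M] [AddCommGroup N]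
    [Module R N] [Module.Flat R N] {f : M →ₗ[R] N} (hf : Function.Surjective f) (I : Ideal R) :
    LinearMap.ker f ⊓ I • ⊤ ≤ I • LinearMap.ker f := by
  rintro x ⟨hx, hxI⟩
  obtain ⟨t, ht⟩ : ∃ t : I ⊗[R] M, TensorProduct.lid R M (I.subtype.rTensor M t) = x := by
    refine Submodule.smul_induction_on hxI (fun r hr m _ => ⟨⟨r, hr⟩ ⊗ₜ m, by simp⟩) ?_
    rintro _ _ ⟨t, rfl⟩ ⟨t', rfl⟩
    exact ⟨t + t', by simp⟩
  -- By flatness `I ⊗ N → N` is injective, and `t` maps to `f x = 0` there. Right exactness then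
  -- lifts `t` to `I ⊗ ker f`.
  have h0 : (LinearMap.lTensor I f) t = 0 := by
    refine Module.Flat.rTensor_preserves_injective_linearMap (M := N) I.subtype I.injective_subtype ?_
    refine (TensorProduct.lid R N).injective ?_
    have comm : (TensorProduct.lid R N).toLinearMap ∘ₗ I.subtype.rTensor N ∘ₗ f.lTensor I =
        f ∘ₗ (TensorProduct.lid R M).toLinearMap ∘ₗ I.subtype.rTensor M :=
      TensorProduct.ext' fun r m => by simp
    rw [map_zero, map_zero, ← show f x = 0 from hx, ← ht]
    exact LinearMap.congr_fun comm t
  obtain ⟨s, rfl⟩ := (lTensor_exact I (LinearMap.exact_subtype_ker_map f) hf t).1 h0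
  rw [← ht]
  clear ht h0
  induction s using TensorProduct.induction_on with
  | zero => simp
  | tmul r m => simpa using Submodule.smul_mem_smul r.2 m.2
  | add s s' h h' => rw [map_add, map_add, map_add]; exact Submodule.add_mem _ h h'

/-- A map onto a flat module that is bijective modulo a nilpotent ideal is bijective. -/
theorem bijective_of_nilpotent {I : Ideal R} (hI : IsNilpotent I) {M N Q : Type*}
    [AddCommGroup M] [Module R M] [AddCommGroup N] [Module R N] [Module.Flat R N]
    [AddCommGroup Q] {f : M →ₗ[R] N} {p : M →+ Q} {q : N →+ Q} (hqf : ∀ x, q (f x) = p x)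
    (hp : Function.Surjective p) (hpI : ∀ x, p x = 0 → x ∈ I • (⊤ : Submodule R M))
    (hqI : ∀ y, q y = 0 → y ∈ I • (⊤ : Submodule R N)) : Function.Bijective f := by
  have hsurj : Function.Surjective f := by
    rw [← LinearMap.range_eq_top, eq_top_iff]
    refine le_of_le_sup_smul_of_nilpotent hI fun y _ => ?_
    obtain ⟨x, hx⟩ := hp (q y)
    refine Submodule.mem_sup.2 ⟨f x, ⟨x, rfl⟩, y - f x, hqI _ ?_, by abel⟩
    rw [map_sub, hqf, hx, sub_self]
  refine ⟨?_, hsurj⟩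
  rw [← LinearMap.ker_eq_bot, eq_bot_iff]
  refine le_of_le_sup_smul_of_nilpotent hI ?_
  rw [bot_sup_eq]
  -- An element of `ker f` dies under `p`, so it lies in `I M`; flatness of the target then puts
  -- `ker f` inside `I ker f`.
  refine le_trans (le_inf le_rfl fun x hx => hpI x ?_) (ker_inf_smul_top_le hsurj I)
  rw [← hqf, show f x = 0 from hx, map_zero]

end Nilpotent

/-! ### Lifting chains, and divisibility by an ideal -/

section Lifting

variable {R : Type u} [CommRing R] {B : Type v} [Ring B] [Algebra R B]
variable {S : Type*} [CommRing S] {C : Type*} [Ring C] [Algebra S C]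

theorem nchainMap_surjective {σ : R →+* S} {f : B →+* C} (h : IsAlgOver σ f)
    (hσ : Function.Surjective σ) (hf : Function.Surjective f) (n : ℕ) :
    Function.Surjective (nchainMap h n) := by
  intro y
  obtain ⟨y, rfl⟩ := Submodule.mkQ_surjective _ y
  induction y using PiTensorProduct.induction_on with
  | smul_tprod r y =>
    obtain ⟨r, rfl⟩ := hσ r
    choose x hx using fun i => hf (y i)
    refine ⟨r • NChain.mk R B n (PiTensorProduct.tprod R x), ?_⟩
    rw [map_smulₛₗ, nchainMap_mk, chainMap_tprod, show f ∘ x = y from funext hx, map_smul]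
    rfl
  | add y y' hy hy' =>
    obtain ⟨x, hx⟩ := hy
    obtain ⟨x', hx'⟩ := hy'
    exact ⟨x + x', by rw [map_add, hx, hx', map_add]; rfl⟩

theorem exists_mem_CC_totMap_eq {σ : R →+* S} {f : B →+* C} (h : IsAlgOver σ f)
    (hσ : Function.Surjective σ) (hf : Function.Surjective f) {n : ℤ} {y : Tot S C}
    (hy : y ∈ CC S C n) : ∃ x ∈ CC R B n, totMap h x = y := by
  classical
  choose x hx using fun m => nchainMap_surjective h hσ hf m (y m)
  refine ⟨fun m => if ∃ i : ℕ, (m : ℤ) = n + 2 * i then x m else 0, fun m hm => if_neg hm,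
    funext fun m => ?_⟩
  change nchainMap h m (if _ then _ else _) = y m
  split_ifs with hm
  · exact hx m
  · rw [map_zero, hy m hm]

theorem exists_sum_of_mem_smul_top {M : Type*} [AddCommGroup M] [Module R M] (s : Finset R) {x : M}
    (hx : x ∈ Ideal.span (s : Set R) • (⊤ : Submodule R M)) :
    ∃ c : R → M, x = ∑ r ∈ s, r • c r := by
  refine Submodule.smul_induction_on hx (fun r hr m _ => ?_) ?_
  · obtain ⟨a, -, rfl⟩ := Submodule.mem_span_finset.1 hr
    refine ⟨fun r => a r • m, ?_⟩
    rw [Finset.sum_smul]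
    refine Finset.sum_congr rfl fun r _ => ?_
    rw [smul_eq_mul, mul_comm, mul_smul]
  · rintro _ _ ⟨c, rfl⟩ ⟨c', rfl⟩
    exact ⟨fun r => c r + c' r, by simp only [smul_add, Finset.sum_add_distrib]⟩

/-- An element of `CC` has infinitely many components. One finite generating set of `I` serves all
of them, so the componentwise expressions assemble into a single finite sum. -/
theorem mem_smul_top_CC {I : Ideal R} (hI : I.FG) {n : ℤ} {ξ : CC R B n}
    (h : ∀ m, (ξ : Tot R B) m ∈ I • (⊤ : Submodule R (NChain R B m))) :
    ξ ∈ I • (⊤ : Submodule R (CC R B n)) := by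
  classical
  obtain ⟨s, rfl⟩ := hI
  choose c hc using fun m => exists_sum_of_mem_smul_top s (h m)
  let y (r : R) : CC R B n :=
    ⟨fun m => if ∃ i : ℕ, (m : ℤ) = n + 2 * i then c m r else 0, fun m hm => if_neg hm⟩
  have : ξ = ∑ r ∈ s, r • y r := by
    refine Subtype.ext (funext fun m => ?_)
    rw [Submodule.coe_sum, Finset.sum_apply]
    by_cases hm : ∃ i : ℕ, (m : ℤ) = n + 2 * i
    · rw [hc m]
      refine Finset.sum_congr rfl fun r _ => ?_
      change _ = r • (if ∃ i : ℕ, (m : ℤ) = n + 2 * i then c m r else 0)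
      rw [if_pos hm]
    · rw [ξ.2 m hm]
      refine (Finset.sum_eq_zero fun r _ => ?_).symm
      change r • (if ∃ i : ℕ, (m : ℤ) = n + 2 * i then c m r else 0) = _
      rw [if_neg hm, smul_zero]
  rw [this]
  exact Submodule.sum_mem _ fun r hr => Submodule.smul_mem_smul (Ideal.subset_span hr) trivial

/-- Replace the arguments one at a time; each replacement changes the value by something in `I Q =
0`. -/
theorem multilinearMap_congr_mod {ι : Type*} [Fintype ι] {M Q : Type*} [AddCommGroup M] [Module R M]
    [AddCommGroup Q] [Module R Q] {I : Ideal R} (hQ : ∀ r ∈ I, ∀ q : Q, r • q = 0)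
    (g : MultilinearMap R (fun _ : ι => M) Q) {x y : ι → M}
    (h : ∀ i, x i - y i ∈ I • (⊤ : Submodule R M)) : g x = g y := by
  classical
  have key (z : ι → M) (i : ι) (m : M) (hm : m ∈ I • (⊤ : Submodule R M)) :
      g (Function.update z i m) = 0 := by
    have : I • (⊤ : Submodule R M) ≤ LinearMap.ker (g.toLinearMap z i) :=
      Submodule.smul_le.2 fun r hr m _ => by
        rw [LinearMap.mem_ker, map_smul, hQ r hr]
    exact this hm
  have ind (s : Finset ι) : g (s.piecewise x y) = g y := by
    induction s using Finset.induction_on with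
    | empty => simp
    | insert i s hi ih =>
      rw [Finset.piecewise_insert, ← sub_add_cancel (x i) (y i), g.map_update_add, key _ _ _ (h i),
        zero_add, ← ih]
      congr 1
      refine Function.update_eq_self_iff.2 ?_
      rw [Finset.piecewise_eq_of_notMem _ _ _ hi]
  simpa using ind Finset.univ

end Lifting

/-! ### Reduction modulo the maximal ideal -/

section Reductions

variable {k : Type u} [Field k] {A : Type w} [Ring A] [Algebra k A]
variable {R : Type v} [CommRing R] [Algebra k R] [IsLocalRing R] [Nilp k R]

theorem isNilpotent_maximalIdeal (k : Type*) [Field k] (R : Type*) [CommRing R] [Algebra k R]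
    [IsLocalRing R] [Nilp k R] : IsNilpotent (IsLocalRing.maximalIdeal R) := by
  have : Module.Finite k R := Nilp.finite
  have : IsArtinianRing R := IsArtinianRing.of_finite k R
  rw [← IsLocalRing.jacobson_eq_maximalIdeal ⊥ bot_ne_top]
  exact IsArtinianRing.isNilpotent_jacobson_bot

theorem fg_maximalIdeal (k : Type*) [Field k] (R : Type*) [CommRing R] [Algebra k R]
    [IsLocalRing R] [Nilp k R] : (IsLocalRing.maximalIdeal R).FG := by
  have : Module.Finite k R := Nilp.finite
  have : IsNoetherianRing R := isNoetherian_of_tower k inferInstance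
  exact IsNoetherian.noetherian _

theorem aug_eq_zero_iff (r : R) : aug k R r = 0 ↔ r ∈ IsLocalRing.maximalIdeal R := by
  rw [← IsLocalRing.residue_eq_zero_iff]
  simp only [aug, AlgHom.comp_apply]
  exact map_eq_zero_iff _ (AlgEquiv.injective _)

theorem aug_surjective : Function.Surjective (aug k R : R →+* k) := fun c =>
  ⟨algebraMap k R c, (aug k R).commutes c⟩

theorem sub_algebraMap_aug_mem (r : R) :
    r - algebraMap k R (aug k R r) ∈ IsLocalRing.maximalIdeal R := by
  rw [← aug_eq_zero_iff (k := k), map_sub, (aug k R).commutes]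
  exact sub_self _

variable {B : Type*} [Ring B] [Algebra R B] {s : B →+* A}
  {hs : IsAlgOver (aug k R : R →+* k) s}

theorem IsReduction.surjective (h : IsReduction hs) : Function.Surjective s := by
  let : Algebra R k := (aug k R : R →+* k).toAlgebra
  let : Module R A := Module.compHom A (aug k R : R →+* k)
  have : IsScalarTower R k A := ⟨fun r c a => mul_smul (aug k R r) c a⟩
  have h' : IsBaseChange k
    ({ toFun := s, map_add' := map_add s, map_smul' := hs.map_smul } : B →ₗ[R] A) := h
  intro a
  obtain ⟨t, rfl⟩ := h'.equiv.surjective a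
  induction t using TensorProduct.induction_on with
  | zero => exact ⟨0, by simp⟩
  | tmul c x =>
    obtain ⟨r, rfl⟩ := aug_surjective (k := k) (R := R) c
    refine ⟨r • x, ?_⟩
    rw [IsBaseChange.equiv_tmul]
    exact hs.map_smul r x
  | add t t' ht ht' =>
    obtain ⟨x, hx⟩ := ht
    obtain ⟨x', hx'⟩ := ht'
    exact ⟨x + x', by rw [map_add, hx, hx', map_add]⟩

/-- The base change property makes `1 ⊗ x` zero in `k ⊗ B`, and right exactness applied to `m → R →
k` identifies the kernel of `B → k ⊗ B` with `m B`. -/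
theorem IsReduction.mem_smul_top (h : IsReduction hs) {x : B} (hx : s x = 0) :
    x ∈ IsLocalRing.maximalIdeal R • (⊤ : Submodule R B) := by
  let : Algebra R k := (aug k R : R →+* k).toAlgebra
  let : Module R A := Module.compHom A (aug k R : R →+* k)
  have : IsScalarTower R k A := ⟨fun r c a => mul_smul (aug k R r) c a⟩
  have h' : IsBaseChange k
    ({ toFun := s, map_add' := map_add s, map_smul' := hs.map_smul } : B →ₗ[R] A) := h
  have h1 : (1 : k) ⊗ₜ[R] x = 0 := by
    refine h'.equiv.injective ?_
    rw [IsBaseChange.equiv_tmul, map_zero, one_smul]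
    exact hx
  have hex : Function.Exact (IsLocalRing.maximalIdeal R).subtype (Algebra.linearMap R k) :=
    fun r => (aug_eq_zero_iff r).trans (by simp)
  obtain ⟨t, ht⟩ := (rTensor_exact B hex (aug_surjective (k := k)) ((1 : R) ⊗ₜ x)).1 (by
    rw [LinearMap.rTensor_tmul]
    refine Eq.trans ?_ h1
    congr 1
    exact map_one (algebraMap R k))
  have : x = TensorProduct.lid R B ((IsLocalRing.maximalIdeal R).subtype.rTensor B t) := by
    rw [ht]; simp
  rw [this]
  clear ht this
  induction t using TensorProduct.induction_on with
  | zero => simp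
  | tmul r y => simpa using Submodule.smul_mem_smul r.2 (Submodule.mem_top (x := y))
  | add t t' ht ht' => rw [map_add, map_add]; exact Submodule.add_mem _ ht ht'

/-- The kernel of the reduction of normalized chains. -/
theorem mem_smul_top_of_nchainMap_eq_zero (h : IsReduction hs) {σ : A → B}
    (hadd : ∀ a a', σ (a + a') = σ a + σ a') (hsmul : ∀ (c : k) a, σ (c • a) = algebraMap k R c • σ a)
    (hone : σ 1 = 1) (hsσ : ∀ a, s (σ a) = a) {n : ℕ} {x : NChain R B n}
    (hx : nchainMap hs n x = 0) :
    x ∈ IsLocalRing.maximalIdeal R • (⊤ : Submodule R (NChain R B n)) := by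
  set m := IsLocalRing.maximalIdeal R
  let Q := NChain R B n ⧸ (m • ⊤ : Submodule R (NChain R B n))
  let π : NChain R B n →ₗ[R] Q := Submodule.mkQ _
  have hQ : ∀ r ∈ m, ∀ q : Q, r • q = 0 := by
    intro r hr q
    obtain ⟨y, rfl⟩ := Submodule.mkQ_surjective _ q
    rw [← map_smul]
    exact (Submodule.Quotient.mk_eq_zero _).2 (Submodule.smul_mem_smul hr trivial)
  let _ : Module k Q := Module.compHom Q (algebraMap k R)
  let g : MultilinearMap R (fun _ : Fin (n + 1) => B) Q :=
    (π ∘ₗ NChain.mk R B n).compMultilinearMap (PiTensorProduct.tprod R)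
  let gk : MultilinearMap k (fun _ : Fin (n + 1) => A) Q :=
    MultilinearMap.mk' (fun x => g (σ ∘ x))
      (fun x i a b => by simp only [Function.comp_update, hadd, MultilinearMap.map_update_add])
      (fun x i c a => by
        simp only [Function.comp_update, hsmul, MultilinearMap.map_update_smul]
        rfl)
  -- The section induces a map from the chains of `A` to the chains of `B` modulo `m`; `σ 1 = 1`
  -- sends degenerate chains to degenerate ones. Multiplicativity of `σ` plays no role.
  let ψ : NChain k A n →ₗ[k] Q := (degenerate k A n).liftQ (PiTensorProduct.lift gk) <| by
    refine Submodule.span_le.2 ?_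
    rintro _ ⟨x, ⟨i, hi, hx⟩, rfl⟩
    change PiTensorProduct.lift gk _ = 0
    rw [PiTensorProduct.lift.tprod]
    change π (NChain.mk R B n _) = 0
    rw [show NChain.mk R B n (PiTensorProduct.tprod R (σ ∘ x)) = 0 from
      (Submodule.Quotient.mk_eq_zero _).2 (tprod_mem_degenerate _ i hi (by simp [hx, hone])),
      map_zero]
  -- The projection modulo `m` factors through the reduction, since `σ (s y)` and `y` agree modulo
  -- `m`; so the kernel of the reduction lies in the kernel of `π`.
  have key (y : NChain R B n) : ψ (nchainMap hs n y) = π y := by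
    obtain ⟨y, rfl⟩ := Submodule.mkQ_surjective _ y
    change ψ (nchainMap hs n (NChain.mk R B n y)) = π (NChain.mk R B n y)
    induction y using PiTensorProduct.induction_on with
    | smul_tprod r y =>
      rw [map_smul, map_smulₛₗ, nchainMap_mk, chainMap_tprod, map_smul, map_smul]
      have h1 : ψ (NChain.mk k A n (PiTensorProduct.tprod k (s ∘ y))) =
          π (NChain.mk R B n (PiTensorProduct.tprod R y)) := by
        refine (PiTensorProduct.lift.tprod (φ := gk) _).trans ?_
        refine multilinearMap_congr_mod hQ g fun i => h.mem_smul_top ?_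
        rw [map_sub]
        exact sub_eq_zero.2 (hsσ _)
      rw [h1]
      have h2 := hQ _ (sub_algebraMap_aug_mem (k := k) r)
        (π (NChain.mk R B n (PiTensorProduct.tprod R y)))
      rw [sub_smul] at h2
      exact (sub_eq_zero.1 h2).symm
    | add y y' hy hy' => simp only [map_add, hy, hy']
  have h0 := key x
  rw [hx, map_zero] at h0
  exact (Submodule.Quotient.mk_eq_zero _).1 h0.symm

end Reductions

theorem cyclicD_mem_CC {R : Type u} [CommRing R] {B : Type v} [Ring B] [Algebra R B] {n : ℤ}
    {x : Tot R B} (hx : x ∈ CC R B (n + 1)) : cyclicD R B x ∈ CC R B n := by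
  intro m hm
  have h1 : x (m + 1) = 0 := hx _ fun ⟨i, hi⟩ => hm ⟨i, by push_cast at hi; omega⟩
  rcases m with _ | m
  · simp [cyclicD, uConnes, h1]
  · have h2 : x m = 0 := hx _ fun ⟨i, hi⟩ => hm ⟨i + 1, by push_cast at hi ⊢; omega⟩
    simp [cyclicD, uConnes, h1, h2]

theorem totMap_congr {R S B C : Type*} [CommRing R] [CommRing S] [Ring B] [Ring C] [Algebra R B]
    [Algebra S C] {σ σ' : R →+* S} {f f' : B →+* C} (h : IsAlgOver σ f) (h' : IsAlgOver σ' f')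
    (hσ : σ = σ') (hf : ∀ x, f x = f' x) (x : Tot R B) : totMap h x = totMap h' x := by
  obtain rfl := hσ
  obtain rfl : f = f' := RingHom.ext hf
  rfl

theorem sub_mem_boundaries_of_mk_eq {R : Type u} [CommRing R] {B : Type v} [Ring B] [Algebra R B]
    {n : ℤ} {x y : cycles R B n} (h : HC.mk R B n x = HC.mk R B n y) :
    (x : Tot R B) - y ∈ boundaries R B n :=
  (Submodule.Quotient.eq ((boundaries R B n).submoduleOf (cycles R B n))).1 h

variable {k : Type u} [Field k] {A : Type w} [Ring A] [Algebra k A]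
variable {R : Type v} [CommRing R] [Algebra k R] [IsLocalRing R] [Nilp k R]

/-! ### The groupoids -/

/-- Modulo `m` the map is the identity of `A`, and its target is flat. -/
theorem algHom_bijective {B B' : Type*} [Ring B] [Algebra R B] [Ring B'] [Algebra R B']
    [Module.Flat R B'] {s : B →+* A} {s' : B' →+* A} {hs : IsAlgOver (aug k R : R →+* k) s}
    {hs' : IsAlgOver (aug k R : R →+* k) s'} (h : IsReduction hs) (h' : IsReduction hs')
    {φ : B →ₐ[R] B'} (hφ : ∀ x, s' (φ x) = s x) : Function.Bijective φ :=
  bijective_of_nilpotent (isNilpotent_maximalIdeal k R) (f := φ.toLinearMap)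
    (p := s.toAddMonoidHom) (q := s'.toAddMonoidHom) hφ h.surjective
    (fun _ hx => h.mem_smul_top hx) (fun _ hy => h'.mem_smul_top hy)

theorem DefHom.isIso {d : ℕ} {η₀ : HC k A d} {X Y : DefObj k A R d η₀} (f : X ⟶ Y) : IsIso f := by
  have := Y.flat
  let f' : DefHom X Y := f
  let e : X.B ≃ₐ[R] Y.B := AlgEquiv.ofBijective f'.φ
    (algHom_bijective X.isReduction Y.isReduction f'.comm)
  let g : DefHom Y X :=
    { φ := e.symm.toAlgHom
      comm := fun y => by
        obtain ⟨x, rfl⟩ := e.surjective y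
        refine Eq.trans ?_ (f'.comm x).symm
        exact congrArg X.s (e.symm_apply_apply x)
      map_η := by
        rw [← f'.map_η]
        refine (HC.map_comp (isAlgOver_algHom e.symm.toAlgHom) (isAlgOver_algHom f'.φ) d _).symm.trans ?_
        obtain ⟨x, hx⟩ := Submodule.mkQ_surjective _ X.η
        rw [← hx]
        refine congrArg (HC.mk R X.B d) (Subtype.ext ?_)
        exact (totMap_congr _ (isAlgOver_algHom (AlgHom.id R X.B)) rfl
          (fun x => e.symm_apply_apply x) _).trans (totMap_algHom_id _) }
  refine ⟨g, ?_, ?_⟩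
  · exact DefHom.ext (AlgHom.ext fun x => e.symm_apply_apply x)
  · exact DefHom.ext (AlgHom.ext fun x => e.apply_symm_apply x)

theorem FlatHom.isIso {d : ℕ} {η₀ : cycles k A d} {X Y : FlatObj k A R d η₀} (f : X ⟶ Y) :
    IsIso f := by
  have := Y.flat
  let f' : FlatHom X Y := f
  let e : X.Alg ≃ₐ[R] Y.Alg := AlgEquiv.ofBijective f'.φ
    (algHom_bijective X.red_isReduction Y.red_isReduction f'.φ_mod_m)
  have he (x : Tot R X.Alg) : totMap (isAlgOver_algHom e.symm.toAlgHom)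
      (totMap (isAlgOver_algHom f'.φ) x) = x := by
    rw [← totMap_algHom_comp]
    exact (totMap_congr _ (isAlgOver_algHom (AlgHom.id R X.Alg)) rfl
      (fun x => e.symm_apply_apply x) _).trans (totMap_algHom_id _)
  have he' (y : Tot R Y.Alg) : totMap (isAlgOver_algHom f'.φ)
      (totMap (isAlgOver_algHom e.symm.toAlgHom) y) = y := by
    rw [← totMap_algHom_comp]
    exact (totMap_congr _ (isAlgOver_algHom (AlgHom.id R Y.Alg)) rfl
      (fun y => e.apply_symm_apply y) _).trans (totMap_algHom_id _)
  let g : FlatHom Y X :=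
    { φ := e.symm.toAlgHom
      φ_mod_m := fun y => by
        obtain ⟨x, rfl⟩ := e.surjective y
        refine Eq.trans ?_ (f'.φ_mod_m x).symm
        exact congrArg X.red (e.symm_apply_apply x)
      -- The composition law forces the inverse of `(φ, ξ)` to be `(φ⁻¹, -φ⁻¹(ξ))`.
      ξ := -ccMap (isAlgOver_algHom e.symm.toAlgHom) (d + 1) f'.ξ
      ξ_mem := Submodule.neg_mem _ (ccMap_mem_smul_top e.symm.toAlgHom _ _ f'.ξ_mem)
      d_ξ := by
        rw [Submodule.coe_neg, map_neg, coe_ccMap, cyclicD_totMap, f'.d_ξ, map_sub, he, neg_sub] }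
  refine ⟨g, ?_, ?_⟩
  · refine FlatHom.ext (AlgHom.ext fun x => e.symm_apply_apply x) ?_
    change ccMap (isAlgOver_algHom e.symm.toAlgHom) (d + 1) f'.ξ +
      -ccMap (isAlgOver_algHom e.symm.toAlgHom) (d + 1) f'.ξ = 0
    rw [add_neg_cancel]
  · refine FlatHom.ext (AlgHom.ext fun x => e.apply_symm_apply x) ?_
    change ccMap (isAlgOver_algHom f'.φ) (d + 1)
      (-ccMap (isAlgOver_algHom e.symm.toAlgHom) (d + 1) f'.ξ) + f'.ξ = 0
    rw [map_neg, neg_add_eq_zero]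
    exact Subtype.ext (he' _)

/-! ### Trivializations -/

theorem sub_one_tmul_modM_mem (x : R ⊗[k] A) :
    x - 1 ⊗ₜ modM k A R x ∈ IsLocalRing.maximalIdeal R • (⊤ : Submodule R (R ⊗[k] A)) := by
  induction x using TensorProduct.induction_on with
  | zero => simp
  | tmul r a =>
    have : r ⊗ₜ[k] a - 1 ⊗ₜ modM k A R (r ⊗ₜ a) =
        (r - algebraMap k R (aug k R r)) • ((1 : R) ⊗ₜ[k] a) := by
      rw [modM_tmul, ← TensorProduct.smul_tmul, sub_smul, TensorProduct.smul_tmul',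
        TensorProduct.smul_tmul', smul_eq_mul, mul_one, smul_eq_mul, mul_one,
        Algebra.algebraMap_eq_smul_one]
    rw [this]
    exact Submodule.smul_mem_smul (sub_algebraMap_aug_mem r) trivial
  | add x y hx hy =>
    rw [map_add, TensorProduct.tmul_add, add_sub_add_comm]
    exact Submodule.add_mem _ hx hy

/-- A reduction has a `k`-linear section that preserves the unit. -/
theorem IsReduction.exists_section {B : Type*} [Ring B] [Algebra R B] [Module k B]
    [IsScalarTower k R B] {s : B →+* A} {hs : IsAlgOver (aug k R : R →+* k) s}
    (h : IsReduction hs) : ∃ σ : A →ₗ[k] B, σ 1 = 1 ∧ ∀ a, s (σ a) = a := by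
  let s' : B →ₗ[k] A :=
    { toFun := s
      map_add' := map_add s
      map_smul' := fun c x => by
        rw [← algebraMap_smul R c x, hs.map_smul]
        exact congrArg (· • s x) ((aug k R).commutes c) }
  obtain ⟨σ, hσ⟩ := LinearMap.exists_rightInverse_of_surjective s'
    (LinearMap.range_eq_top.2 h.surjective)
  have hσ' (a : A) : s (σ a) = a := LinearMap.congr_fun hσ a
  -- If `A = 0` then `B = m B`, so `B = 0` and any section is unital.
  by_cases h1 : (1 : A) = 0
  · have hA (a : A) : a = 0 := by rw [← mul_one a, h1, mul_zero]
    have hB : (⊤ : Submodule R B) ≤ ⊥ :=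
      le_of_le_sup_smul_of_nilpotent (isNilpotent_maximalIdeal k R) fun x _ => by
        rw [bot_sup_eq]
        exact h.mem_smul_top (hA _)
    have hB' (x : B) : x = 0 := hB (Submodule.mem_top (x := x))
    exact ⟨σ, by rw [hB' 1, hB' (σ 1)], hσ'⟩
  · obtain ⟨ℓ, hℓ⟩ := LinearMap.exists_leftInverse_of_injective (LinearMap.toSpanSingleton k A 1)
      (LinearMap.ker_toSpanSingleton k h1)
    have hℓ1 : ℓ 1 = 1 := by simpa using LinearMap.congr_fun hℓ 1
    -- The error `1 - σ 1` lies in the kernel of the reduction, so adding it along a form `ℓ` with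
    -- `ℓ 1 = 1` repairs the unit and keeps a section.
    refine ⟨σ + ℓ.smulRight (1 - σ 1), ?_, fun a => ?_⟩
    · simp [hℓ1]
    · have : s' ((σ + ℓ.smulRight (1 - σ 1)) a) = a := by
        rw [LinearMap.add_apply, LinearMap.smulRight_apply, map_add, map_smul, map_sub]
        change s (σ a) + ℓ a • (s 1 - s (σ 1)) = a
        rw [hσ', hσ', map_one, sub_self, smul_zero, add_zero]
      exact this

/-- The product on `A ⊗ R` transported along a linear isomorphism to a deformation of `A`. -/
def InvMul.ofEquiv {B : Type*} [Ring B] [Algebra R B] {s : B →+* A} (e : R ⊗[k] A ≃ₗ[R] B)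
    (he1 : e (1 ⊗ₜ 1) = 1) (hes : ∀ x, s (e x) = modM k A R x) : InvMul k A R where
  μ := -((LinearMap.mul R B).compl₁₂ e.toLinearMap e.toLinearMap).compr₂ e.symm.toLinearMap
  assoc x y z := by simp [mul_assoc]
  one_mul x := by simp [he1]
  mul_one x := by simp [he1]
  mod_m x y := by simp [← hes]

/-- The isomorphism of algebras underlying the transport of the product. -/
def InvMul.ofEquivAlgEquiv {B : Type*} [Ring B] [Algebra R B] {s : B →+* A}
    (e : R ⊗[k] A ≃ₗ[R] B) (he1 : e (1 ⊗ₜ 1) = 1) (hes : ∀ x, s (e x) = modM k A R x) :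
    (InvMul.ofEquiv e he1 hes).Alg ≃ₐ[R] B :=
  AlgEquiv.ofLinearEquiv ((InvMul.ofEquiv e he1 hes).valLinearEquiv.trans e) he1 fun x y => by
    change e (-(InvMul.ofEquiv e he1 hes).μ x.val y.val) = e x.val * e y.val
    simp [InvMul.ofEquiv]

/-- Every flat deformation of `A` is isomorphic to some `(A ⊗ R, -μ)`. -/
theorem IsReduction.exists_algEquiv {B : Type*} [Ring B] [Algebra R B] [Module.Flat R B]
    {s : B →+* A} {hs : IsAlgOver (aug k R : R →+* k) s} (h : IsReduction hs) :
    ∃ (M : InvMul k A R) (e : M.Alg ≃ₐ[R] B), ∀ x, s (e x) = M.red x := by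
  let _ : Module k B := Module.compHom B (algebraMap k R)
  have : IsScalarTower k R B := ⟨fun c r x =>
    (congrArg (· • x) (Algebra.smul_def c r)).trans (mul_smul (algebraMap k R c) r x)⟩
  obtain ⟨σ, hσ1, hσ⟩ := h.exists_section
  let E : R ⊗[k] A →ₗ[R] B := σ.liftBaseChange R
  have hE (r : R) (a : A) : E (r ⊗ₜ a) = r • σ a := LinearMap.liftBaseChange_tmul ..
  have hsE (x : R ⊗[k] A) : s (E x) = modM k A R x := by
    induction x using TensorProduct.induction_on with
    | zero => simp
    | tmul r a => rw [hE, hs.map_smul, hσ, modM_tmul]; rfl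
    | add x y hx hy => rw [map_add, map_add, hx, hy, map_add]
  have hbij : Function.Bijective E :=
    bijective_of_nilpotent (isNilpotent_maximalIdeal k R) (p := (modM k A R).toAddMonoidHom)
      (q := s.toAddMonoidHom) hsE (fun a => ⟨1 ⊗ₜ a, by simp⟩)
      (fun x hx => by
        have := sub_one_tmul_modM_mem x
        rwa [show modM k A R x = 0 from hx, TensorProduct.tmul_zero, sub_zero] at this)
      (fun _ hy => h.mem_smul_top hy)
  exact ⟨InvMul.ofEquiv (LinearEquiv.ofBijective E hbij) ((hE 1 1).trans (by rw [hσ1, one_smul])) hsE,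
    InvMul.ofEquivAlgEquiv _ _ _, fun x => hsE x.val⟩

/-! ### The functor -/

theorem flatToDef_essSurj {d : ℕ} {η₀ : HC k A d} {ηhat : cycles k A d}
    (hη : HC.mk k A d ηhat = η₀) : (flatToDef (R := R) hη).EssSurj := by
  refine ⟨fun Y => ?_⟩
  have := Y.flat
  obtain ⟨M, e, he⟩ := Y.isReduction.exists_algEquiv
  obtain ⟨η', hη'⟩ := Submodule.mkQ_surjective _ (HC.map (isAlgOver_algHom e.symm.toAlgHom) d Y.η)
  change HC.mk R M.Alg d η' = _ at hη'
  have hback : HC.map (isAlgOver_algHom e.toAlgHom) d (HC.mk R M.Alg d η') = Y.η := by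
    rw [hη']
    refine (HC.map_comp (isAlgOver_algHom e.toAlgHom) (isAlgOver_algHom e.symm.toAlgHom) d _).symm.trans ?_
    obtain ⟨x, hx⟩ := Submodule.mkQ_surjective _ Y.η
    rw [← hx]
    refine congrArg (HC.mk R Y.B d) (Subtype.ext ?_)
    exact (totMap_congr _ (isAlgOver_algHom (AlgHom.id R Y.B)) rfl
      (fun x => e.apply_symm_apply x) _).trans (totMap_algHom_id _)
  have hred : HC.mk k A d (cyclesMap M.red_isAlgOver d η') = HC.mk k A d ηhat := by
    rw [hη, ← Y.map_η, ← hback, HC.map_mk]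
    refine congrArg (HC.mk k A d) (Subtype.ext ?_)
    refine Eq.trans ?_ (totMap_comp Y.isAlgOver (isAlgOver_algHom e.toAlgHom) _)
    exact totMap_congr _ _ rfl (fun x => (he x).symm) _
  -- The reduction of `η'` agrees with `ηhat` only up to the boundary of `ξ₀`. Subtracting the
  -- boundary of a lift `ξ` of `ξ₀` gives a homologous cycle whose reduction is exactly `ηhat`.
  obtain ⟨ξ₀, hξ₀, hDξ₀⟩ := sub_mem_boundaries_of_mk_eq hred
  obtain ⟨ξ, hξ, rfl⟩ := exists_mem_CC_totMap_eq M.red_isAlgOver aug_surjective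
    M.red_isReduction.surjective hξ₀
  let X : FlatObj k A R d ηhat :=
    { M with
      η := ⟨η'.1 - cyclicD R M.Alg ξ, Submodule.sub_mem _ η'.2.1 (cyclicD_mem_CC hξ)⟩
      closed := by
        change cyclicD R M.Alg (η'.1 - cyclicD R M.Alg ξ) = 0
        rw [map_sub, cyclicD_cyclicD, sub_zero]
        exact η'.2.2
      η_mod_m := by
        change totMap M.red_isAlgOver (η'.1 - cyclicD R M.Alg ξ) = _
        rw [map_sub, ← cyclicD_totMap, hDξ₀]
        exact sub_sub_cancel _ _ }
  let f : DefHom (X.toDefObj hη) Y :=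
    DefHom.mk (X := X.toDefObj hη) e.toAlgHom he (by
      refine Eq.trans (congrArg _ ?_) hback
      exact (HC.mk_eq_mk ⟨ξ, hξ, (sub_sub_cancel _ _).symm⟩).symm)
  have : IsIso (X := (flatToDef (R := R) hη).obj X) (Y := Y) f := DefHom.isIso f
  exact ⟨X, ⟨asIso (X := (flatToDef (R := R) hη).obj X) (Y := Y) f⟩⟩

/-- Here the unital section `a ↦ 1 ⊗ a` is at hand, so the kernel of the reduction is known in each
chain degree, and finite generation of `m` assembles the components. -/
theorem InvMul.mem_smul_top_of_totMap_eq_zero (M : InvMul k A R) {n : ℤ} {ξ : CC R M.Alg n}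
    (h : totMap M.red_isAlgOver (ξ : Tot R M.Alg) = 0) :
    ξ ∈ IsLocalRing.maximalIdeal R • (⊤ : Submodule R (CC R M.Alg n)) := by
  refine mem_smul_top_CC (fg_maximalIdeal k R) fun m => ?_
  refine mem_smul_top_of_nchainMap_eq_zero M.red_isReduction (σ := fun a => ⟨1 ⊗ₜ a⟩)
    (fun a a' => congrArg Alg.of (TensorProduct.tmul_add _ _ _))
    (fun c a => congrArg Alg.of ?_) rfl (fun a => ?_) (congrFun h m)
  · change 1 ⊗ₜ (c • a) = algebraMap k R c • ((1 : R) ⊗ₜ[k] a)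
    rw [TensorProduct.tmul_smul, algebraMap_smul]
  · change modM k A R (1 ⊗ₜ a) = a
    simp

theorem flatToDef_full {d : ℕ} {η₀ : HC k A d} (hA : IsCalabiYau d η₀) {ηhat : cycles k A d}
    (hη : HC.mk k A d ηhat = η₀) : (flatToDef (R := R) hη).Full := by
  refine ⟨fun {X Y} f => ?_⟩
  let f' : DefHom (X.toDefObj hη) (Y.toDefObj hη) := f
  let φ : X.Alg →ₐ[R] Y.Alg := f'.φ
  have hφ (x : X.Alg) : Y.red (φ x) = X.red x := f'.comm x
  obtain ⟨ξ, hξ, hDξ⟩ : (totMap (isAlgOver_algHom φ) (X.η : Tot R X.Alg)) - Y.η ∈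
      boundaries R Y.Alg d :=
    sub_mem_boundaries_of_mk_eq (x := cyclesMap (isAlgOver_algHom φ) d X.cycle) f'.map_η
  -- Since `φ` is the identity modulo `m`, both `φ(η₁)` and `η₂` reduce to `ηhat`, and their
  -- difference reduces to zero.
  have hred : cyclicD k A (totMap Y.red_isAlgOver ξ) = 0 := by
    rw [cyclicD_totMap, hDξ, map_sub, Y.η_mod_m, ← X.η_mod_m, sub_eq_zero]
    refine (totMap_comp Y.red_isAlgOver (isAlgOver_algHom φ) _).symm.trans ?_
    exact totMap_congr _ _ rfl hφ _
  -- This is where the Calabi-Yau condition enters: the reduction of `ξ` is a boundary. Correcting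
  -- `ξ` by the boundary of a lift of the primitive `y` leaves its own boundary unchanged and makes
  -- it vanish modulo `m`.
  obtain ⟨y, hy, hDy⟩ := exists_cyclicD_eq (fun n hn => exists_b_eq_of_isCalabiYau hA hn)
    (totMap_mem_CC Y.red_isAlgOver hξ) hred
  obtain ⟨ζ, hζ, rfl⟩ := exists_mem_CC_totMap_eq Y.red_isAlgOver aug_surjective
    Y.red_isReduction.surjective hy
  let g : FlatHom X Y :=
    { φ := φ
      φ_mod_m := hφ
      ξ := ⟨ξ - cyclicD R Y.Alg ζ, Submodule.sub_mem _ hξ (cyclicD_mem_CC hζ)⟩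
      ξ_mem := Y.toInvMul.mem_smul_top_of_totMap_eq_zero (by
        change totMap Y.red_isAlgOver (ξ - cyclicD R Y.Alg ζ) = 0
        rw [map_sub, ← cyclicD_totMap, hDy, sub_self])
      d_ξ := by
        change cyclicD R Y.Alg (ξ - cyclicD R Y.Alg ζ) = _
        rw [map_sub, cyclicD_cyclicD, sub_zero, hDξ] }
  exact ⟨g, rfl⟩

end CYDef

end

theorem proposition6p2 {k : Type*} [Field k] [CharZero k] {A : Type*} [Ring A] [Algebra k A]
    (d : ℕ) (η₀ : CYDef.HC k A d) (hA : CYDef.IsCalabiYau d η₀)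
    (ηhat : CYDef.cycles k A d) (hη : CYDef.HC.mk k A d ηhat = η₀)
    (R : Type*) [CommRing R] [Algebra k R] [IsLocalRing R] [CYDef.Nilp k R] :
    CategoryTheory.IsGroupoid (CYDef.FlatObj k A R d ηhat) ∧
    CategoryTheory.IsGroupoid (CYDef.DefObj k A R d η₀) ∧
    (CYDef.flatToDef (R := R) hη).EssSurj ∧
    (CYDef.flatToDef (R := R) hη).Full :=
  ⟨⟨fun f => CYDef.FlatHom.isIso f⟩, ⟨fun f => CYDef.DefHom.isIso f⟩,
    CYDef.flatToDef_essSurj hη, CYDef.flatToDef_full hA hη⟩
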